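/- **Conventions.** A group $G$ has *decidable power coset membership problem* if $G$ is finitely generated and, with respect to a finite generating family $s_1,\dots,s_n$ of $G$, there is an algorithm that, given words in the letters $s_i^{\pm1}$ representing elements $x,g\in G$ and $h_1,\dots,h_k\in G$, decides whether there is a non-zero integer $m$ with $g^m\in xH$, where $H=\langle h_1,\dots,h_k\rangle$. (This does not depend on the choice of the finite generating family.) A *graph* consists of a set $V$ of vertices, a set $E$ of edges, maps $o,t:E\to V$, and a fixed-point free involution $e\mapsto e^{-1}$ of $E$ with $o(e)=t(e^{-1})$. A *graph of groups* $\mathbb A$ consists of a graph together with a group $A_v$ for each vertex $v$, a group $A_e$ for each edge $e$, with $A_{e^{-1}}=A_e$, and monomorphisms $\alpha_e:A_e\to A_{o(e)}$ and $\omega_e:A_e\to A_{t(e)}$ with $\alpha_{e^{-1}}=\omega_e$. For a vertex $v_0$, the *fundamental group* $\pi_1(\mathbb A,v_0)$ is the group, under concatenation, of equivalence classes of loops $\langle p_0,e_1,p_1,\dots,e_n,p_n\rangle$ based at $v_0$ (where $(e_1,\dots,e_n)$ is an edge path from $v_0$ to $v_0$, $p_0\in A_{v_0}$ and $p_i\in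 A_{t(e_i)}$); the equivalence relation is generated by the elementary reductions, which replace a subpath $\langle a,e,\omega_e(c),e^{-1},b\rangle$ with $c\in A_e$ by $\langle a\,\alpha_e(c)\,b\rangle$. **Statement.** Let $\mathbb A$ be a graph of groups whose underlying graph has finitely many vertices and edges, and let $v_0$ be a vertex. Suppose that every edge group of $\mathbb A$ is finite and that every vertex group of $\mathbb A$ is finitely generated and has decidable power coset membership problem. Then $G=\pi_1(\mathbb A,v_0)$ is finitely generated and has decidable power coset membership problem. -/

import Mathlib

open scoped Pointwise

universe u v w x

/-! ### Graphs of groups -/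

/-- A graph in the sense of Serre: a set `V` of vertices, sets `a ⟶ b` of edges `e` with `o(e) = a`
and `t(e) = b`, and a fixed-point free involution `e ↦ e⁻¹` (written `Quiver.reverse e`) exchanging
origin and terminus. Loops and multiple edges are allowed. -/
class SerreGraph (V : Type u) extends Quiver.{v} V, Quiver.HasInvolutiveReverse V where
  /-- No edge is its own inverse. (An edge `e` with `e⁻¹ = e` must have equal endpoints.) -/
  reverse_ne : ∀ {a : V} (e : a ⟶ a), Quiver.reverse e ≠ e

set_option linter.checkUnivs false in
/-- A graph of groups with underlying graph `V`: a group for each vertex, a group for each edge and,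
for each edge `e`, monomorphisms `α e`, `ω e` from the edge group to the vertex groups at the origin
and at the terminus of `e`. The edge groups of `e` and `e⁻¹` are identified through `rev e`, and
under this identification `α e⁻¹ = ω e` and `ω e⁻¹ = α e`. -/
structure GraphOfGroups (V : Type u) [SerreGraph.{u, v} V] where
  /-- The vertex groups. -/
  vertexGroup : V → Type w
  [vertexInst : ∀ a, Group (vertexGroup a)]
  /-- The edge groups. -/
  edgeGroup : ∀ {a b : V}, (a ⟶ b) → Type x
  [edgeInst : ∀ {a b : V} (e : a ⟶ b), Group (edgeGroup e)]
  /-- The boundary monomorphism into the vertex group at the origin. -/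
  α : ∀ {a b : V} (e : a ⟶ b), edgeGroup e →* vertexGroup a
  /-- The boundary monomorphism into the vertex group at the terminus. -/
  ω : ∀ {a b : V} (e : a ⟶ b), edgeGroup e →* vertexGroup b
  α_injective : ∀ {a b : V} (e : a ⟶ b), Function.Injective (α e)
  ω_injective : ∀ {a b : V} (e : a ⟶ b), Function.Injective (ω e)
  /-- The identification of the edge group of `e` with the edge group of `e⁻¹`. -/
  rev : ∀ {a b : V} (e : a ⟶ b), edgeGroup e ≃* edgeGroup (Quiver.reverse e)
  α_rev : ∀ {a b : V} (e : a ⟶ b) (c : edgeGroup e), α (Quiver.reverse e) (rev e c) = ω e c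
  ω_rev : ∀ {a b : V} (e : a ⟶ b) (c : edgeGroup e), ω (Quiver.reverse e) (rev e c) = α e c

namespace GraphOfGroups

variable {V : Type u} [SerreGraph.{u, v} V] (A : GraphOfGroups.{u, v, w, x} V)

instance instGroupVertexGroup (a : V) : Group (A.vertexGroup a) := A.vertexInst a

instance instGroupEdgeGroup {a b : V} (e : a ⟶ b) : Group (A.edgeGroup e) := A.edgeInst e

/-- Paths `⟨p₀, e₁, p₁, …, eₙ, pₙ⟩` in a graph of groups, from a vertex `a` to a vertex `b`: an edge
path `e₁, …, eₙ` from `a` to `b`, with `p₀` in the group of `a` and `pᵢ` in the group of the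
terminus of `eᵢ`. -/
inductive GPath : V → V → Type (max u v w)
  /-- The path `⟨g⟩` without edges. -/
  | nil {a : V} (g : A.vertexGroup a) : GPath a a
  /-- The path `⟨g, e, p₀, e₁, p₁, …⟩`, where `p = ⟨p₀, e₁, p₁, …⟩`. -/
  | cons {a b c : V} (g : A.vertexGroup a) (e : a ⟶ b) (p : GPath b c) : GPath a c

namespace GPath

variable {A}

/-- `g · ⟨p₀, e₁, p₁, …⟩ = ⟨g p₀, e₁, p₁, …⟩`. -/
def lmul : {a b : V} → A.vertexGroup a → A.GPath a b → A.GPath a b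
  | _, _, g, nil h => nil (g * h)
  | _, _, g, cons h e p => cons (g * h) e p

/-- Concatenation:
`⟨p₀, e₁, …, eₙ, pₙ⟩ ⟨q₀, f₁, …, q_m⟩ = ⟨p₀, e₁, …, eₙ, pₙ q₀, f₁, …, q_m⟩`. -/
def append : {a b c : V} → A.GPath a b → A.GPath b c → A.GPath a c
  | _, _, _, nil g, q => lmul g q
  | _, _, _, cons g e p, q => cons g e (append p q)

/-- The inverse path `⟨pₙ⁻¹, eₙ⁻¹, …, e₁⁻¹, p₀⁻¹⟩`. -/
def inv : {a b : V} → A.GPath a b → A.GPath b a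
  | _, _, nil g => nil g⁻¹
  | _, _, cons g e p => append (inv p) (cons 1 (Quiver.reverse e) (nil g⁻¹))

/-- Elementary reductions: a subpath `⟨g, e, ω e c, e⁻¹, h⟩`, at any place of a path, is replaced
by `⟨g (α e c) h⟩`. -/
inductive Red : {a b : V} → A.GPath a b → A.GPath a b → Prop
  /-- The reduction takes place at the first edge of the path. -/
  | head {a b d : V} (g : A.vertexGroup a) (e : a ⟶ b) (c : A.edgeGroup e) (p : A.GPath a d) :
      Red (cons g e (cons (A.ω e c) (Quiver.reverse e) p)) (lmul (g * A.α e c) p)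
  /-- The reduction takes place after the first edge of the path. -/
  | tail {a b d : V} (g : A.vertexGroup a) (e : a ⟶ b) {p q : A.GPath b d} :
      Red p q → Red (cons g e p) (cons g e q)

/-- The equivalence relation on paths generated by the elementary reductions. -/
def Equiv {a b : V} (p q : A.GPath a b) : Prop := Relation.EqvGen Red p q

theorem Equiv.refl {a b : V} (p : A.GPath a b) : Equiv p p := Relation.EqvGen.refl p

theorem Equiv.symm {a b : V} {p q : A.GPath a b} (h : Equiv p q) : Equiv q p :=
  Relation.EqvGen.symm _ _ h

theorem Equiv.trans {a b : V} {p q r : A.GPath a b} (h : Equiv p q) (h' : Equiv q r) :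
    Equiv p r :=
  Relation.EqvGen.trans _ _ _ h h'

theorem Red.equiv {a b : V} {p q : A.GPath a b} (h : Red p q) : Equiv p q :=
  Relation.EqvGen.rel _ _ h

theorem Equiv.map {a b c d : V} (f : A.GPath a b → A.GPath c d)
    (hf : ∀ p q, Red p q → Red (f p) (f q)) {p q : A.GPath a b} (h : Equiv p q) :
    Equiv (f p) (f q) := by
  induction h with
  | rel p q h => exact (hf p q h).equiv
  | refl p => exact Equiv.refl _
  | symm p q _ ih => exact ih.symm
  | trans p q r _ _ ih₁ ih₂ => exact ih₁.trans ih₂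

theorem lmul_cons {a b c : V} (g h : A.vertexGroup a) (e : a ⟶ b) (p : A.GPath b c) :
    lmul g (cons h e p) = cons (g * h) e p := rfl

theorem lmul_lmul {a b : V} (g h : A.vertexGroup a) (p : A.GPath a b) :
    lmul g (lmul h p) = lmul (g * h) p := by
  cases p <;> simp [lmul, mul_assoc]

theorem one_lmul {a b : V} (p : A.GPath a b) : lmul 1 p = p := by
  cases p <;> simp [lmul]

theorem lmul_append {a b c : V} (g : A.vertexGroup a) (p : A.GPath a b) (q : A.GPath b c) :
    append (lmul g p) q = lmul g (append p q) := by
  cases p with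
  | nil h => exact (lmul_lmul g h q).symm
  | cons h e p => rfl

theorem append_assoc {a b c d : V} (p : A.GPath a b) (q : A.GPath b c) (r : A.GPath c d) :
    append (append p q) r = append p (append q r) := by
  induction p with
  | nil g => simp [append, lmul_append]
  | cons g e p ih => simp [append, ih]

theorem append_one {a b : V} (p : A.GPath a b) : append p (nil 1) = p := by
  induction p with
  | nil g => simp [append, lmul]
  | cons g e p ih => simp [append, ih]

theorem Red.lmul {a b : V} (g : A.vertexGroup a) {p q : A.GPath a b} (h : Red p q) :
    Red (lmul g p) (lmul g q) := by
  cases h with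
  | head k e c p =>
    have := Red.head (g * k) e c p
    rw [lmul_cons, lmul_lmul, ← mul_assoc]
    exact this
  | tail k e h => exact Red.tail (g * k) e h

theorem Red.append_left {a b c : V} (p : A.GPath a b) {q r : A.GPath b c} (h : Red q r) :
    Red (append p q) (append p r) := by
  induction p with
  | nil g => exact h.lmul g
  | cons g e p ih => exact Red.tail g e (ih h)

theorem Red.append_right {a b c : V} {p q : A.GPath a b} (h : Red p q) (r : A.GPath b c) :
    Red (append p r) (append q r) := by
  induction h with
  | head g e c p =>
    rw [lmul_append]
    exact Red.head g e c (append p r)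
  | tail g e _ ih => exact Red.tail g e (ih r)

theorem Equiv.append {a b c : V} {p p' : A.GPath a b} {q q' : A.GPath b c}
    (hp : Equiv p p') (hq : Equiv q q') : Equiv (append p q) (append p' q') :=
  (hp.map (fun r => GPath.append r q) fun _ _ h => h.append_right q).trans
    (hq.map (fun r => GPath.append p' r) fun _ _ h => h.append_left p')

theorem append_inv {a b : V} (p : A.GPath a b) : Equiv (append p (inv p)) (nil 1) := by
  induction p with
  | nil g => simpa [append, inv, lmul] using Equiv.refl _
  | @cons a b d g e p ih =>
    have h₁ : Equiv (append (append p (inv p)) (cons 1 (Quiver.reverse e) (nil g⁻¹)))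
        (cons (A.ω e 1) (Quiver.reverse e) (nil g⁻¹)) := by
      have := ih.append (Equiv.refl (cons 1 (Quiver.reverse e) (nil g⁻¹)))
      simpa [append, lmul] using this
    have h₂ := h₁.map (cons g e) fun _ _ h => Red.tail g e h
    have h₃ := h₂.trans (Red.head g e 1 (nil g⁻¹)).equiv
    simpa [append, inv, lmul, append_assoc] using h₃

theorem inv_append {a b : V} (p : A.GPath a b) : Equiv (append (inv p) p) (nil 1) := by
  induction p with
  | nil g => simpa [append, inv, lmul] using Equiv.refl _
  | @cons a b d g e p ih =>
    have h := Red.head (1 : A.vertexGroup b) (Quiver.reverse e) 1 p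
    rw [Quiver.reverse_reverse] at h
    have h₂ := (h.append_left (inv p)).equiv.trans (by simpa [one_lmul] using ih)
    simpa [append, inv, lmul, append_assoc] using h₂

theorem Equiv.inv {a b : V} {p q : A.GPath a b} (h : Equiv p q) :
    Equiv (inv p) (inv q) := by
  have h₁ : Equiv (GPath.inv p) (GPath.append (GPath.inv p) (GPath.append q (GPath.inv q))) := by
    have := (Equiv.refl (GPath.inv p)).append (append_inv q)
    rw [append_one] at this
    exact this.symm
  have h₂ : Equiv (GPath.append (GPath.append (GPath.inv p) q) (GPath.inv q)) (GPath.inv q) := by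
    have h₃ : Equiv (GPath.append (GPath.inv p) q) (nil 1) :=
      ((Equiv.refl (GPath.inv p)).append h.symm).trans (inv_append p)
    have := h₃.append (Equiv.refl (GPath.inv q))
    simpa [GPath.append, one_lmul] using this
  rw [append_assoc] at h₂
  exact h₁.trans h₂

end GPath

/-- Equivalence of loops based at `v₀`. -/
def loopSetoid (v₀ : V) : Setoid (A.GPath v₀ v₀) where
  r := GPath.Equiv
  iseqv := ⟨GPath.Equiv.refl, GPath.Equiv.symm, GPath.Equiv.trans⟩

/-- The fundamental group `π₁(A, v₀)` of a graph of groups: equivalence classes of loops based at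
`v₀`, with concatenation. -/
def FundamentalGroup (v₀ : V) : Type (max u v w) := Quotient (A.loopSetoid v₀)

instance instGroupFundamentalGroup (v₀ : V) : Group (A.FundamentalGroup v₀) where
  mul := Quotient.map₂ GPath.append fun _ _ hp _ _ hq => GPath.Equiv.append hp hq
  one := Quotient.mk _ (GPath.nil 1)
  inv := Quotient.map GPath.inv fun _ _ h => GPath.Equiv.inv h
  mul_assoc := by
    rintro ⟨p⟩ ⟨q⟩ ⟨r⟩
    exact congrArg (Quotient.mk _) (GPath.append_assoc p q r)
  one_mul := by
    rintro ⟨p⟩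
    exact congrArg (Quotient.mk _) (GPath.one_lmul p)
  mul_one := by
    rintro ⟨p⟩
    exact congrArg (Quotient.mk _) (GPath.append_one p)
  inv_mul_cancel := by
    rintro ⟨p⟩
    exact Quotient.sound (GPath.inv_append p)

end GraphOfGroups

/-! ### The power coset membership problem -/

/-- The element of `G` that is represented by a word in the letters `sᵢ` (coded `(i, true)`) and
`sᵢ⁻¹` (coded `(i, false)`). -/
def wordValue {G : Type*} [Group G] {n : ℕ} (s : Fin n → G) (l : List (Fin n × Bool)) : G :=
  (l.map fun a => if a.2 then s a.1 else (s a.1)⁻¹).prod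

/-- The instance `(x, g, L)` of the power coset membership problem, where `x`, `g` and the members
of `L` are words in the letters `sᵢ`, `sᵢ⁻¹`, has the answer "yes": there is a non-zero integer `m`
with `g ^ m ∈ x H`, where `H` is the subgroup generated by the elements that `L` represents. -/
def PowerCosetInstance {G : Type*} [Group G] {n : ℕ} (s : Fin n → G)
    (I : List (Fin n × Bool) × List (Fin n × Bool) × List (List (Fin n × Bool))) : Prop :=
  ∃ m : ℤ, m ≠ 0 ∧
    wordValue s I.2.1 ^ m ∈
      wordValue s I.1 • (Subgroup.closure {h | ∃ l ∈ I.2.2, wordValue s l = h} : Set G)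

/-- `G` is finitely generated and its power coset membership problem is decidable: for a finite
generating family of `G`, there is an algorithm that decides the problem, its inputs being given as
words in the generators. (Rewriting words shows that the choice of the finite generating family is
immaterial.) -/
def DecidablePowerCosetMembership (G : Type*) [Group G] : Prop :=
  ∃ (n : ℕ) (s : Fin n → G), Subgroup.closure (Set.range s) = ⊤ ∧
    ComputablePred (PowerCosetInstance s)

/-! The problem is decidable because both it and its complement are recursively enumerable.

Positive instances. Equality of words in G is recursively enumerable: the relations of a vertex
group can be listed, since membership in the trivial subgroup is the power coset problem with
trivial g (`mem_wordSubgroup_iff_powerCoset`), and together with the relations of the elementary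
reductions they detect when a word spelling a loop is trivial (`PathWord.evalWord_eq_one_iff`). It
remains to search for an exponent and a product of generators of H
(`powerCoset_iff_exists_flatten`).

Negative instances. Write g = y c y⁻¹ with c a cyclically reduced loop or an element of a vertex
group (`exists_conj_cyclicallyReduced`), and put z = x⁻¹ y. Then g ^ m ∈ xH means z c ^ m y⁻¹ ∈ H,
that is, c ^ m takes the point Hz of the coset space H\G to Hy. The certificate is a finitely
described partial action of the graph of groups, modelled on a finite part of H\G, in which the
generators of H are loops at a base point from which z and y can be traced. It is sound for every
such partial action (`Refuted.not_powerCoset`), because a reduced path acts wherever some equivalent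
path acts (`PartialAction.Ev.of_equiv`): normalizing a reduced path only moves edge group elements
across edges. Since the powers of a cyclically reduced c are reduced, a solution m would have to
show up as a trace of a power of c. If c has no edges, such a trace is an instance of the problem in
a vertex group. Otherwise positive powers of c reach only finitely many points, because the edge
groups are finite (`finite_run_end`), and the finite list of these points shows that the target is
missed (`Evades`).

Certificates exist for all negative instances (`refuted_of_not_powerCoset`): one takes the part of
H\G traversed by y, z and the generators of H. The stabilizers of cosets in the vertex groups need
not be finitely generated, but only finitely many coincidences of points matter, so they may be
replaced by subgroups generated by finite lists. -/

/-! ### Primitive recursive functions -/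

section PrimrecFunProp

variable {α β γ σ : Type*} [Primcodable α] [Primcodable β] [Primcodable γ] [Primcodable σ]

theorem Primrec.fst_comp {f : α → β × γ} (hf : Primrec f) : Primrec fun a => (f a).1 :=
  Primrec.fst.comp hf

theorem Primrec.snd_comp {f : α → β × γ} (hf : Primrec f) : Primrec fun a => (f a).2 :=
  Primrec.snd.comp hf

theorem Primrec.append_comp {f g : α → List β} (hf : Primrec f) (hg : Primrec g) :
    Primrec fun a => f a ++ g a :=
  Primrec.list_append.comp hf hg

theorem Primrec.cons_comp {f : α → β} {g : α → List β} (hf : Primrec f) (hg : Primrec g) :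
    Primrec fun a => f a :: g a :=
  Primrec.list_cons.comp hf hg

theorem Primrec.some_comp {f : α → β} (hf : Primrec f) : Primrec fun a => some (f a) :=
  Primrec.option_some.comp hf

theorem Primrec.inl_comp {f : α → β} (hf : Primrec f) :
    Primrec fun a => (Sum.inl (f a) : β ⊕ γ) :=
  Primrec.sumInl.comp hf

theorem Primrec.inr_comp {f : α → γ} (hf : Primrec f) :
    Primrec fun a => (Sum.inr (f a) : β ⊕ γ) :=
  Primrec.sumInr.comp hf

attribute [fun_prop] Primrec
attribute [fun_prop] Primrec.id Primrec.const Primrec.comp Primrec.fst_comp Primrec.snd_comp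
  Primrec.pair Primrec.append_comp Primrec.cons_comp Primrec.some_comp Primrec.inl_comp
  Primrec.inr_comp

end PrimrecFunProp

/-! ### Runs of nondeterministic machines -/

section Run

variable {σ β : Type*}

/-- `Run R s l s'`: a machine with the transitions `R` can pass from the state `s` to the state
`s'` by reading `l`. -/
inductive Run (R : σ → β → σ → Prop) : σ → List β → σ → Prop
  | nil (s : σ) : Run R s [] s
  | cons {s s' s'' : σ} {b : β} {l : List β} : R s b s' → Run R s' l s'' → Run R s (b :: l) s''

theorem run_nil_iff {R : σ → β → σ → Prop} {s s' : σ} : Run R s [] s' ↔ s = s' :=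
  ⟨fun h => by cases h; rfl, fun h => h ▸ Run.nil s⟩

theorem run_cons_iff {R : σ → β → σ → Prop} {s s' : σ} {b : β} {l : List β} :
    Run R s (b :: l) s' ↔ ∃ t, R s b t ∧ Run R t l s' :=
  ⟨fun h => by cases h; exact ⟨_, ‹_›, ‹_›⟩, fun ⟨_, h, h'⟩ => Run.cons h h'⟩

theorem run_append_iff {R : σ → β → σ → Prop} {l l' : List β} {s s' : σ} :
    Run R s (l ++ l') s' ↔ ∃ t, Run R s l t ∧ Run R t l' s' := by
  induction l generalizing s with
  | nil => simp [run_nil_iff]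
  | cons b l ih =>
    simp only [List.cons_append, run_cons_iff, ih]
    exact ⟨fun ⟨t, h, t', h', h''⟩ => ⟨t', ⟨t, h, h'⟩, h''⟩,
      fun ⟨t', ⟨t, h, h'⟩, h''⟩ => ⟨t, h, t', h', h''⟩⟩

end Run

/-! ### Closure properties of recursively enumerable predicates -/

section REPred

variable {α β γ σ : Type*} [Primcodable α] [Primcodable β] [Primcodable γ] [Primcodable σ]

/-- A halting computation halts within some number of steps, and evaluation with a step bound
(`evaln`) is primitive recursive; conversely, a witness can be found by unbounded search. The
closure properties below become manipulations of such witnesses. -/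
theorem rePred_iff_exists_primrecRel {p : α → Prop} :
    REPred p ↔ ∃ R : α → ℕ → Prop, PrimrecRel R ∧ ∀ a, p a ↔ ∃ n, R a n := by
  constructor
  · intro h
    obtain ⟨c, hc⟩ := Nat.Partrec.Code.exists_code.1 h
    refine ⟨fun a n => (Nat.Partrec.Code.evaln n c (Encodable.encode a)).isSome = true, ?_, ?_⟩
    · have h₁ : Primrec fun x : α × ℕ => (Nat.Partrec.Code.evaln x.2 c (Encodable.encode x.1)) :=
        Nat.Partrec.Code.primrec_evaln.comp
          (((Primrec.snd.pair (Primrec.const c))).pair (Primrec.encode.comp Primrec.fst))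
      exact Primrec.eq.comp (Primrec.option_isSome.comp h₁) (Primrec.const true)
    · intro a
      have h₁ : p a ↔ (Nat.Partrec.Code.eval c (Encodable.encode a)).Dom := by
        rw [hc]
        simp [Part.assert]
      rw [h₁, Part.dom_iff_mem]
      constructor
      · rintro ⟨y, hy⟩
        obtain ⟨k, hk⟩ := Nat.Partrec.Code.evaln_complete.1 hy
        exact ⟨k, Option.isSome_iff_exists.2 ⟨y, hk⟩⟩
      · rintro ⟨k, hk⟩
        obtain ⟨y, hy⟩ := Option.isSome_iff_exists.1 hk
        exact ⟨y, Nat.Partrec.Code.evaln_sound hy⟩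
  · rintro ⟨R, hR, hp⟩
    obtain ⟨d, hd⟩ := hR
    have (a : α) (n : ℕ) : Decidable (R a n) := d (a, n)
    have h₁ : Partrec₂ fun (a : α) (n : ℕ) => (Part.some (decide (R a n)) : Part Bool) :=
      Computable.partrec (hd.to_comp.of_eq fun x => by congr)
    refine (Partrec.rfind h₁).dom_re.of_eq fun a => ?_
    rw [hp a]
    refine Iff.trans Nat.rfind_dom' ?_
    constructor
    · rintro ⟨n, hn, -⟩
      exact ⟨n, by simpa [eq_comm] using hn⟩
    · rintro ⟨n, hn⟩
      exact ⟨n, by simpa [eq_comm] using hn, fun _ => trivial⟩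

theorem PrimrecPred.rePred {p : α → Prop} (h : PrimrecPred p) : REPred p :=
  rePred_iff_exists_primrecRel.2 ⟨fun a _ => p a, h.comp Primrec.fst, fun a => by simp⟩

theorem REPred.comp {p : β → Prop} (h : REPred p) {f : α → β} (hf : Primrec f) :
    REPred fun a => p (f a) := by
  obtain ⟨R, hR, hp⟩ := rePred_iff_exists_primrecRel.1 h
  exact rePred_iff_exists_primrecRel.2
    ⟨fun a n => R (f a) n, hR.comp (hf.comp Primrec.fst) Primrec.snd, fun a => hp (f a)⟩

theorem REPred.eq {f g : α → β} (hf : Primrec f) (hg : Primrec g) : REPred fun a => f a = g a :=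
  PrimrecPred.rePred (Primrec.eq.comp hf hg)

theorem REPred.ne {f g : α → β} (hf : Primrec f) (hg : Primrec g) : REPred fun a => f a ≠ g a :=
  PrimrecPred.rePred (Primrec.eq.comp hf hg).not

theorem REPred.exists {p : α → β → Prop} (h : REPred fun x : α × β => p x.1 x.2) :
    REPred fun a => ∃ b, p a b := by
  obtain ⟨R, hR, hp⟩ := rePred_iff_exists_primrecRel.1 h
  refine rePred_iff_exists_primrecRel.2
    -- One number codes both a candidate for `b` and its step bound. The list has at most one member
    -- and is empty when decoding fails.
    ⟨fun a n => ∃ b ∈ (Encodable.decode (α := β) n.unpair.1).toList, R (a, b) n.unpair.2, ?_, ?_⟩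
  · have h₁ : PrimrecRel fun (b : β) (x : α × ℕ) => R (x.1, b) x.2 :=
      hR.comp ((Primrec.fst.comp Primrec.snd).pair Primrec.fst) (Primrec.snd.comp Primrec.snd)
    refine h₁.exists_mem_list.comp (f := fun x : α × ℕ => _)
      (g := fun x : α × ℕ => (x.1, x.2.unpair.2)) ?_ ?_
    · exact Primrec.optionToList.comp (Primrec.decode.comp
        (Primrec.fst.comp (Primrec.unpair.comp Primrec.snd)))
    · exact Primrec.fst.pair (Primrec.snd.comp (Primrec.unpair.comp Primrec.snd))
  · intro a
    constructor
    · rintro ⟨b, hb⟩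
      obtain ⟨n, hn⟩ := (hp (a, b)).1 hb
      exact ⟨Nat.pair (Encodable.encode b) n, b, by simp, by simpa using hn⟩
    · rintro ⟨n, b, -, hb⟩
      exact ⟨b, (hp (a, b)).2 ⟨_, hb⟩⟩

theorem REPred.and {p q : α → Prop} (hp : REPred p) (hq : REPred q) :
    REPred fun a => p a ∧ q a := by
  obtain ⟨R, hR, hp⟩ := rePred_iff_exists_primrecRel.1 hp
  obtain ⟨S, hS, hq⟩ := rePred_iff_exists_primrecRel.1 hq
  have h₁ : REPred fun a => ∃ x : ℕ × ℕ, R a x.1 ∧ S a x.2 :=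
    REPred.exists (PrimrecPred.rePred
      ((hR.comp Primrec.fst (Primrec.fst.comp Primrec.snd)).and
        (hS.comp Primrec.fst (Primrec.snd.comp Primrec.snd))))
  refine h₁.of_eq fun a => ?_
  rw [hp, hq]
  exact ⟨fun ⟨x, h, h'⟩ => ⟨⟨_, h⟩, _, h'⟩, fun ⟨⟨n, h⟩, m, h'⟩ => ⟨(n, m), h, h'⟩⟩

theorem REPred.or {p q : α → Prop} (hp : REPred p) (hq : REPred q) :
    REPred fun a => p a ∨ q a := by
  obtain ⟨R, hR, hp⟩ := rePred_iff_exists_primrecRel.1 hp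
  obtain ⟨S, hS, hq⟩ := rePred_iff_exists_primrecRel.1 hq
  refine rePred_iff_exists_primrecRel.2 ⟨fun a n => R a n ∨ S a n, PrimrecPred.or hR hS, ?_⟩
  intro a
  rw [hp, hq, ← exists_or]

/-- Finitely many witnesses lie below a common bound, here the sum of all of them plus one, and a
bounded quantifier stays primitive recursive. -/
theorem REPred.forall_mem {p : α → β → Prop} {f : α → List β}
    (h : REPred fun x : α × β => p x.1 x.2) (hf : Primrec f) : REPred fun a => ∀ b ∈ f a, p a b := by
  obtain ⟨R, hR, hp⟩ := rePred_iff_exists_primrecRel.1 h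
  refine rePred_iff_exists_primrecRel.2
    ⟨fun a N => ∀ b ∈ f a, ∃ n ∈ List.range N, R (a, b) n, ?_, fun a => ?_⟩
  · have h₁ : PrimrecRel fun (n : ℕ) (x : α × β) => R x n :=
      hR.comp Primrec.snd Primrec.fst
    have h₂ : PrimrecRel fun (b : β) (x : α × ℕ) => ∃ n ∈ List.range x.2, R (x.1, b) n :=
      PrimrecRel.comp (R := fun (l : List ℕ) x => ∃ n ∈ l, R x n)
        (f := fun y : β × α × ℕ => List.range y.2.2) (g := fun y => (y.2.1, y.1))
        h₁.exists_mem_list (Primrec.list_range.comp (by fun_prop)) (by fun_prop)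
    exact PrimrecRel.comp
      (R := fun (l : List β) (x : α × ℕ) => ∀ b ∈ l, ∃ n ∈ List.range x.2, R (x.1, b) n)
      (f := fun y : α × ℕ => f y.1) (g := fun y => y)
      h₂.forall_mem_list (by fun_prop) (by fun_prop)
  · constructor
    · intro h
      choose! n hn using fun b hb => (hp (a, b)).1 (h b hb)
      refine ⟨((f a).map n).sum + 1, fun b hb => ⟨n b, ?_, hn b hb⟩⟩
      rw [List.mem_range]
      exact Nat.lt_succ_of_le (List.le_sum_of_mem (List.mem_map_of_mem hb))
    · rintro ⟨N, h⟩ b hb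
      obtain ⟨n, -, hn⟩ := h b hb
      exact (hp (a, b)).2 ⟨n, hn⟩

theorem REPred.forall_finite [Finite β] {p : α → β → Prop}
    (h : REPred fun x : α × β => p x.1 x.2) : REPred fun a => ∀ b, p a b := by
  have := Fintype.ofFinite β
  refine (h.forall_mem (Primrec.const (Finset.univ : Finset β).toList)).of_eq fun a => ?_
  simp

theorem REPred.mem {f : α → List β} {g : α → β} (hf : Primrec f) (hg : Primrec g) :
    REPred fun a => g a ∈ f a := by
  have h₁ : REPred fun a => ∃ n : ℕ, (f a)[n]? = some (g a) :=
    REPred.exists (REPred.eq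
      (Primrec.list_getElem?.comp (hf.comp Primrec.fst) Primrec.snd) (by fun_prop))
  refine h₁.of_eq fun a => ?_
  rw [List.mem_iff_getElem?]

/-- `p i` may be any family of predicates, since the index set is finite. -/
theorem REPred.uncurry_finite [Finite β] {p : β → α → Prop} (h : ∀ b, REPred (p b)) :
    REPred fun x : α × β => p x.2 x.1 := by
  classical
  have := Fintype.ofFinite β
  have h₁ : ∀ s : Finset β, REPred fun x : α × β => ∃ b ∈ s, x.2 = b ∧ p b x.1 := by
    intro s
    induction s using Finset.induction_on with
    | empty =>
      refine (REPred.ne (Primrec.const 0) (Primrec.const 0) : REPred fun x : α × β => 0 ≠ 0).of_eq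
        fun x => by simp
    | insert b s hb ih =>
      refine (((REPred.eq Primrec.snd (Primrec.const b)).and ((h b).comp Primrec.fst)).or ih).of_eq
        fun x => ?_
      simp [or_and_right]
      constructor
      · rintro (⟨rfl, h⟩ | h)
        · exact Or.inl ⟨rfl, h⟩
        · exact Or.inr h
      · rintro (⟨rfl, h⟩ | h)
        · exact Or.inl ⟨rfl, h⟩
        · exact Or.inr h
  refine (h₁ Finset.univ).of_eq fun x => ?_
  simp

/-- A run is witnessed by the list of its transitions. `step` folds the list from the right, fails
if consecutive states do not match, and recovers the initial state and the word read; that each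
transition is legal is a separate enumerable condition. -/
theorem REPred.run {R : α → σ → β → σ → Prop}
    (h : REPred fun x : α × σ × β × σ => R x.1 x.2.1 x.2.2.1 x.2.2.2)
    {f : α → σ} {g : α → List β} {k : α → σ} (hf : Primrec f) (hg : Primrec g) (hk : Primrec k) :
    REPred fun a => Run (R a) (f a) (g a) (k a) := by
  classical
  let step : (σ × β × σ) → Option (σ × List β) → Option (σ × List β) := fun t acc =>
    acc.bind fun y => if y.1 = t.2.2 then some (t.1, t.2.1 :: y.2) else none
  have hstep : Primrec₂ step := by
    refine Primrec.option_bind Primrec.snd (Primrec.ite (Primrec.eq.comp ?_ ?_) ?_ ?_) <;> fun_prop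
  have h₁ : REPred fun a => ∃ T : List (σ × β × σ),
      (∀ t ∈ T, R a t.1 t.2.1 t.2.2) ∧ T.foldr step (some (k a, [])) = some (f a, g a) := by
    refine REPred.exists (REPred.and ?_ (REPred.eq ?_ (by fun_prop)))
    · exact REPred.forall_mem (p := fun (x : α × List (σ × β × σ)) t => R x.1 t.1 t.2.1 t.2.2)
        (h.comp (f := fun x : (α × List (σ × β × σ)) × σ × β × σ => (x.1.1, x.2)) (by fun_prop))
        Primrec.snd
    · exact Primrec.list_foldr (h := fun _ y => step y.1 y.2) Primrec.snd (by fun_prop)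
        (hstep.comp (Primrec.fst.comp Primrec.snd) (Primrec.snd.comp Primrec.snd))
  refine h₁.of_eq fun a => ?_
  generalize f a = s, g a = l, k a = s'
  constructor
  · rintro ⟨T, hT, hf⟩
    induction T generalizing s l with
    | nil =>
      simp only [List.foldr_nil, Option.some.injEq, Prod.mk.injEq] at hf
      obtain ⟨rfl, rfl⟩ := hf
      exact Run.nil _
    | cons t T ih =>
      simp only [List.foldr_cons, step, Option.bind_eq_some_iff] at hf
      obtain ⟨y, hy, hy'⟩ := hf
      split_ifs at hy' with hc
      simp only [Option.some.injEq, Prod.mk.injEq] at hy'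
      obtain ⟨rfl, rfl⟩ := hy'
      exact Run.cons (hT t (by simp))
        (hc ▸ ih y.1 y.2 (fun t ht => hT t (by simp [ht])) hy)
  · intro h
    induction h with
    | nil s => exact ⟨[], by simp, rfl⟩
    | @cons s t s' b l h _ ih =>
      obtain ⟨T, hT, hf⟩ := ih
      refine ⟨(s, b, t) :: T, ?_, ?_⟩
      · simpa [h] using hT
      · simp only [List.foldr_cons, hf, step]
        simp

end REPred

namespace GraphOfGroups

variable {V : Type u} [SerreGraph.{u, v} V] {A : GraphOfGroups.{u, v, w, x} V}

/-! ### Reduced paths and normal forms -/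

namespace GPath

/-- The first vertex group element of a path. -/
def head : {a b : V} → A.GPath a b → A.vertexGroup a
  | _, _, nil g => g
  | _, _, cons g _ _ => g

/-- The number of edges of a path. -/
def length : {a b : V} → A.GPath a b → ℕ
  | _, _, nil _ => 0
  | _, _, cons _ _ p => length p + 1

/-- An elementary reduction applies to the first two edges of `⟨g, e, p⟩`. -/
def Cancels {a b d : V} (e : a ⟶ b) (p : A.GPath b d) : Prop :=
  ∃ (c : A.edgeGroup e) (q : A.GPath a d), p = cons (A.ω e c) (Quiver.reverse e) q

/-- No elementary reduction applies to the path. -/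
def Reduced : {a b : V} → A.GPath a b → Prop
  | _, _, nil _ => True
  | _, _, cons _ e p => ¬ Cancels e p ∧ Reduced p

@[simp] theorem head_lmul {a b : V} (g : A.vertexGroup a) (p : A.GPath a b) :
    head (lmul g p) = g * head p := by
  cases p <;> rfl

@[simp] theorem length_lmul {a b : V} (g : A.vertexGroup a) (p : A.GPath a b) :
    length (lmul g p) = length p := by
  cases p <;> rfl

@[simp] theorem length_append {a b c : V} (p : A.GPath a b) (q : A.GPath b c) :
    length (append p q) = length p + length q := by
  induction p with
  | nil g => simp [append, length]
  | cons g e p ih => simp [append, length, ih]; omega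

@[simp] theorem reduced_lmul {a b : V} (g : A.vertexGroup a) (p : A.GPath a b) :
    Reduced (lmul g p) ↔ Reduced p := by
  cases p <;> rfl

theorem cancels_lmul {a b d : V} (e : a ⟶ b) (c : A.edgeGroup e) (p : A.GPath b d) :
    Cancels e (lmul (A.ω e c) p) ↔ Cancels e p := by
  have key : ∀ (c : A.edgeGroup e) (p : A.GPath b d), Cancels e p →
      Cancels e (lmul (A.ω e c) p) := by
    rintro c _ ⟨c', q, rfl⟩
    exact ⟨c * c', q, by rw [lmul_cons, map_mul]⟩
  refine ⟨fun h => ?_, key c p⟩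
  have := key c⁻¹ _ h
  rwa [lmul_lmul, ← map_mul, inv_mul_cancel, map_one, one_lmul] at this

theorem cons_inj {a b d : V} {g h : A.vertexGroup a} {e : a ⟶ b} {p q : A.GPath b d}
    (H : cons g e p = cons h e q) : g = h ∧ p = q := by
  simpa using H

/-- The chosen representative of the coset of `g` modulo the image of the edge group. -/
noncomputable def cosetRep {a b : V} (e : a ⟶ b) (g : A.vertexGroup b) : A.vertexGroup b :=
  Quotient.out (Quotient.mk (QuotientGroup.rightRel (A.ω e).range) g)

theorem exists_omega_mul_cosetRep {a b : V} (e : a ⟶ b) (g : A.vertexGroup b) :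
    ∃ c : A.edgeGroup e, A.ω e c * cosetRep e g = g := by
  have h : QuotientGroup.rightRel (A.ω e).range (cosetRep e g) g :=
    Quotient.exact (Quotient.out_eq (Quotient.mk (QuotientGroup.rightRel (A.ω e).range) g))
  rw [QuotientGroup.rightRel_apply] at h
  obtain ⟨c, hc⟩ := h
  exact ⟨c, by rw [hc]; group⟩

/-- The element `c` of the edge group with `g = ω c * cosetRep g`. -/
noncomputable def edgePart {a b : V} (e : a ⟶ b) (g : A.vertexGroup b) : A.edgeGroup e :=
  (exists_omega_mul_cosetRep e g).choose

theorem omega_edgePart_mul {a b : V} (e : a ⟶ b) (g : A.vertexGroup b) :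
    A.ω e (edgePart e g) * cosetRep e g = g :=
  (exists_omega_mul_cosetRep e g).choose_spec

theorem cosetRep_omega_mul {a b : V} (e : a ⟶ b) (c : A.edgeGroup e) (g : A.vertexGroup b) :
    cosetRep e (A.ω e c * g) = cosetRep e g := by
  refine congrArg Quotient.out (Quotient.sound ?_)
  change QuotientGroup.rightRel (A.ω e).range _ _
  rw [QuotientGroup.rightRel_apply]
  exact ⟨c⁻¹, by simp⟩

theorem edgePart_omega_mul {a b : V} (e : a ⟶ b) (c : A.edgeGroup e) (g : A.vertexGroup b) :
    edgePart e (A.ω e c * g) = c * edgePart e g := by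
  apply A.ω_injective e
  rw [map_mul, ← mul_left_inj (cosetRep e g), mul_assoc, omega_edgePart_mul]
  conv_lhs => rw [← cosetRep_omega_mul e c g, omega_edgePart_mul]

theorem edgePart_cosetRep {a b : V} (e : a ⟶ b) (g : A.vertexGroup b) :
    edgePart e (cosetRep e g) = 1 := by
  have h := edgePart_omega_mul e (edgePart e g) (cosetRep e g)
  rw [omega_edgePart_mul] at h
  exact (mul_eq_left.1 h.symm)

open Classical in
/-- The normal form of `⟨g, e, p⟩`, where `p` is in normal form. -/
noncomputable def normCons {a b d : V} (g : A.vertexGroup a) (e : a ⟶ b) (p : A.GPath b d) :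
    A.GPath a d :=
  if h : Cancels e p then lmul (g * A.α e h.choose) h.choose_spec.choose
  else cons (g * A.α e (edgePart e (head p))) e (lmul (A.ω e (edgePart e (head p)))⁻¹ p)

/-- The normal form of a path, with respect to the chosen coset representatives. -/
noncomputable def norm : {a b : V} → A.GPath a b → A.GPath a b
  | _, _, nil g => nil g
  | _, _, cons g e p => normCons g e (norm p)

/-- The paths in normal form. -/
def IsNormal : {a b : V} → A.GPath a b → Prop
  | _, _, nil _ => True
  | _, _, cons _ e p => edgePart e (head p) = 1 ∧ ¬ Cancels e p ∧ IsNormal p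

theorem normCons_cancel {a b d : V} (g : A.vertexGroup a) (e : a ⟶ b) (c : A.edgeGroup e)
    (p : A.GPath a d) :
    normCons g e (cons (A.ω e c) (Quiver.reverse e) p) = lmul (g * A.α e c) p := by
  have h : Cancels e (cons (A.ω e c) (Quiver.reverse e) p) := ⟨c, p, rfl⟩
  rw [normCons, dif_pos h]
  obtain ⟨h₁, h₂⟩ := cons_inj h.choose_spec.choose_spec
  rw [← h₂, ← A.ω_injective e h₁]

theorem normCons_of_not_cancels {a b d : V} (g : A.vertexGroup a) (e : a ⟶ b) {p : A.GPath b d}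
    (h : ¬ Cancels e p) : normCons g e p =
      cons (g * A.α e (edgePart e (head p))) e (lmul (A.ω e (edgePart e (head p)))⁻¹ p) :=
  dif_neg h

theorem lmul_normCons {a b d : V} (h g : A.vertexGroup a) (e : a ⟶ b) (p : A.GPath b d) :
    lmul h (normCons g e p) = normCons (h * g) e p := by
  by_cases hc : Cancels e p
  · obtain ⟨c, q, rfl⟩ := hc
    rw [normCons_cancel, normCons_cancel, lmul_lmul, mul_assoc]
  · rw [normCons_of_not_cancels _ _ hc, normCons_of_not_cancels _ _ hc, lmul_cons, mul_assoc]

theorem normCons_lmul {a b d : V} (g : A.vertexGroup a) (e : a ⟶ b) (c : A.edgeGroup e)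
    (p : A.GPath b d) : normCons g e (lmul (A.ω e c) p) = normCons (g * A.α e c) e p := by
  by_cases hc : Cancels e p
  · obtain ⟨c', q, rfl⟩ := hc
    rw [normCons_cancel, lmul_cons, ← map_mul, normCons_cancel, map_mul, mul_assoc]
  · rw [normCons_of_not_cancels _ _ hc,
      normCons_of_not_cancels _ _ (mt (cancels_lmul e c p).1 hc), head_lmul, edgePart_omega_mul,
      lmul_lmul]
    simp [mul_assoc]

theorem isNormal_lmul {a b : V} (g : A.vertexGroup a) (p : A.GPath a b) :
    IsNormal (lmul g p) ↔ IsNormal p := by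
  cases p <;> rfl

theorem IsNormal.normCons {a b d : V} (g : A.vertexGroup a) (e : a ⟶ b) {p : A.GPath b d}
    (hp : IsNormal p) : IsNormal (normCons g e p) := by
  by_cases hc : Cancels e p
  · obtain ⟨c, q, rfl⟩ := hc
    rw [normCons_cancel, isNormal_lmul]
    exact hp.2.2
  · rw [normCons_of_not_cancels _ _ hc]
    refine ⟨?_, ?_, ?_⟩
    · rw [head_lmul, inv_mul_eq_of_eq_mul (omega_edgePart_mul e (head p)).symm]
      exact edgePart_cosetRep e _
    · rwa [← map_inv, cancels_lmul]
    · rwa [isNormal_lmul]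

theorem isNormal_norm {a b : V} (p : A.GPath a b) : IsNormal (norm p) := by
  induction p with
  | nil g => trivial
  | cons g e p ih => exact ih.normCons g e

theorem normCons_eq_cons {a b d : V} (g : A.vertexGroup a) (e : a ⟶ b) {p : A.GPath b d}
    (h₁ : edgePart e (head p) = 1) (h₂ : ¬ Cancels e p) : normCons g e p = cons g e p := by
  rw [normCons_of_not_cancels _ _ h₂, h₁]
  simp [one_lmul]

/-- Van der Waerden's trick: edges act on normal forms, and inverse edges act by inverse maps. Hence
elementary reductions do not change `norm`. -/
theorem normCons_normCons_reverse {a b d : V} (e : a ⟶ b) {p : A.GPath a d} (hp : IsNormal p) :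
    normCons 1 e (normCons 1 (Quiver.reverse e) p) = p := by
  by_cases hc : Cancels (Quiver.reverse e) p
  · obtain ⟨c, q, rfl⟩ := hc
    obtain ⟨c, rfl⟩ := (A.rev e).surjective c
    rw [normCons_cancel, one_mul, A.α_rev, normCons_lmul, one_mul, A.ω_rev]
    obtain ⟨h₁, h₂, -⟩ := hp
    -- The double reverse equals `e` only propositionally, so it is generalized before the
    -- substitution.
    generalize hr : Quiver.reverse (Quiver.reverse e) = e' at h₁ h₂ ⊢
    rw [Quiver.reverse_reverse] at hr
    subst hr
    exact normCons_eq_cons _ _ h₁ h₂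
  · rw [normCons_of_not_cancels _ _ hc]
    obtain ⟨c, hc'⟩ := (A.rev e).surjective (edgePart (Quiver.reverse e) (head p))
    rw [← hc', one_mul, A.α_rev, normCons_cancel, one_mul, A.ω_rev, lmul_lmul, mul_inv_cancel,
      one_lmul]

theorem norm_lmul {a b : V} (g : A.vertexGroup a) (p : A.GPath a b) :
    norm (lmul g p) = lmul g (norm p) := by
  cases p with
  | nil h => rfl
  | cons h e p => exact (lmul_normCons g h e (norm p)).symm

theorem Red.norm_eq {a b : V} {p q : A.GPath a b} (h : Red p q) : norm p = norm q := by
  induction h with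
  | head g e c p =>
    have h := normCons_normCons_reverse e (isNormal_norm p)
    rw [norm_lmul]
    conv_rhs => rw [← h, lmul_normCons, mul_one, ← normCons_lmul, lmul_normCons, mul_one]
    rfl
  | tail g e _ ih => exact congrArg (normCons g e) ih

theorem Equiv.norm_eq {a b : V} {p q : A.GPath a b} (h : Equiv p q) : norm p = norm q := by
  induction h with
  | rel p q h => exact h.norm_eq
  | refl p => rfl
  | symm p q _ ih => exact ih.symm
  | trans p q r _ _ ih₁ ih₂ => exact ih₁.trans ih₂

/-- Normalizing a reduced path keeps its edges and alters the element before its first edge by a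
right factor from the image of `α`. That factor can be absorbed in the `c` of a cancellation, so no
new cancellation arises. -/
theorem not_cancels_norm {a b d : V} (e : a ⟶ b) {p : A.GPath b d} (hp : Reduced p)
    (h : ¬ Cancels e p) : ¬ Cancels e (norm p) := by
  induction p generalizing a with
  | nil g => exact h
  | cons g f p ih =>
    rintro ⟨c, q, hq⟩
    rw [norm, normCons_of_not_cancels _ _ (ih f hp.2 hp.1)] at hq
    simp only [cons.injEq] at hq
    obtain ⟨rfl, h₁, h₂, -⟩ := hq
    obtain rfl := eq_of_heq h₂
    generalize edgePart (Quiver.reverse e) (head (norm p)) = c' at h₁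
    obtain ⟨c', rfl⟩ := (A.rev e).surjective c'
    rw [A.α_rev, ← eq_mul_inv_iff_mul_eq, ← map_inv, ← map_mul] at h₁
    exact h ⟨_, _, by rw [h₁]⟩

end GPath

/-! ### Partial actions of a graph of groups -/

variable (A) in
/-- Sets with actions of the vertex groups and partial bijections between them, one for each edge,
that are equivariant under the edge groups. -/
structure PartialAction where
  /-- The set for a vertex. -/
  Pt : V → Type*
  [inst : ∀ a, MulAction (A.vertexGroup a) (Pt a)]
  /-- The graph of the partial bijection for an edge. -/
  Step : ∀ {a b : V}, (a ⟶ b) → Pt a → Pt b → Prop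
  step_unique : ∀ {a b : V} {e : a ⟶ b} {x : Pt a} {y z : Pt b}, Step e x y → Step e x z → y = z
  step_smul : ∀ {a b : V} {e : a ⟶ b} {x : Pt a} {y : Pt b} (c : A.edgeGroup e), Step e x y →
    Step e (A.α e c • x) (A.ω e c • y)
  step_reverse : ∀ {a b : V} {e : a ⟶ b} {x : Pt a} {y : Pt b}, Step e x y →
    Step (Quiver.reverse e) y x

namespace PartialAction

open GPath

instance instMulActionPt (P : A.PartialAction) (a : V) : MulAction (A.vertexGroup a) (P.Pt a) :=
  P.inst a

variable (P : A.PartialAction)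

/-- `P.Ev p x y`: the path `p`, acting from the right, takes `x` to `y`. -/
def Ev : {a b : V} → A.GPath a b → P.Pt a → P.Pt b → Prop
  | _, _, nil g, x, y => g⁻¹ • x = y
  | _, _, cons g e p, x, y => ∃ z, P.Step e (g⁻¹ • x) z ∧ Ev p z y

variable {P}

theorem ev_lmul {a b : V} {g : A.vertexGroup a} {p : A.GPath a b} {x : P.Pt a} {y : P.Pt b} :
    P.Ev (lmul g p) x y ↔ P.Ev p (g⁻¹ • x) y := by
  cases p <;> simp [lmul, Ev, mul_smul]

theorem ev_append {a b c : V} {p : A.GPath a b} {q : A.GPath b c} {x : P.Pt a} {y : P.Pt c} :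
    P.Ev (append p q) x y ↔ ∃ z, P.Ev p x z ∧ P.Ev q z y := by
  induction p with
  | nil g => simp [append, ev_lmul, Ev]
  | cons g e p ih =>
    simp only [append, Ev, ih]
    exact ⟨fun ⟨z, h, t, h', h''⟩ => ⟨t, ⟨z, h, h'⟩, h''⟩,
      fun ⟨t, ⟨z, h, h'⟩, h''⟩ => ⟨z, h, t, h', h''⟩⟩

theorem Ev.inv {a b : V} {p : A.GPath a b} {x : P.Pt a} {y : P.Pt b} (h : P.Ev p x y) :
    P.Ev (GPath.inv p) y x := by
  induction p with
  | nil g =>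
    obtain rfl := h
    simp [GPath.inv, Ev]
  | cons g e p ih =>
    obtain ⟨z, h₁, h₂⟩ := h
    rw [GPath.inv, ev_append]
    refine ⟨z, ih h₂, g⁻¹ • x, ?_, ?_⟩
    · simpa using P.step_reverse h₁
    · simp [Ev]

/-- One direction only: the inverse of a reduction inserts an edge, which may be undefined at the
point in question. -/
theorem Ev.red {a b : V} {p q : A.GPath a b} (hr : Red p q) {x : P.Pt a} {y : P.Pt b}
    (h : P.Ev p x y) : P.Ev q x y := by
  induction hr with
  | head g e c p =>
    obtain ⟨z, h₁, t, h₂, h₃⟩ := h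
    have h₄ := P.step_reverse (P.step_smul c⁻¹ h₁)
    rw [map_inv, map_inv] at h₄
    obtain rfl := P.step_unique h₂ h₄
    rw [ev_lmul]
    simpa [mul_smul] using h₃
  | tail g e _ ih =>
    obtain ⟨z, h₁, h₂⟩ := h
    exact ⟨z, h₁, ih h₂⟩

/-- Equivariance of the partial bijections. In contrast to a cancellation, moving an edge group
element across an edge does not change the domain of the path. -/
theorem ev_twist {a b d : V} (g : A.vertexGroup a) (e : a ⟶ b) (c : A.edgeGroup e)
    {p : A.GPath b d} {x : P.Pt a} {y : P.Pt d} :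
    P.Ev (cons (g * A.α e c) e (lmul (A.ω e c)⁻¹ p)) x y ↔ P.Ev (cons g e p) x y := by
  simp only [Ev, ev_lmul, inv_inv]
  constructor
  · rintro ⟨z, h₁, h₂⟩
    refine ⟨_, ?_, h₂⟩
    simpa [mul_smul] using P.step_smul c h₁
  · rintro ⟨z, h₁, h₂⟩
    refine ⟨(A.ω e c)⁻¹ • z, ?_, by simpa using h₂⟩
    simpa [mul_smul] using P.step_smul c⁻¹ h₁

theorem Ev.normCons {a b d : V} {g : A.vertexGroup a} {e : a ⟶ b} {p : A.GPath b d} {x : P.Pt a}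
    {y : P.Pt d} (h : P.Ev (cons g e p) x y) : P.Ev (normCons g e p) x y := by
  by_cases hc : Cancels e p
  · obtain ⟨c, q, rfl⟩ := hc
    rw [normCons_cancel]
    exact h.red (Red.head g e c q)
  · rw [normCons_of_not_cancels _ _ hc]
    exact (ev_twist g e _).2 h

theorem Ev.norm {a b : V} {p : A.GPath a b} {x : P.Pt a} {y : P.Pt b} (h : P.Ev p x y) :
    P.Ev (norm p) x y := by
  induction p with
  | nil g => exact h
  | cons g e p ih =>
    obtain ⟨z, h₁, h₂⟩ := h
    exact Ev.normCons ⟨z, h₁, ih h₂⟩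

/-- For a reduced path the normal form arises by twists alone, without cancellations, so the passage
to it can be undone. -/
theorem Ev.of_norm {a b : V} {p : A.GPath a b} (hp : Reduced p) {x : P.Pt a} {y : P.Pt b}
    (h : P.Ev (GPath.norm p) x y) : P.Ev p x y := by
  induction p with
  | nil g => exact h
  | cons g e p ih =>
    rw [GPath.norm, normCons_of_not_cancels _ _ (not_cancels_norm e hp.2 hp.1), ev_twist] at h
    obtain ⟨z, h₁, h₂⟩ := h
    exact ⟨z, h₁, ih hp.2 h₂⟩

/-- A reduced path acts whenever some equivalent path acts. -/
theorem Ev.of_equiv {a b : V} {p q : A.GPath a b} (hp : Reduced p) (hpq : Equiv p q) {x : P.Pt a}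
    {y : P.Pt b} (h : P.Ev q x y) : P.Ev p x y :=
  Ev.of_norm hp (hpq.norm_eq ▸ h.norm)

end PartialAction

end GraphOfGroups

namespace GraphOfGroups

variable {V : Type u} [SerreGraph.{u, v} V] {A : GraphOfGroups.{u, v, w, x} V}

/-! ### Cyclically reduced paths -/

namespace GPath

theorem cancels_of_cancels_append {a b c d : V} {e : a ⟶ b} {p : A.GPath b c} {q : A.GPath c d}
    (hp : 0 < p.length) (h : Cancels e (append p q)) : Cancels e p := by
  cases p with
  | nil g => simp [length] at hp
  | cons g f p =>
    obtain ⟨s, r, h⟩ := h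
    simp only [append, cons.injEq] at h
    obtain ⟨rfl, rfl, h₂, -⟩ := h
    obtain rfl := eq_of_heq h₂
    exact ⟨s, p, rfl⟩

/-- Reducedness concerns only pairs of consecutive edges, and no such pair can meet both `p` and
`r`, since `q` has an edge. -/
theorem Reduced.append_append {a b c d : V} {p : A.GPath a b} {q : A.GPath b c} {r : A.GPath c d}
    (hq : 0 < q.length) (h₁ : Reduced (append p q)) (h₂ : Reduced (append q r)) :
    Reduced (append p (append q r)) := by
  induction p with
  | nil g => simpa [append] using h₂
  | cons g e p ih =>
    refine ⟨fun h => h₁.1 ?_, ih hq h₁.2 h₂⟩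
    rw [← append_assoc] at h
    exact cancels_of_cancels_append (by simp; omega) h

/-- `powSucc c n` is the power `c ^ (n + 1)` of the loop `c`. -/
def powSucc {a : V} (c : A.GPath a a) : ℕ → A.GPath a a
  | 0 => c
  | n + 1 => append c (powSucc c n)

theorem Reduced.powSucc {a : V} {c : A.GPath a a} (h : Reduced c) (h' : Reduced (append c c))
    (n : ℕ) : Reduced (powSucc c n) := by
  rcases Nat.eq_zero_or_pos c.length with hc | hc
  · have h₀ : (GPath.powSucc c n).length = 0 := by
      induction n with
      | zero => exact hc
      | succ n ih => simp [GPath.powSucc, hc, ih]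
    generalize GPath.powSucc c n = p at h₀ ⊢
    cases p with
    | nil g => trivial
    | cons g e p => simp [length] at h₀
  · have key : ∀ n, Reduced (GPath.powSucc c n) ∧ Reduced (append c (GPath.powSucc c n)) := by
      intro n
      induction n with
      | zero => exact ⟨h, h'⟩
      | succ n ih => exact ⟨ih.2, h'.append_append hc ih.2⟩
    exact (key n).1

theorem Red.length_lt {a b : V} {p q : A.GPath a b} (h : Red p q) : q.length < p.length := by
  induction h with
  | head g e c p => simp [length]
  | tail g e _ ih => simpa [length] using ih

theorem exists_red_of_not_reduced {a b : V} {p : A.GPath a b} (h : ¬ Reduced p) :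
    ∃ q, Red p q := by
  induction p with
  | nil g => exact (h trivial).elim
  | cons g e p ih =>
    by_cases hc : Cancels e p
    · obtain ⟨c, q, rfl⟩ := hc
      exact ⟨_, Red.head g e c q⟩
    · obtain ⟨q, hq⟩ := ih fun h' => h ⟨hc, h'⟩
      exact ⟨_, Red.tail g e hq⟩

/-- Every loop is conjugate to an element of a vertex group or to a cyclically reduced loop. -/
theorem exists_conj_cyclicallyReduced {v₀ : V} (p : A.GPath v₀ v₀) :
    ∃ (a : V) (y : A.GPath v₀ a) (c : A.GPath a a), Equiv (append p y) (append y c) ∧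
      (c.length = 0 ∨ Reduced c ∧ Reduced (append c c)) := by
  classical
  -- `c` is chosen with the fewest edges among all conjugates of `p`, at all vertices.
  have hex : ∃ (n : ℕ) (a : V) (y : A.GPath v₀ a) (c : A.GPath a a),
      Equiv (append p y) (append y c) ∧ c.length = n :=
    ⟨_, v₀, nil 1, p, by simpa [append_one, append, one_lmul] using Equiv.refl p, rfl⟩
  obtain ⟨a, y, c, hc, hn⟩ := Nat.find_spec hex
  have hmin : ∀ (a' : V) (y' : A.GPath v₀ a') (c' : A.GPath a' a'),
      Equiv (append p y') (append y' c') → c.length ≤ c'.length := fun a' y' c' h =>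
    hn ▸ Nat.find_min' hex ⟨a', y', c', h, rfl⟩
  have hred : ∀ (a' : V) (y' : A.GPath v₀ a') (c' : A.GPath a' a'),
      Equiv (append p y') (append y' c') → c'.length = c.length → Reduced c' := by
    intro a' y' c' h hl
    by_contra hr
    obtain ⟨q, hq⟩ := exists_red_of_not_reduced hr
    have h₁ := hmin a' y' q (h.trans ((Equiv.refl y').append hq.equiv))
    have h₂ := hq.length_lt
    omega
  refine ⟨a, y, c, hc, ?_⟩
  have hc₀ := hred a y c hc rfl
  cases c with
  | nil g => exact Or.inl rfl
  | @cons _ b _ g e c =>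
    refine Or.inr ⟨hc₀, ?_⟩
    have h₀ : cons g e c = append (cons g e (nil 1)) c := by simp [append, one_lmul]
    -- Moving the first edge to the end gives a conjugate of the same length, which is reduced by
    -- minimality. The overlapping reduced pieces are then glued to the square of the loop.
    have h₁ : Reduced (append c (cons g e (nil 1))) := by
      refine hred b (append y (cons g e (nil 1))) _ ?_ (by simp [length])
      rw [← append_assoc, append_assoc y, ← append_assoc _ c, ← h₀, ← append_assoc]
      exact hc.append (Equiv.refl _)
    rcases Nat.eq_zero_or_pos c.length with hl | hl
    · cases c with
      | cons => simp [length] at hl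
      | nil k =>
        refine ⟨?_, ?_, trivial⟩
        · rintro ⟨s, q, h⟩
          simp only [append, lmul, cons.injEq] at h
          -- A loop with the single edge `e` cancels against itself only if `e` is its own inverse.
          exact SerreGraph.reverse_ne e (eq_of_heq h.2.2.1).symm
        · rintro ⟨s, q, h⟩
          cases h
    · rw [h₀] at hc₀ ⊢
      rw [append_assoc]
      have h₂ := h₁.append_append (by simp [length]) hc₀
      exact hc₀.append_append hl h₂

end GPath

/-! ### The path groupoid acting on the fundamental group -/

section Transport

open GPath

/-- The class of a loop. -/
def loopClass {v₀ : V} (p : A.GPath v₀ v₀) : A.FundamentalGroup v₀ := Quotient.mk _ p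

theorem loopClass_append {v₀ : V} (p q : A.GPath v₀ v₀) :
    loopClass (append p q) = loopClass p * loopClass q := rfl

theorem loopClass_inv {v₀ : V} (p : A.GPath v₀ v₀) :
    loopClass (GPath.inv p) = (loopClass p)⁻¹ := rfl

theorem loopClass_eq_iff {v₀ : V} {p q : A.GPath v₀ v₀} :
    loopClass p = loopClass q ↔ GPath.Equiv p q :=
  ⟨fun h => Quotient.exact h, fun h => Quotient.sound h⟩

open Classical in
/-- A functor from the path groupoid to the fundamental group that is the identity on loops. It
joins the ends of a path to `v₀` by fixed paths, if they lie in the component of `v₀`. -/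
noncomputable def transport (v₀ : V) {a b : V} (p : A.GPath a b) : A.FundamentalGroup v₀ :=
  if h : Nonempty (A.GPath v₀ a) then
    -- By proof irrelevance, the path chosen by `Nonempty.some` depends only on its end vertex,
    -- which gives functoriality. The path chosen for `v₀` may be a non-trivial loop; conjugating by
    -- its class makes the functor the identity on loops.
    (loopClass (Nonempty.some ⟨nil 1⟩))⁻¹ *
      loopClass (append h.some (append p (GPath.inv
        (Nonempty.some (⟨append h.some p⟩ : Nonempty (A.GPath v₀ b)))))) *
      loopClass (Nonempty.some ⟨nil 1⟩)
  else 1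

theorem transport_append (v₀ : V) {a b c : V} (p : A.GPath a b) (q : A.GPath b c) :
    transport v₀ (append p q) = transport v₀ p * transport v₀ q := by
  by_cases h : Nonempty (A.GPath v₀ a)
  · have h' : Nonempty (A.GPath v₀ b) := ⟨append h.some p⟩
    rw [transport, transport, transport, dif_pos h, dif_pos h, dif_pos h']
    have key : ∀ (γ : A.GPath v₀ a) (δ : A.GPath v₀ b) (ε : A.GPath v₀ c),
        loopClass (append γ (append (append p q) (GPath.inv ε))) =
        loopClass (append γ (append p (GPath.inv δ))) *
          loopClass (append δ (append q (GPath.inv ε))) := by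
      intro γ δ ε
      rw [← loopClass_append, loopClass_eq_iff]
      have h₁ := (inv_append δ).append (GPath.Equiv.refl (append q (GPath.inv ε)))
      have h₂ := (GPath.Equiv.refl (append γ p)).append h₁
      simpa [append_assoc, append, one_lmul] using h₂.symm
    rw [key _ h'.some]
    group
  · have h' : ¬ Nonempty (A.GPath v₀ b) := fun ⟨r⟩ => h ⟨append r (GPath.inv p)⟩
    rw [transport, transport, transport, dif_neg h, dif_neg h, dif_neg h', one_mul]

theorem transport_congr (v₀ : V) {a b : V} {p q : A.GPath a b} (hpq : GPath.Equiv p q) :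
    transport v₀ p = transport v₀ q := by
  by_cases h : Nonempty (A.GPath v₀ a)
  · rw [transport, transport, dif_pos h, dif_pos h]
    congr 2
    rw [loopClass_eq_iff]
    exact (GPath.Equiv.refl _).append (hpq.append (GPath.Equiv.refl _))
  · rw [transport, transport, dif_neg h, dif_neg h]

theorem transport_loop {v₀ : V} (p : A.GPath v₀ v₀) : transport v₀ p = loopClass p := by
  rw [transport, dif_pos (⟨nil 1⟩ : Nonempty (A.GPath v₀ v₀)), loopClass_append, loopClass_append, loopClass_inv]
  group

theorem transport_one (v₀ a : V) : transport v₀ (nil 1 : A.GPath a a) = 1 := by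
  have h := transport_append v₀ (nil 1 : A.GPath a a) (nil 1)
  rw [append_one] at h
  exact (mul_eq_left.1 h.symm)

variable (A) in
/-- The vertex group in the fundamental group. -/
noncomputable def vertexHom (v₀ a : V) : A.vertexGroup a →* A.FundamentalGroup v₀ where
  toFun g := transport v₀ (nil g)
  map_one' := transport_one v₀ a
  map_mul' g h := transport_append v₀ (nil g) (nil h)

variable (A) in
/-- The stable letter of an edge. -/
noncomputable def edgeElement (v₀ : V) {a b : V} (e : a ⟶ b) : A.FundamentalGroup v₀ :=
  transport v₀ (cons (1 : A.vertexGroup a) e (nil 1))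

theorem vertexHom_apply (v₀ : V) {a : V} (g : A.vertexGroup a) :
    A.vertexHom v₀ a g = transport v₀ (nil g) := rfl

theorem transport_lmul (v₀ : V) {a b : V} (g : A.vertexGroup a) (p : A.GPath a b) :
    transport v₀ (lmul g p) = A.vertexHom v₀ a g * transport v₀ p :=
  transport_append v₀ (nil g) p

theorem transport_cons_one (v₀ : V) {a b c : V} (e : a ⟶ b) (p : A.GPath b c) :
    transport v₀ (cons 1 e p) = A.edgeElement v₀ e * transport v₀ p := by
  rw [edgeElement, ← transport_append]
  simp [append, one_lmul]

theorem edgeElement_mul_vertexHom_mul (v₀ : V) {a b : V} (e : a ⟶ b) (c : A.edgeGroup e) :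
    A.edgeElement v₀ e * A.vertexHom v₀ b (A.ω e c) * A.edgeElement v₀ (Quiver.reverse e) =
      A.vertexHom v₀ a (A.α e c) := by
  have h := transport_congr v₀ (Red.head 1 e c (nil (1 : A.vertexGroup a))).equiv
  rw [transport_cons_one] at h
  have h₁ : cons (A.ω e c) (Quiver.reverse e) (nil (1 : A.vertexGroup a)) =
    lmul (A.ω e c) (cons 1 (Quiver.reverse e) (nil 1)) := by simp [lmul]
  rw [h₁, transport_lmul] at h
  rw [mul_assoc, vertexHom_apply v₀ (A.α e c)]
  simpa [edgeElement, lmul] using h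

theorem edgeElement_mul_reverse (v₀ : V) {a b : V} (e : a ⟶ b) :
    A.edgeElement v₀ e * A.edgeElement v₀ (Quiver.reverse e) = 1 := by
  simpa using edgeElement_mul_vertexHom_mul v₀ e (1 : A.edgeGroup e)

theorem edgeElement_reverse (v₀ : V) {a b : V} (e : a ⟶ b) :
    A.edgeElement v₀ (Quiver.reverse e) = (A.edgeElement v₀ e)⁻¹ :=
  (inv_eq_of_mul_eq_one_right (edgeElement_mul_reverse v₀ e)).symm

theorem vertexHom_mul_edgeElement (v₀ : V) {a b : V} (e : a ⟶ b) (c : A.edgeGroup e) :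
    A.vertexHom v₀ a (A.α e c) * A.edgeElement v₀ e =
      A.edgeElement v₀ e * A.vertexHom v₀ b (A.ω e c) := by
  rw [← edgeElement_mul_vertexHom_mul, edgeElement_reverse, inv_mul_cancel_right]

end Transport

end GraphOfGroups

/-! ### Words -/

section EvalWord

variable {ι κ G : Type*} [Group G]

/-- The value of a word in the letters `s i` and their inverses. -/
def evalWord (s : ι → G) (l : List (ι × Bool)) : G := FreeGroup.lift s (FreeGroup.mk l)

@[simp] theorem evalWord_nil (s : ι → G) : evalWord s [] = 1 := map_one (FreeGroup.lift s)

@[simp] theorem evalWord_append (s : ι → G) (l l' : List (ι × Bool)) :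
    evalWord s (l ++ l') = evalWord s l * evalWord s l' := by
  rw [evalWord, ← FreeGroup.mul_mk, map_mul]
  rfl

theorem evalWord_cons (s : ι → G) (b : ι × Bool) (l : List (ι × Bool)) :
    evalWord s (b :: l) = evalWord s [b] * evalWord s l :=
  evalWord_append s [b] l

@[simp] theorem evalWord_invRev (s : ι → G) (l : List (ι × Bool)) :
    evalWord s (FreeGroup.invRev l) = (evalWord s l)⁻¹ := by
  rw [evalWord, ← FreeGroup.inv_mk, map_inv]
  rfl

theorem evalWord_singleton_true (s : ι → G) (i : ι) : evalWord s [(i, true)] = s i := by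
  simp [evalWord]

theorem evalWord_eq_prod (s : ι → G) (l : List (ι × Bool)) :
    evalWord s l = (l.map fun a => if a.2 then s a.1 else (s a.1)⁻¹).prod := by
  rw [evalWord, FreeGroup.lift_mk]
  congr 2
  funext a
  cases a.2 <;> rfl

theorem map_evalWord {G' : Type*} [Group G'] (φ : G →* G') (s : ι → G) (l : List (ι × Bool)) :
    φ (evalWord s l) = evalWord (φ ∘ s) l := by
  have h : φ.comp (FreeGroup.lift s) = FreeGroup.lift (φ ∘ s) := by
    ext i
    simp
  exact DFunLike.congr_fun h _

theorem evalWord_flatMap (s : ι → G) (τ : κ × Bool → List (ι × Bool)) (t : κ → G)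
    (hτ : ∀ x, evalWord s (τ x) = evalWord t [x]) (l : List (κ × Bool)) :
    evalWord s (l.flatMap τ) = evalWord t l := by
  induction l with
  | nil => rfl
  | cons x l ih => rw [List.flatMap_cons, evalWord_append, ih, hτ, evalWord_cons t x l]

theorem exists_evalWord {s : ι → G} (hs : Subgroup.closure (Set.range s) = ⊤) (g : G) :
    ∃ l, evalWord s l = g := by
  have h : g ∈ (FreeGroup.lift s).range := by
    rw [FreeGroup.range_lift_eq_closure, hs]
    trivial
  obtain ⟨x, rfl⟩ := h
  obtain ⟨l, rfl⟩ := Quot.exists_rep x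
  exact ⟨l, rfl⟩

theorem evalWord_mem_closure (s : ι → G) (l : List (ι × Bool)) :
    evalWord s l ∈ Subgroup.closure (Set.range s) := by
  rw [← FreeGroup.range_lift_eq_closure]
  exact ⟨_, rfl⟩

/-- The subgroup generated by the values of a list of words. -/
def wordSubgroup (s : ι → G) (L : List (List (ι × Bool))) : Subgroup G :=
  Subgroup.closure {h | ∃ l ∈ L, evalWord s l = h}

/-- The power coset membership problem, for a family of generators with an arbitrary index type. -/
def PowerCoset (s : ι → G)
    (I : List (ι × Bool) × List (ι × Bool) × List (List (ι × Bool))) : Prop :=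
  ∃ m : ℤ, m ≠ 0 ∧ (evalWord s I.1)⁻¹ * evalWord s I.2.1 ^ m ∈ wordSubgroup s I.2.2

theorem powerCosetInstance_iff {n : ℕ} (s : Fin n → G)
    (I : List (Fin n × Bool) × List (Fin n × Bool) × List (List (Fin n × Bool))) :
    PowerCosetInstance s I ↔ PowerCoset s I := by
  have h : wordValue s = evalWord s := funext fun l => (evalWord_eq_prod s l).symm
  simp only [PowerCosetInstance, PowerCoset, h, mem_leftCoset_iff]
  rfl

end EvalWord

namespace GraphOfGroups

variable {V : Type u} [SerreGraph.{u, v} V] {A : GraphOfGroups.{u, v, w, x} V}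

/-! ### Words for paths -/

variable (V) in
/-- The edges, with arbitrary endpoints. -/
abbrev TotalEdge := Σ a b : V, (a ⟶ b)

variable (V) in
/-- The letters for paths: generators of the vertex groups, indexed by `K`, and edges. -/
abbrev Letter (K : Type*) := (V × K) ⊕ TotalEdge V

/-- The reverse edge. -/
def TotalEdge.rev (e : TotalEdge V) : TotalEdge V := ⟨e.2.1, e.1, Quiver.reverse e.2.2⟩

variable (A) in
/-- The elements of all edge groups. -/
abbrev EdgeElement := Σ e : TotalEdge V, A.edgeGroup e.2.2

variable (A) in
/-- Families of generators of the vertex groups with a common index type, and words for the images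
of the edge groups. -/
structure Coding (K : Type*) where
  gen : ∀ a, K → A.vertexGroup a
  closure_gen : ∀ a, Subgroup.closure (Set.range (gen a)) = ⊤
  αWord : A.EdgeElement → List (K × Bool)
  ωWord : A.EdgeElement → List (K × Bool)
  evalWord_αWord : ∀ c, evalWord (gen c.1.1) (αWord c) = A.α c.1.2.2 c.2
  evalWord_ωWord : ∀ c, evalWord (gen c.1.2.1) (ωWord c) = A.ω c.1.2.2 c.2

theorem exists_coding {K : Type*} (gen : ∀ a, K → A.vertexGroup a)
    (h : ∀ a, Subgroup.closure (Set.range (gen a)) = ⊤) : ∃ C : A.Coding K, C.gen = gen := by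
  choose aw haw using fun c : A.EdgeElement => exists_evalWord (h c.1.1) (A.α c.1.2.2 c.2)
  choose ow how using fun c : A.EdgeElement => exists_evalWord (h c.1.2.1) (A.ω c.1.2.2 c.2)
  exact ⟨⟨gen, h, aw, ow, haw, how⟩, rfl⟩

namespace Coding

open GPath

variable {K : Type*} (C : A.Coding K)

/-- The element of the fundamental group for a letter. -/
noncomputable def letter (v₀ : V) : Letter V K → A.FundamentalGroup v₀
  | Sum.inl (a, k) => A.vertexHom v₀ a (C.gen a k)
  | Sum.inr e => A.edgeElement v₀ e.2.2

/-- `C.PathWord p f`: the word `f` spells the path `p`. -/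
inductive PathWord : {a b : V} → A.GPath a b → List (Letter V K × Bool) → Prop
  | nil (a : V) : PathWord (GPath.nil (1 : A.vertexGroup a)) []
  | vertex {a b : V} (k : K) (β : Bool) {p : A.GPath a b} {f : List (Letter V K × Bool)} :
      PathWord p f →
        PathWord (lmul (evalWord (C.gen a) [(k, β)]) p) ((Sum.inl (a, k), β) :: f)
  -- Edge letters occur only with the sign `true`; an edge is traversed backwards through the letter
  -- of its reverse.
  | edge {a b c : V} (e : a ⟶ b) {p : A.GPath b c} {f : List (Letter V K × Bool)} :
      PathWord p f → PathWord (GPath.cons 1 e p) ((Sum.inr ⟨a, b, e⟩, true) :: f)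

variable {C} in
theorem PathWord.append {a b c : V} {p : A.GPath a b} {q : A.GPath b c}
    {f g : List (Letter V K × Bool)} (hp : C.PathWord p f) (hq : C.PathWord q g) :
    C.PathWord (GPath.append p q) (f ++ g) := by
  induction hp with
  | nil a => simpa [GPath.append, one_lmul] using hq
  | vertex k β _ ih => rw [lmul_append]; exact (ih hq).vertex k β
  | edge e _ ih => exact (ih hq).edge e

/-- The word for an element of a vertex group. -/
def vertexWord (a : V) (w : List (K × Bool)) : List (Letter V K × Bool) :=
  w.map fun x => (Sum.inl (a, x.1), x.2)

theorem pathWord_vertexWord (a : V) (w : List (K × Bool)) :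
    C.PathWord (GPath.nil (evalWord (C.gen a) w)) (vertexWord a w) := by
  induction w with
  | nil => simpa [vertexWord] using PathWord.nil (C := C) a
  | cons b w ih => rw [evalWord_cons]; exact ih.vertex b.1 b.2

theorem exists_pathWord {a b : V} (p : A.GPath a b) : ∃ f, C.PathWord p f := by
  induction p with
  | nil g =>
    obtain ⟨w, rfl⟩ := exists_evalWord (C.closure_gen _) g
    exact ⟨_, C.pathWord_vertexWord _ w⟩
  | @cons a b _ g e p ih =>
    obtain ⟨f, hf⟩ := ih
    obtain ⟨w, rfl⟩ := exists_evalWord (C.closure_gen _) g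
    refine ⟨vertexWord a w ++ (Sum.inr ⟨a, b, e⟩, true) :: f, ?_⟩
    simpa [GPath.append, lmul] using (C.pathWord_vertexWord a w).append (hf.edge e)

variable {C} in
theorem PathWord.evalWord_eq {a b : V} {p : A.GPath a b} {f : List (Letter V K × Bool)}
    (h : C.PathWord p f) (v₀ : V) : evalWord (C.letter v₀) f = transport v₀ p := by
  induction h with
  | nil a => rw [transport_one, evalWord_nil]
  | @vertex a _ k β _ _ _ ih =>
    rw [evalWord_cons, ih, transport_lmul, map_evalWord]
    rfl
  | edge e _ ih =>
    rw [evalWord_cons, ih, transport_cons_one, evalWord_singleton_true]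
    rfl

/-! ### Points -/

variable (V K) in
/-- The labels of orbits. A label includes generators of the stabilizer. -/
abbrev Label := List (Letter V K × Bool) × List (List (K × Bool))

variable (V K) in
/-- Names of points: the label of an orbit, and a word for the element that takes the base point of
the orbit to the point. -/
abbrev Point := Label V K × List (K × Bool)

/-- The action from the right of a word on points. -/
def shift (x : Point V K) (w : List (K × Bool)) : Point V K := (x.1, x.2 ++ w)

/-- Two names of points for the vertex `a` denote the same point. -/
def SamePoint (a : V) (x y : Point V K) : Prop :=
  x.1 = y.1 ∧
    evalWord (C.gen a) x.2 * (evalWord (C.gen a) y.2)⁻¹ ∈ wordSubgroup (C.gen a) x.1.2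

/-- The point that is named `x`. -/
def toPt (a : V) (x : Point V K) :
    Σ o : Label V K, A.vertexGroup a ⧸ wordSubgroup (C.gen a) o.2 :=
  -- Inversion turns right cosets of the stabilizer into left cosets, so the action of `g` from the
  -- right becomes that of `g⁻¹` from the left.
  ⟨x.1, ((evalWord (C.gen a) x.2)⁻¹ : A.vertexGroup a)⟩

theorem inv_smul_toPt_eq_iff (a : V) (g : A.vertexGroup a) (x y : Point V K) :
    g⁻¹ • C.toPt a x = C.toPt a y ↔ x.1 = y.1 ∧
      evalWord (C.gen a) x.2 * g * (evalWord (C.gen a) y.2)⁻¹ ∈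
        wordSubgroup (C.gen a) x.1.2 := by
  obtain ⟨o, x⟩ := x
  obtain ⟨o', y⟩ := y
  constructor
  · intro h
    obtain ⟨rfl, h⟩ := Sigma.mk.inj_iff.1 h
    refine ⟨rfl, ?_⟩
    have := QuotientGroup.eq.1 (eq_of_heq h)
    simpa [mul_assoc, toPt] using this
  · rintro ⟨h, h'⟩
    dsimp only at h h'
    subst h
    refine Sigma.mk.inj_iff.2 ⟨rfl, heq_of_eq (QuotientGroup.eq.2 ?_)⟩
    simpa [mul_assoc, toPt] using h'

theorem toPt_eq_iff (a : V) (x y : Point V K) :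
    C.toPt a x = C.toPt a y ↔ C.SamePoint a x y := by
  have := C.inv_smul_toPt_eq_iff a 1 x y
  simpa [SamePoint] using this

theorem toPt_shift (a : V) (x : Point V K) (w : List (K × Bool)) :
    C.toPt a (shift x w) = (evalWord (C.gen a) w)⁻¹ • C.toPt a x := by
  rw [eq_comm, inv_smul_toPt_eq_iff]
  simp [shift, one_mem]

theorem evalWord_αWord_mk {a b : V} (e : a ⟶ b) (c : A.edgeGroup e) :
    evalWord (C.gen a) (C.αWord ⟨⟨a, b, e⟩, c⟩) = A.α e c :=
  C.evalWord_αWord ⟨⟨a, b, e⟩, c⟩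

theorem evalWord_ωWord_mk {a b : V} (e : a ⟶ b) (c : A.edgeGroup e) :
    evalWord (C.gen b) (C.ωWord ⟨⟨a, b, e⟩, c⟩) = A.ω e c :=
  C.evalWord_ωWord ⟨⟨a, b, e⟩, c⟩

/-- A list of triples `(e, x, y)` that is closed under reversal and defines partial bijections. -/
def Valid (E : List (TotalEdge V × Point V K × Point V K)) : Prop :=
  (∀ t ∈ E, (t.1.rev, t.2.2, t.2.1) ∈ E) ∧
    -- Only single-valuedness up to the edge group is demanded; injectivity follows by applying it
    -- to the reversed triples.
    ∀ t ∈ E, ∀ t' ∈ E, ∀ c : A.EdgeElement, t.1 = c.1 → t'.1 = c.1 →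
      C.SamePoint c.1.1 (shift t.2.1 (C.αWord c)) t'.2.1 →
        C.SamePoint c.1.2.1 (shift t.2.2 (C.ωWord c)) t'.2.2

variable {C} in
/-- The partial action that is defined by a valid list. -/
def Valid.partialAction {E : List (TotalEdge V × Point V K × Point V K)} (hE : C.Valid E) :
    A.PartialAction where
  Pt a := Σ o : Label V K, A.vertexGroup a ⧸ wordSubgroup (C.gen a) o.2
  Step {a b} e X Y := ∃ t ∈ E, t.1 = ⟨a, b, e⟩ ∧ ∃ c : A.edgeGroup e,
    X = (A.α e c)⁻¹ • C.toPt a t.2.1 ∧ Y = (A.ω e c)⁻¹ • C.toPt b t.2.2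
  step_unique := by
    rintro a b e X Y Z ⟨t, ht, hte, c, rfl, rfl⟩ ⟨t', ht', hte', c', h, rfl⟩
    -- The two arrows leave the same point after shifts by `c` and `c'`, so their sources differ by
    -- the shift with `c * c'⁻¹`.
    have h₁ := hE.2 t ht t' ht' ⟨⟨a, b, e⟩, c * c'⁻¹⟩ hte hte'
    simp only [← toPt_eq_iff, toPt_shift, evalWord_αWord_mk, evalWord_ωWord_mk] at h₁
    rw [inv_smul_eq_iff, smul_smul, ← map_inv, ← map_mul, ← inv_smul_eq_iff, ← map_inv] at h
    rw [inv_smul_eq_iff, smul_smul, ← map_inv, ← map_mul, ← inv_smul_eq_iff]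
    exact h₁ (by simpa using h)
  step_smul := by
    rintro a b e X Y d ⟨t, ht, hte, c, rfl, rfl⟩
    exact ⟨t, ht, hte, c * d⁻¹, by simp [mul_smul], by simp [mul_smul]⟩
  step_reverse := by
    rintro a b e X Y ⟨t, ht, hte, c, rfl, rfl⟩
    refine ⟨_, hE.1 t ht, by rw [hte]; rfl, A.rev e c, ?_, ?_⟩
    · rw [A.α_rev]
    · rw [A.ω_rev]

section ValidAPI

variable {C} {E : List (TotalEdge V × Point V K × Point V K)} (hE : C.Valid E)

/-- The point of the partial action that is named `x`. -/
def Valid.pt (a : V) (x : Point V K) : hE.partialAction.Pt a := C.toPt a x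

theorem Valid.inv_smul_pt_eq_iff {a : V} {g : A.vertexGroup a} {x y : Point V K} :
    g⁻¹ • hE.pt a x = hE.pt a y ↔ x.1 = y.1 ∧
      evalWord (C.gen a) x.2 * g * (evalWord (C.gen a) y.2)⁻¹ ∈ wordSubgroup (C.gen a) x.1.2 :=
  C.inv_smul_toPt_eq_iff a g x y

theorem Valid.pt_eq_iff {a : V} {x y : Point V K} : hE.pt a x = hE.pt a y ↔ C.SamePoint a x y :=
  C.toPt_eq_iff a x y

theorem Valid.pt_shift (a : V) (x : Point V K) (w : List (K × Bool)) :
    hE.pt a (shift x w) = (evalWord (C.gen a) w)⁻¹ • hE.pt a x :=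
  C.toPt_shift a x w

theorem Valid.step_iff {a b : V} {e : a ⟶ b} {X : hE.partialAction.Pt a}
    {Y : hE.partialAction.Pt b} : hE.partialAction.Step e X Y ↔
      ∃ t ∈ E, t.1 = ⟨a, b, e⟩ ∧ ∃ c : A.edgeGroup e,
        X = hE.pt a (shift t.2.1 (C.αWord ⟨⟨a, b, e⟩, c⟩)) ∧
        Y = hE.pt b (shift t.2.2 (C.ωWord ⟨⟨a, b, e⟩, c⟩)) := by
  simp only [pt_shift, evalWord_αWord_mk, evalWord_ωWord_mk]
  rfl

end ValidAPI

/-! ### Tracing words -/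

/-- The machine that traces a word through the partial action. The point `none` means that the
trace has left the domain. -/
inductive TraceStep (E : List (TotalEdge V × Point V K × Point V K)) :
    V × Option (Point V K) → Letter V K × Bool → V × Option (Point V K) → Prop
  | vertex (a : V) (k : K) (β : Bool) (ζ : Option (Point V K)) :
      TraceStep E (a, ζ) (Sum.inl (a, k), β) (a, ζ.map fun x => shift x [(k, β)])
  | edge {a b : V} (e : a ⟶ b) (c : A.edgeGroup e) (x : Point V K)
      (t : TotalEdge V × Point V K × Point V K) : t ∈ E → t.1 = ⟨a, b, e⟩ →
      C.SamePoint a x (shift t.2.1 (C.αWord ⟨⟨a, b, e⟩, c⟩)) →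
      TraceStep E (a, some x) (Sum.inr ⟨a, b, e⟩, true)
        (b, some (shift t.2.2 (C.ωWord ⟨⟨a, b, e⟩, c⟩)))
  | stuck {a b : V} (e : a ⟶ b) (x : Point V K) :
      (∀ t ∈ E, ∀ c : A.EdgeElement, t.1 = c.1 → c.1 = ⟨a, b, e⟩ →
        ¬ C.SamePoint a x (shift t.2.1 (C.αWord c))) →
      TraceStep E (a, some x) (Sum.inr ⟨a, b, e⟩, true) (b, none)
  | dead {a b : V} (e : a ⟶ b) : TraceStep E (a, none) (Sum.inr ⟨a, b, e⟩, true) (b, none)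

variable {C} {E : List (TotalEdge V × Point V K × Point V K)}

theorem PathWord.exists_run {a b : V} {p : A.GPath a b} {f : List (Letter V K × Bool)}
    (h : C.PathWord p f) (ζ : Option (Point V K)) :
    ∃ ξ, Run (C.TraceStep E) (a, ζ) f (b, ξ) := by
  induction h generalizing ζ with
  | nil a => exact ⟨ζ, Run.nil _⟩
  | vertex k β _ ih =>
    obtain ⟨ξ, hξ⟩ := ih (ζ.map fun x => shift x [(k, β)])
    exact ⟨ξ, Run.cons (TraceStep.vertex _ k β ζ) hξ⟩
  | @edge a b d e _ _ _ ih =>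
    cases ζ with
    | none =>
      obtain ⟨ξ, hξ⟩ := ih none
      exact ⟨ξ, Run.cons (TraceStep.dead e) hξ⟩
    | some x =>
      by_cases H : ∀ t ∈ E, ∀ c : A.EdgeElement, t.1 = c.1 → c.1 = ⟨a, b, e⟩ →
        ¬ C.SamePoint a x (shift t.2.1 (C.αWord c))
      · obtain ⟨ξ, hξ⟩ := ih none
        exact ⟨ξ, Run.cons (TraceStep.stuck e x H) hξ⟩
      · push Not at H
        obtain ⟨t, ht, ⟨e', c⟩, h₁, h₂, h₃⟩ := H
        dsimp only at h₁ h₂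
        subst h₂
        obtain ⟨ξ, hξ⟩ := ih (some (shift t.2.2 (C.ωWord ⟨⟨a, b, e⟩, c⟩)))
        exact ⟨ξ, Run.cons (TraceStep.edge e c x t ht h₁ h₃) hξ⟩

theorem exists_pathWord_of_run {a b : V} {f : List (Letter V K × Bool)} {ζ ξ : Option (Point V K)}
    (h : Run (C.TraceStep E) (a, ζ) f (b, ξ)) : ∃ p : A.GPath a b, C.PathWord p f := by
  induction f generalizing a ζ with
  | nil =>
    cases h
    exact ⟨_, PathWord.nil _⟩
  | cons l f ih =>
    obtain ⟨⟨d, θ⟩, h₁, h₂⟩ := run_cons_iff.1 h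
    obtain ⟨p, hp⟩ := ih h₂
    cases h₁ with
    | vertex => exact ⟨_, hp.vertex _ _⟩
    | edge e => exact ⟨_, hp.edge e⟩
    | stuck e => exact ⟨_, hp.edge e⟩
    | dead e => exact ⟨_, hp.edge e⟩

theorem run_none {a b : V} {f : List (Letter V K × Bool)} {ξ : Option (Point V K)}
    (h : Run (C.TraceStep E) (a, none) f (b, ξ)) : ξ = none := by
  induction f generalizing a with
  | nil =>
    cases h
    rfl
  | cons l f ih =>
    obtain ⟨⟨d, θ⟩, h₁, h₂⟩ := run_cons_iff.1 h
    cases h₁ with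
    | vertex => exact ih h₂
    | dead e => exact ih h₂

/-- The machine chooses an arrow and an edge group element, but `step_unique` makes the resulting
point independent of the choice, and `stuck` is allowed only where no arrow fits. A single run
therefore settles whether and where the path is defined. -/
theorem PathWord.ev_iff {a b : V} {p : A.GPath a b} {f : List (Letter V K × Bool)}
    (h : C.PathWord p f) (hE : C.Valid E) {x : Point V K} {ξ : Option (Point V K)}
    (hr : Run (C.TraceStep E) (a, some x) f (b, ξ)) (Y : hE.partialAction.Pt b) :
    hE.partialAction.Ev p (hE.pt a x) Y ↔ ∃ y, ξ = some y ∧ hE.pt b y = Y := by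
  induction h generalizing x with
  | nil a =>
    cases hr
    simp only [PartialAction.Ev, inv_one, one_smul]
    simp
  | vertex k β _ ih =>
    obtain ⟨⟨d, θ⟩, h₁, h₂⟩ := run_cons_iff.1 hr
    cases h₁
    rw [← ih h₂, PartialAction.ev_lmul, ← hE.pt_shift]
  | @edge a b d e _ _ _ ih =>
    obtain ⟨⟨d, θ⟩, h₁, h₂⟩ := run_cons_iff.1 hr
    simp only [PartialAction.Ev, inv_one, one_smul]
    cases h₁ with
    | edge _ c _ t ht h₃ h₄ =>
      rw [← ih h₂]
      have hs : hE.partialAction.Step e (hE.pt a x)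
          (hE.pt b (shift t.2.2 (C.ωWord ⟨⟨a, b, e⟩, c⟩))) :=
        hE.step_iff.2 ⟨t, ht, h₃, c, hE.pt_eq_iff.2 h₄, rfl⟩
      constructor
      · rintro ⟨z, h₅, h₆⟩
        obtain rfl := hE.partialAction.step_unique hs h₅
        exact h₆
      · intro h
        exact ⟨_, hs, h⟩
    | stuck _ _ h₃ =>
      obtain rfl := run_none h₂
      refine iff_of_false ?_ (by simp)
      rintro ⟨z, h₅, -⟩
      obtain ⟨t, ht, hte, c, h₄, -⟩ := hE.step_iff.1 h₅
      exact h₃ t ht ⟨⟨a, b, e⟩, c⟩ hte rfl (hE.pt_eq_iff.1 h₄)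

end Coding

end GraphOfGroups

namespace GraphOfGroups

variable {V : Type u} [SerreGraph.{u, v} V] {A : GraphOfGroups.{u, v, w, x} V}

open GPath

/-! ### Equations in the fundamental group, read in a partial action -/

theorem GPath.reduced_nil {a : V} (g : A.vertexGroup a) : Reduced (nil g : A.GPath a a) := trivial

theorem GPath.equiv_of_append_append_inv {a b c : V} {p : A.GPath a b} {q : A.GPath b c}
    {r : A.GPath a c} {s : A.GPath a a} (h : GPath.Equiv (append p (append q (GPath.inv r))) s) :
    GPath.Equiv q (append (GPath.inv p) (append s r)) := by
  have h₁ := (GPath.Equiv.refl (GPath.inv p)).append (h.append (GPath.Equiv.refl r))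
  have h₂ := (inv_append p).append ((GPath.Equiv.refl q).append (inv_append r))
  simp only [append_assoc, append_one] at h₁ h₂
  have h₃ : append (nil 1) q = q := one_lmul q
  rw [h₃] at h₂
  exact h₂.symm.trans h₁

theorem transport_inv (v₀ : V) {a b : V} (p : A.GPath a b) :
    transport v₀ (GPath.inv p) = (transport v₀ p)⁻¹ := by
  rw [eq_inv_iff_mul_eq_one, ← transport_append, transport_congr v₀ (inv_append p), transport_one]

theorem transport_powSucc (v₀ : V) {a : V} (c : A.GPath a a) (n : ℕ) :
    transport v₀ (powSucc c n) = transport v₀ c ^ (n + 1) := by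
  induction n with
  | zero => simp [powSucc]
  | succ n ih => rw [powSucc, transport_append, ih, ← pow_succ']

namespace PartialAction

variable {P : A.PartialAction}

/-- The path `q` is equivalent to z⁻¹ η y, which can be followed from `Z` through `X` to `Y`.
Nothing is assumed about following `q` itself; its being reduced supplies this. -/
theorem ev_of_transport_eq {v₀ a : V} {z y : A.GPath v₀ a} {q : A.GPath a a} {η : A.GPath v₀ v₀}
    (hq : Reduced q)
    (h : transport v₀ z * transport v₀ q * (transport v₀ y)⁻¹ = loopClass η) {X : P.Pt v₀}
    {Y Z : P.Pt a} (hη : P.Ev η X X) (hz : P.Ev z X Z) (hy : P.Ev y X Y) : P.Ev q Z Y := by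
  rw [← transport_inv, mul_assoc, ← transport_append, ← transport_append, transport_loop,
    loopClass_eq_iff] at h
  exact Ev.of_equiv hq (equiv_of_append_append_inv h)
    (ev_append.2 ⟨X, hz.inv, ev_append.2 ⟨X, hη, hy⟩⟩)

/-- Some representative of each class fixes `X`, namely a product of the given loops and their
inverses; other representatives may be undefined at `X`. -/
theorem exists_ev_of_mem_closure {v₀ : V} {S : Set (A.FundamentalGroup v₀)} {X : P.Pt v₀}
    (hS : ∀ h ∈ S, ∃ η : A.GPath v₀ v₀, loopClass η = h ∧ P.Ev η X X) {h : A.FundamentalGroup v₀}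
    (hh : h ∈ Subgroup.closure S) : ∃ η : A.GPath v₀ v₀, loopClass η = h ∧ P.Ev η X X := by
  induction hh using Subgroup.closure_induction with
  | mem h hh => exact hS h hh
  | one => exact ⟨nil 1, rfl, by simp [Ev]⟩
  | mul g h _ _ ih₁ ih₂ =>
    obtain ⟨η₁, rfl, h₁⟩ := ih₁
    obtain ⟨η₂, rfl, h₂⟩ := ih₂
    exact ⟨append η₁ η₂, rfl, ev_append.2 ⟨X, h₁, h₂⟩⟩
  | inv h _ ih =>
    obtain ⟨η, rfl, h⟩ := ih
    exact ⟨GPath.inv η, rfl, h.inv⟩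

end PartialAction

namespace Coding

variable {K : Type*} (C : A.Coding K)

/-! ### Recognizing reduced words -/

/-- The machine that reads the words of reduced paths. It remembers the last edge and the word
that follows it. -/
inductive ReducedStep : V × Option (TotalEdge V) × List (K × Bool) → Letter V K × Bool →
    V × Option (TotalEdge V) × List (K × Bool) → Prop
  | vertex (a : V) (k : K) (β : Bool) (o : Option (TotalEdge V)) (w : List (K × Bool)) :
      ReducedStep (a, o, w) (Sum.inl (a, k), β) (a, o, w ++ [(k, β)])
  | edge {a b : V} (e : a ⟶ b) (o : Option (TotalEdge V)) (w : List (K × Bool)) :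
      (∀ c : A.EdgeElement, o = some c.1 → c.1.rev = ⟨a, b, e⟩ →
        evalWord (C.gen c.1.2.1) w ≠ evalWord (C.gen c.1.2.1) (C.ωWord c)) →
      ReducedStep (a, o, w) (Sum.inr ⟨a, b, e⟩, true) (b, some ⟨a, b, e⟩, [])

variable {C}

theorem exists_pathWord_of_run_reducedStep {a b : V} {f : List (Letter V K × Bool)}
    {s t : Option (TotalEdge V) × List (K × Bool)} (h : Run C.ReducedStep (a, s) f (b, t)) :
    ∃ p : A.GPath a b, C.PathWord p f := by
  induction f generalizing a s with
  | nil =>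
    cases h
    exact ⟨_, PathWord.nil _⟩
  | cons l f ih =>
    obtain ⟨⟨d, θ⟩, h₁, h₂⟩ := run_cons_iff.1 h
    obtain ⟨p, hp⟩ := ih h₂
    cases h₁ with
    | vertex => exact ⟨_, hp.vertex _ _⟩
    | edge e => exact ⟨_, hp.edge e⟩

theorem cancels_lmul_cons_one_iff {a b d a' : V} {e : a ⟶ b} {e' : a' ⟶ a} {w : List (K × Bool)}
    {p : A.GPath b d} : Cancels e' (lmul (evalWord (C.gen a) w) (cons 1 e p)) ↔
      ∃ c : A.EdgeElement, (⟨a', a, e'⟩ : TotalEdge V) = c.1 ∧ c.1.rev = ⟨a, b, e⟩ ∧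
        evalWord (C.gen c.1.2.1) w = evalWord (C.gen c.1.2.1) (C.ωWord c) := by
  constructor
  · rintro ⟨c, q, h⟩
    simp only [lmul, cons.injEq] at h
    obtain ⟨rfl, h₁, h₂, -⟩ := h
    obtain rfl := eq_of_heq h₂
    refine ⟨⟨⟨b, a, e'⟩, c⟩, rfl, rfl, ?_⟩
    rw [evalWord_ωWord, ← h₁, mul_one]
  · rintro ⟨⟨e'', c⟩, h₁, h₂, h₃⟩
    dsimp only at h₁
    subst h₁
    cases h₂
    refine ⟨c, p, ?_⟩
    rw [evalWord_ωWord] at h₃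
    rw [h₃, lmul, mul_one]

/-- Vertex letters only lengthen the stored word. When the next edge arrives, a cancellation is
excluded by comparing that word with the image of each element of the edge group. -/
theorem PathWord.exists_run_reducedStep_iff {a b : V} {p : A.GPath a b}
    {f : List (Letter V K × Bool)} (hp : C.PathWord p f) (o : Option (TotalEdge V))
    (w : List (K × Bool)) : (∃ t, Run C.ReducedStep (a, o, w) f (b, t)) ↔ Reduced p ∧
      ∀ (a' : V) (e' : a' ⟶ a), o = some ⟨a', a, e'⟩ →
        ¬ Cancels e' (lmul (evalWord (C.gen a) w) p) := by
  induction hp generalizing o w with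
  | nil a =>
    refine iff_of_true ⟨_, Run.nil _⟩ ⟨trivial, ?_⟩
    rintro a' e' - ⟨c, q, h⟩
    simp [lmul] at h
  | vertex k β hp ih =>
    have h₁ := ih o (w ++ [(k, β)])
    simp only [evalWord_append, ← lmul_lmul] at h₁
    rw [reduced_lmul, ← h₁]
    constructor
    · rintro ⟨t, ht⟩
      obtain ⟨s, hs, ht⟩ := run_cons_iff.1 ht
      cases hs
      exact ⟨t, ht⟩
    · rintro ⟨t, ht⟩
      exact ⟨t, Run.cons (ReducedStep.vertex _ k β o w) ht⟩
  | @edge a b d e p f hp ih =>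
    have h₁ := ih (some ⟨a, b, e⟩) []
    have h₂ : (∀ (a' : V) (e' : a' ⟶ b), some (⟨a, b, e⟩ : TotalEdge V) = some ⟨a', b, e'⟩ →
        ¬ Cancels e' (lmul (evalWord (C.gen b) []) p)) ↔ ¬ Cancels e p := by
      rw [evalWord_nil, one_lmul]
      constructor
      · intro h
        exact h a e rfl
      · rintro h a' e' he
        cases he
        exact h
    rw [h₂, and_comm] at h₁
    change _ ↔ (¬ Cancels e p ∧ Reduced p) ∧ _
    rw [← h₁]
    simp only [cancels_lmul_cons_one_iff]
    constructor
    · rintro ⟨t, ht⟩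
      obtain ⟨s, hs, ht⟩ := run_cons_iff.1 ht
      cases hs with
      | edge _ _ _ h =>
        refine ⟨⟨t, ht⟩, ?_⟩
        rintro a' e' rfl ⟨c, hc₁, hc₂, hc₃⟩
        exact h c (congrArg some hc₁) hc₂ hc₃
    · rintro ⟨⟨t, ht⟩, h⟩
      refine ⟨t, Run.cons (ReducedStep.edge e o w ?_) ht⟩
      rintro ⟨⟨a', a'', e'⟩, c⟩ rfl h₂ h₃
      cases h₂
      exact h a' e' rfl ⟨_, rfl, rfl, h₃⟩

theorem PathWord.exists_run_reducedStep_none_iff {a b : V} {p : A.GPath a b}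
    {f : List (Letter V K × Bool)} (hp : C.PathWord p f) :
    (∃ t, Run C.ReducedStep (a, none, []) f (b, t)) ↔ Reduced p := by
  rw [hp.exists_run_reducedStep_iff]
  simp

/-! ### Certificates for negative instances -/

variable (C)

/-- The traces of the powers of `c` that start at `x` do not end at `y`: this is witnessed by a
finite list of points. -/
def Evades (E : List (TotalEdge V × Point V K × Point V K)) (a : V)
    (c : List (Letter V K × Bool)) (x y : Point V K) : Prop :=
  -- `Z` contains the points reached by positive powers. The start `x` itself may coincide with `y`,
  -- since the exponent zero is excluded.
  ∃ Z : List (Point V K), (∀ ζ ∈ x :: Z, Run (C.TraceStep E) (a, some ζ) c (a, none) ∨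
    ∃ ζ' ∈ Z, Run (C.TraceStep E) (a, some ζ) c (a, some ζ')) ∧ ∀ ζ ∈ Z, ¬ C.SamePoint a ζ y

/-- Some non-trivial power of the element with the word `w` takes `x` to `y`. -/
def PowerHits (a : V) (w : List (K × Bool)) (x y : Point V K) : Prop :=
  x.1 = y.1 ∧ ∃ m : ℤ, m ≠ 0 ∧
    evalWord (C.gen a) x.2 * evalWord (C.gen a) w ^ m * (evalWord (C.gen a) y.2)⁻¹ ∈
      wordSubgroup (C.gen a) x.1.2

/-- The generators of the subgroup are loops at the point `q`. -/
def Stabilizes (v₀ : V) (E : List (TotalEdge V × Point V K × Point V K)) (q : Point V K)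
    (L : List (List (Letter V K × Bool))) : Prop :=
  ∀ l ∈ L, ∃ (f : List (Letter V K × Bool)) (r : Point V K),
    -- The given word `l` need not spell a path; `f` is a loop with the same value.
    evalWord (C.letter v₀) l = evalWord (C.letter v₀) f ∧
    Run (C.TraceStep E) (v₀, some q) f (v₀, some r) ∧ C.SamePoint v₀ r q

/-- A certificate for a negative answer to an instance of the power coset membership problem. -/
def Refuted (v₀ : V) (I : List (Letter V K × Bool) × List (Letter V K × Bool) ×
    List (List (Letter V K × Bool))) : Prop :=
  ∃ (E : List (TotalEdge V × Point V K × Point V K)) (q : Point V K), C.Valid E ∧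
    C.Stabilizes v₀ E q I.2.2 ∧
    ∃ (a : V) (z y c : List (Letter V K × Bool)) (p r : Point V K),
      -- The equations x z = y and g y = y c give x⁻¹ g ^ m = z c ^ m y⁻¹ for every m.
      evalWord (C.letter v₀) (I.1 ++ z) = evalWord (C.letter v₀) y ∧
      evalWord (C.letter v₀) (I.2.1 ++ y) = evalWord (C.letter v₀) (y ++ c) ∧
      Run (C.TraceStep E) (v₀, some q) z (a, some p) ∧
      Run (C.TraceStep E) (v₀, some q) y (a, some r) ∧
      ((∃ w, c = vertexWord a w ∧ ¬ C.PowerHits a w p r) ∨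
        ((∃ t, Run C.ReducedStep (a, none, []) c (a, t)) ∧
          (∃ t, Run C.ReducedStep (a, none, []) (c ++ c) (a, t)) ∧
          C.Evades E a c p r ∧ C.Evades E a c r p))

/-! ### Soundness of the certificates -/

variable {C}

theorem Evades.not_ev {E : List (TotalEdge V × Point V K × Point V K)} {a : V}
    {f : List (Letter V K × Bool)} {x y : Point V K} (h : C.Evades E a f x y) (hE : C.Valid E)
    {c : A.GPath a a} (hc : C.PathWord c f) (n : ℕ) :
    ¬ hE.partialAction.Ev (powSucc c n) (hE.pt a x) (hE.pt a y) := by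
  obtain ⟨Z, hZ, hZ'⟩ := h
  have h₁ : ∀ ζ ∈ x :: Z, ∀ Y, hE.partialAction.Ev c (hE.pt a ζ) Y → ∃ ζ' ∈ Z, hE.pt a ζ' = Y := by
    intro ζ hζ Y hY
    rcases hZ ζ hζ with h | ⟨ζ', hζ', h⟩
    · rw [hc.ev_iff hE h] at hY
      simp at hY
    · rw [hc.ev_iff hE h] at hY
      obtain ⟨_, h, hY⟩ := hY
      cases h
      exact ⟨ζ', hζ', hY⟩
  have h₂ : ∀ n, ∀ ζ ∈ x :: Z, ∀ Y, hE.partialAction.Ev (powSucc c n) (hE.pt a ζ) Y →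
      ∃ ζ' ∈ Z, hE.pt a ζ' = Y := by
    intro n
    induction n with
    | zero => exact h₁
    | succ n ih =>
      intro ζ hζ Y hY
      obtain ⟨W, hW, hW'⟩ := PartialAction.ev_append.1 hY
      obtain ⟨ζ', hζ', rfl⟩ := h₁ ζ hζ W hW
      exact ih ζ' (List.mem_cons_of_mem _ hζ') Y hW'
  intro h
  obtain ⟨ζ, hζ, h⟩ := h₂ n x List.mem_cons_self _ h
  exact hZ' ζ hζ (hE.pt_eq_iff.1 h)

theorem Refuted.not_powerCoset {v₀ : V} {I : List (Letter V K × Bool) ×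
    List (Letter V K × Bool) × List (List (Letter V K × Bool))} (h : C.Refuted v₀ I) :
    ¬ PowerCoset (C.letter v₀) I := by
  obtain ⟨E, q, hE, hL, a, z, y, f, p, r, hxz, hgy, hz, hy, hc⟩ := h
  obtain ⟨zp, hzp⟩ := exists_pathWord_of_run hz
  obtain ⟨yp, hyp⟩ := exists_pathWord_of_run hy
  have evz : hE.partialAction.Ev zp (hE.pt v₀ q) (hE.pt a p) :=
    (hzp.ev_iff hE hz _).2 ⟨_, rfl, rfl⟩
  have evy : hE.partialAction.Ev yp (hE.pt v₀ q) (hE.pt a r) :=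
    (hyp.ev_iff hE hy _).2 ⟨_, rfl, rfl⟩
  rintro ⟨m, hm, hmem⟩
  rw [evalWord_append, hzp.evalWord_eq, hyp.evalWord_eq] at hxz
  rw [evalWord_append, evalWord_append, hyp.evalWord_eq] at hgy
  obtain ⟨c, hcf, hc⟩ : ∃ c : A.GPath a a, C.PathWord c f ∧
      ((∃ w, c = nil (evalWord (C.gen a) w) ∧ ¬ C.PowerHits a w p r) ∨
        (Reduced c ∧ Reduced (append c c) ∧ C.Evades E a f p r ∧ C.Evades E a f r p)) := by
    rcases hc with ⟨w, rfl, hw⟩ | ⟨⟨t, ht⟩, ht', h₁, h₂⟩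
    · exact ⟨_, C.pathWord_vertexWord a w, Or.inl ⟨w, rfl, hw⟩⟩
    · obtain ⟨c, hc⟩ := exists_pathWord_of_run_reducedStep ht
      exact ⟨c, hc, Or.inr ⟨hc.exists_run_reducedStep_none_iff.1 ⟨t, ht⟩,
        (hc.append hc).exists_run_reducedStep_none_iff.1 ht', h₁, h₂⟩⟩
  rw [hcf.evalWord_eq] at hgy
  set x := evalWord (C.letter v₀) I.1
  set g := evalWord (C.letter v₀) I.2.1
  have hx : x⁻¹ = transport v₀ zp * (transport v₀ yp)⁻¹ := by
    rw [← hxz]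
    group
  have hg : g = transport v₀ yp * transport v₀ c * (transport v₀ yp)⁻¹ := by
    rw [← hgy]
    group
  rw [hx, hg, conj_zpow] at hmem
  have hS : ∀ h ∈ wordSubgroup (C.letter v₀) I.2.2, ∃ η : A.GPath v₀ v₀, loopClass η = h ∧
      hE.partialAction.Ev η (hE.pt v₀ q) (hE.pt v₀ q) := by
    intro h hh
    refine PartialAction.exists_ev_of_mem_closure ?_ hh
    rintro _ ⟨l, hl, rfl⟩
    obtain ⟨f', r', hlf, hr, hs⟩ := hL l hl
    obtain ⟨η, hη⟩ := exists_pathWord_of_run hr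
    refine ⟨η, ?_, (hη.ev_iff hE hr _).2 ⟨_, rfl, hE.pt_eq_iff.2 hs⟩⟩
    rw [hlf, hη.evalWord_eq, transport_loop]
  rcases hc with ⟨w, rfl, hw⟩ | ⟨hr₁, hr₂, hpr, hrp⟩
  · obtain ⟨η, hη, hη'⟩ := hS _ hmem
    have h₁ : hE.partialAction.Ev (nil (evalWord (C.gen a) w ^ m)) (hE.pt a p) (hE.pt a r) := by
      refine PartialAction.ev_of_transport_eq (η := η) (reduced_nil _) ?_ hη' evz evy
      rw [hη, ← vertexHom_apply, ← vertexHom_apply, map_zpow]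
      group
    obtain ⟨h₂, h₃⟩ := hE.inv_smul_pt_eq_iff.1 h₁
    exact hw ⟨h₂, m, hm, h₃⟩
  -- A negative power taking `p` to `r` is a positive power taking `r` to `p`, whence the two
  -- conditions of evasion. The shift by one occurs because `powSucc c n` is the power with exponent
  -- n + 1.
  · rcases lt_or_gt_of_ne hm with hm | hm
    · obtain ⟨η, hη, hη'⟩ := hS _ (inv_mem hmem)
      obtain ⟨n, rfl⟩ : ∃ n : ℕ, m = -(n + 1 : ℕ) := ⟨(-m - 1).toNat, by omega⟩
      refine hrp.not_ev hE hcf n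
        (PartialAction.ev_of_transport_eq (η := η) (hr₁.powSucc hr₂ n) ?_ hη' evy evz)
      rw [hη, transport_powSucc, zpow_neg, zpow_natCast]
      group
    · obtain ⟨η, hη, hη'⟩ := hS _ hmem
      obtain ⟨n, rfl⟩ : ∃ n : ℕ, m = (n + 1 : ℕ) := ⟨(m - 1).toNat, by omega⟩
      refine hpr.not_ev hE hcf n
        (PartialAction.ev_of_transport_eq (η := η) (hr₁.powSucc hr₂ n) ?_ hη' evz evy)
      rw [hη, transport_powSucc, zpow_natCast]
      group

end Coding

end GraphOfGroups

namespace GraphOfGroups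

variable {V : Type u} [SerreGraph.{u, v} V] {A : GraphOfGroups.{u, v, w, x} V}

open GPath

@[simp] theorem TotalEdge.rev_rev (e : TotalEdge V) : e.rev.rev = e := by
  obtain ⟨a, b, e⟩ := e
  simp [TotalEdge.rev, Quiver.reverse_reverse]

namespace Coding

variable {K : Type*} (C : A.Coding K) (v₀ : V)

theorem exists_loop_word (g : A.FundamentalGroup v₀) :
    ∃ (p : A.GPath v₀ v₀) (f : List (Letter V K × Bool)), C.PathWord p f ∧ loopClass p = g := by
  obtain ⟨p, rfl⟩ := Quotient.exists_rep g
  obtain ⟨f, hf⟩ := C.exists_pathWord p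
  exact ⟨p, f, hf, rfl⟩

theorem exists_evalWord_letter (g : A.FundamentalGroup v₀) :
    ∃ f, evalWord (C.letter v₀) f = g := by
  obtain ⟨p, f, hf, rfl⟩ := C.exists_loop_word v₀ g
  exact ⟨f, by rw [hf.evalWord_eq, transport_loop]⟩

theorem closure_range_letter : Subgroup.closure (Set.range (C.letter v₀)) = ⊤ := by
  refine eq_top_iff.2 fun g _ => ?_
  obtain ⟨f, rfl⟩ := C.exists_evalWord_letter v₀ g
  exact evalWord_mem_closure _ f

/-! ### The coset space of a subgroup as a partial action -/

variable (H : Subgroup (A.FundamentalGroup v₀))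

/-- The chosen representative of a double coset modulo `H` and a vertex group. -/
noncomputable def canon {v₀ : V} (H : Subgroup (A.FundamentalGroup v₀)) (a : V)
    (g : A.FundamentalGroup v₀) : A.FundamentalGroup v₀ :=
  Quotient.out (DoubleCoset.mk H (A.vertexHom v₀ a).range g)

variable {v₀ H}

theorem canon_spec (a : V) (g : A.FundamentalGroup v₀) :
    ∃ h ∈ H, ∃ k : A.vertexGroup a, g = h * canon H a g * A.vertexHom v₀ a k := by
  have h := DoubleCoset.mk_out_eq_mul H (A.vertexHom v₀ a).range g
  obtain ⟨h, _, hh, ⟨k, rfl⟩, he⟩ := h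
  refine ⟨h⁻¹, inv_mem hh, k⁻¹, ?_⟩
  rw [canon, DoubleCoset.mk, he, map_inv]
  group

theorem canon_eq_of {a : V} {g g' : A.FundamentalGroup v₀} {k : A.vertexGroup a}
    (h : g * A.vertexHom v₀ a k * g'⁻¹ ∈ H) : canon H a g = canon H a g' := by
  refine congrArg Quotient.out ((DoubleCoset.eq H (A.vertexHom v₀ a).range g g').2
    ⟨_, inv_mem h, _, ⟨k, rfl⟩, ?_⟩)
  group

/-- The element that takes the base point `H` to a point, given by the representative of a double
coset and a word. -/
noncomputable def value (a : V) (s : A.FundamentalGroup v₀ × List (K × Bool)) :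
    A.FundamentalGroup v₀ :=
  s.1 * A.vertexHom v₀ a (evalWord (C.gen a) s.2)

open Classical in
/-- Those words of `S` that fix the orbit base point with the representative `r`. -/
noncomputable def stabWords (H : Subgroup (A.FundamentalGroup v₀)) (S : List (List (K × Bool)))
    (a : V) (r : A.FundamentalGroup v₀) : List (List (K × Bool)) :=
  S.filter fun k => r * A.vertexHom v₀ a (evalWord (C.gen a) k) * r⁻¹ ∈ H

/-- The name of a point. -/
noncomputable def name (H : Subgroup (A.FundamentalGroup v₀)) (S : List (List (K × Bool))) (a : V)
    (s : A.FundamentalGroup v₀ × List (K × Bool)) : Point V K :=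
  (((C.exists_evalWord_letter v₀ s.1).choose, C.stabWords H S a s.1), s.2)

variable {C}

theorem value_append (a : V) (r : A.FundamentalGroup v₀) (k l : List (K × Bool)) :
    C.value a (r, k ++ l) = C.value a (r, k) * A.vertexHom v₀ a (evalWord (C.gen a) l) := by
  simp [value, mul_assoc]

theorem fst_eq_of_value_mem {a : V} {s t : A.FundamentalGroup v₀ × List (K × Bool)}
    (hs : canon H a s.1 = s.1) (ht : canon H a t.1 = t.1)
    (h : C.value a s * (C.value a t)⁻¹ ∈ H) : s.1 = t.1 := by
  rw [← hs, ← ht]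
  refine canon_eq_of (k := evalWord (C.gen a) s.2 * (evalWord (C.gen a) t.2)⁻¹) ?_
  simpa [value, mul_assoc] using h

variable (C) in
theorem exists_value (a : V) (g : A.FundamentalGroup v₀) :
    ∃ s : A.FundamentalGroup v₀ × List (K × Bool), canon H a s.1 = s.1 ∧
      g * (C.value a s)⁻¹ ∈ H := by
  obtain ⟨h, hh, k, hk⟩ := canon_spec (H := H) a g
  obtain ⟨w, rfl⟩ := exists_evalWord (C.closure_gen a) k
  have h₁ : g * (canon H a g * A.vertexHom v₀ a (evalWord (C.gen a) w))⁻¹ = h := by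
    rw [mul_inv_eq_iff_eq_mul, ← mul_assoc]
    exact hk
  refine ⟨(canon H a g, w), canon_eq_of (k := evalWord (C.gen a) w) ?_, ?_⟩
  · have h₂ := inv_mem hh
    rwa [← h₁, mul_inv_rev, inv_inv] at h₂
  · exact h₁ ▸ hh

variable {S : List (List (K × Bool))}

theorem mem_of_mem_wordSubgroup_stabWords {a : V} {r : A.FundamentalGroup v₀}
    {k : A.vertexGroup a} (h : k ∈ wordSubgroup (C.gen a) (C.stabWords H S a r)) :
    r * A.vertexHom v₀ a k * r⁻¹ ∈ H := by
  have h₁ : wordSubgroup (C.gen a) (C.stabWords H S a r) ≤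
      H.comap ((MulAut.conj r).toMonoidHom.comp (A.vertexHom v₀ a)) := by
    refine (Subgroup.closure_le _).2 ?_
    rintro _ ⟨l, hl, rfl⟩
    simpa [stabWords] using (List.mem_filter.1 hl).2
  simpa using h₁ h

theorem name_fst_inj {a : V} {s t : A.FundamentalGroup v₀ × List (K × Bool)}
    (h : (C.name H S a s).1 = (C.name H S a t).1) : s.1 = t.1 := by
  have h₁ := congrArg (fun o => evalWord (C.letter v₀) o.1) h
  simpa [name, (C.exists_evalWord_letter v₀ s.1).choose_spec,
    (C.exists_evalWord_letter v₀ t.1).choose_spec] using h₁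

theorem value_mul_mem_of_mem {a : V} {s t : A.FundamentalGroup v₀ × List (K × Bool)}
    {k : A.vertexGroup a} (h : (C.name H S a s).1 = (C.name H S a t).1)
    (h' : evalWord (C.gen a) s.2 * k * (evalWord (C.gen a) t.2)⁻¹ ∈
      wordSubgroup (C.gen a) (C.name H S a s).1.2) :
    C.value a s * A.vertexHom v₀ a k * (C.value a t)⁻¹ ∈ H := by
  have h₁ := mem_of_mem_wordSubgroup_stabWords h'
  rw [value, value, ← name_fst_inj h]
  simpa [mul_assoc] using h₁

theorem value_mem_of_samePoint {a : V} {s t : A.FundamentalGroup v₀ × List (K × Bool)}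
    (h : C.SamePoint a (C.name H S a s) (C.name H S a t)) :
    C.value a s * (C.value a t)⁻¹ ∈ H := by
  have := value_mul_mem_of_mem (k := 1) h.1 (by rw [mul_one]; exact h.2)
  simpa using this

/-- Equal names always mean equal cosets, but the converse needs a word in `S` for the stabilizing
element, since the names know only the part of the stabilizer generated by words from `S`. -/
theorem samePoint_name {a : V} {s t : A.FundamentalGroup v₀ × List (K × Bool)}
    (hs : canon H a s.1 = s.1) (ht : canon H a t.1 = t.1)
    (h : C.value a s * (C.value a t)⁻¹ ∈ H)
    (hS : ∃ k ∈ S, evalWord (C.gen a) k =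
      evalWord (C.gen a) s.2 * (evalWord (C.gen a) t.2)⁻¹) :
    C.SamePoint a (C.name H S a s) (C.name H S a t) := by
  have h₁ := fst_eq_of_value_mem hs ht h
  refine ⟨by simp only [name, h₁], ?_⟩
  obtain ⟨k, hk, hk'⟩ := hS
  refine Subgroup.subset_closure ⟨k, List.mem_filter.2 ⟨hk, ?_⟩, hk'⟩
  rw [value, value, ← h₁] at h
  simpa [hk', mul_assoc] using h

/-- `(e, s, t)` is an arrow of the coset space of `H`. -/
def IsArrow (C : A.Coding K) (H : Subgroup (A.FundamentalGroup v₀))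
    (t : TotalEdge V × (A.FundamentalGroup v₀ × List (K × Bool)) ×
      (A.FundamentalGroup v₀ × List (K × Bool))) : Prop :=
  canon H t.1.1 t.2.1.1 = t.2.1.1 ∧ canon H t.1.2.1 t.2.2.1 = t.2.2.1 ∧
    C.value t.1.1 t.2.1 * A.edgeElement v₀ t.1.2.2 * (C.value t.1.2.1 t.2.2)⁻¹ ∈ H

/-- The triple of names. -/
noncomputable def nameArrow (C : A.Coding K) (H : Subgroup (A.FundamentalGroup v₀))
    (S : List (List (K × Bool)))
    (t : TotalEdge V × (A.FundamentalGroup v₀ × List (K × Bool)) ×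
      (A.FundamentalGroup v₀ × List (K × Bool))) : TotalEdge V × Point V K × Point V K :=
  (t.1, C.name H S t.1.1 t.2.1, C.name H S t.1.2.1 t.2.2)

theorem IsArrow.rev {t : TotalEdge V × (A.FundamentalGroup v₀ × List (K × Bool)) ×
    (A.FundamentalGroup v₀ × List (K × Bool))} (h : C.IsArrow H t) :
    C.IsArrow H (t.1.rev, t.2.2, t.2.1) := by
  refine ⟨h.2.1, h.1, ?_⟩
  have := inv_mem h.2.2
  rw [mul_inv_rev, mul_inv_rev, ← edgeElement_reverse, inv_inv, ← mul_assoc] at this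
  exact this

variable {F : List (TotalEdge V × (A.FundamentalGroup v₀ × List (K × Bool)) ×
  (A.FundamentalGroup v₀ × List (K × Bool)))}

/-- Right multiplication on the cosets of `H` is a genuine action, so sources that coincide force
targets to coincide as cosets. The words in `S` make the coincidence of targets visible in the
names. -/
theorem valid_map_nameArrow (hF : ∀ t ∈ F, C.IsArrow H t)
    (hrev : ∀ t ∈ F, (t.1.rev, t.2.2, t.2.1) ∈ F)
    (hS : ∀ t ∈ F, ∀ t' ∈ F, ∀ c, t.2.1.2 ++ C.αWord c ++ FreeGroup.invRev t'.2.1.2 ∈ S) :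
    C.Valid (F.map (C.nameArrow H S)) := by
  constructor
  · intro t ht
    obtain ⟨t, ht₀, rfl⟩ := List.mem_map.1 ht
    exact List.mem_map.2 ⟨_, hrev t ht₀, rfl⟩
  · intro t ht t' ht' c hc hc'
    obtain ⟨⟨e, s₁, s₂⟩, ht₀, rfl⟩ := List.mem_map.1 ht
    obtain ⟨⟨e', s₁', s₂'⟩, ht₀', rfl⟩ := List.mem_map.1 ht'
    obtain ⟨⟨a, b, e₀⟩, c⟩ := c
    simp only [nameArrow] at hc hc' ⊢
    subst hc hc'
    intro h
    have h₁ : C.value a (s₁.1, s₁.2 ++ C.αWord ⟨⟨a, b, e₀⟩, c⟩) * (C.value a s₁')⁻¹ ∈ H :=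
      value_mem_of_samePoint h
    rw [value_append, evalWord_αWord_mk] at h₁
    obtain ⟨-, h₂, h₃⟩ := hF _ ht₀
    obtain ⟨-, h₂', h₃'⟩ := hF _ ht₀'
    -- The targets are sources of the reversed arrows, so `hS`, which speaks of sources only,
    -- applies to them too.
    refine samePoint_name (s := (s₂.1, s₂.2 ++ C.ωWord ⟨⟨a, b, e₀⟩, c⟩)) h₂ h₂' ?_
      ⟨_, hS _ (hrev _ ht₀) _ (hrev _ ht₀') ⟨⟨b, a, Quiver.reverse e₀⟩, A.rev e₀ c⟩, ?_⟩
    · rw [value_append, evalWord_ωWord_mk]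
      have h₄ := mul_mem (mul_mem (inv_mem h₃) h₁) h₃'
      have h₅ := vertexHom_mul_edgeElement v₀ e₀ c
      convert h₄ using 1
      simp only [mul_inv_rev, inv_inv, mul_assoc, inv_mul_cancel_left]
      rw [← mul_assoc (A.vertexHom v₀ a _) (A.edgeElement v₀ e₀), h₅]
      group
    · rw [evalWord_append, evalWord_append, evalWord_invRev, evalWord_αWord_mk, A.α_rev,
        evalWord_append, evalWord_ωWord_mk]

theorem shift_name (a : V) (s : A.FundamentalGroup v₀ × List (K × Bool)) (k : List (K × Bool)) :
    shift (C.name H S a s) k = C.name H S a (s.1, s.2 ++ k) := rfl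

/-- Every path can be traced from every point of the coset space; the trace uses finitely many
arrows. -/
theorem PathWord.exists_arrows {a b : V} {p : A.GPath a b} {f : List (Letter V K × Bool)}
    (hp : C.PathWord p f) {s : A.FundamentalGroup v₀ × List (K × Bool)}
    (hs : canon H a s.1 = s.1) :
    ∃ (F : List (TotalEdge V × (A.FundamentalGroup v₀ × List (K × Bool)) ×
        (A.FundamentalGroup v₀ × List (K × Bool))))
      (t : A.FundamentalGroup v₀ × List (K × Bool)), (∀ t ∈ F, C.IsArrow H t) ∧
      canon H b t.1 = t.1 ∧ C.value a s * transport v₀ p * (C.value b t)⁻¹ ∈ H ∧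
      -- The trace must work for every `S` and every larger list of arrows, since `S` is chosen only
      -- after all arrows are known.
      ∀ (S : List (List (K × Bool))) (E : List (TotalEdge V × Point V K × Point V K)),
        (∀ t ∈ F, C.nameArrow H S t ∈ E) →
        Run (C.TraceStep E) (a, some (C.name H S a s)) f (b, some (C.name H S b t)) := by
  induction hp generalizing s with
  | nil a =>
    refine ⟨[], s, by simp, hs, ?_, fun _ _ _ => Run.nil _⟩
    rw [transport_one]
    simp [one_mem]
  | @vertex a b k β p f hp ih =>
    obtain ⟨F, t, h₁, h₂, h₃, h₄⟩ := ih (s := (s.1, s.2 ++ [(k, β)])) hs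
    refine ⟨F, t, h₁, h₂, ?_, fun S E hE => Run.cons (TraceStep.vertex a k β _) (h₄ S E hE)⟩
    rw [value_append] at h₃
    rwa [transport_lmul, ← mul_assoc]
  | @edge a b d e p f hp ih =>
    obtain ⟨t, ht, ht'⟩ := C.exists_value (H := H) b (C.value a s * A.edgeElement v₀ e)
    obtain ⟨F, t', h₁, h₂, h₃, h₄⟩ := ih (s := (t.1, t.2 ++ C.ωWord ⟨⟨a, b, e⟩, 1⟩)) ht
    refine ⟨(⟨a, b, e⟩, s, t) :: F, t', ?_, h₂, ?_, fun S E hE => ?_⟩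
    · intro t₀ ht₀
      rcases List.mem_cons.1 ht₀ with rfl | ht₀
      · exact ⟨hs, ht, ht'⟩
      · exact h₁ t₀ ht₀
    · rw [value_append, evalWord_ωWord_mk, map_one, map_one, mul_one] at h₃
      rw [transport_cons_one]
      convert mul_mem ht' h₃ using 1
      group
    · refine Run.cons (TraceStep.edge e 1 _ _ (hE _ List.mem_cons_self) rfl ?_)
        (h₄ S E fun t ht => hE t (List.mem_cons_of_mem _ ht))
      refine ⟨rfl, ?_⟩
      simp only [shift, nameArrow, evalWord_append, evalWord_αWord_mk, map_one, mul_one]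
      simp [one_mem]

/-- Traces in the coset space compute cosets. -/
theorem PathWord.value_of_run {a b : V} {p : A.GPath a b} {f : List (Letter V K × Bool)}
    (hp : C.PathWord p f) (hF : ∀ t ∈ F, C.IsArrow H t)
    {s : A.FundamentalGroup v₀ × List (K × Bool)} {y : Point V K}
    (h : Run (C.TraceStep (F.map (C.nameArrow H S))) (a, some (C.name H S a s)) f (b, some y)) :
    ∃ t : A.FundamentalGroup v₀ × List (K × Bool), y = C.name H S b t ∧
      C.value a s * transport v₀ p * (C.value b t)⁻¹ ∈ H := by
  induction hp generalizing s with
  | nil a =>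
    cases h
    refine ⟨s, rfl, ?_⟩
    rw [transport_one]
    simp [one_mem]
  | @vertex a b k β p f hp ih =>
    obtain ⟨⟨d, θ⟩, h₁, h₂⟩ := run_cons_iff.1 h
    cases h₁
    obtain ⟨t, rfl, ht⟩ := ih (s := (s.1, s.2 ++ [(k, β)])) h₂
    refine ⟨t, rfl, ?_⟩
    rw [value_append] at ht
    rwa [transport_lmul, ← mul_assoc]
  | @edge a b d e p f hp ih =>
    obtain ⟨⟨d, θ⟩, h₁, h₂⟩ := run_cons_iff.1 h
    cases h₁ with
    | stuck => cases run_none h₂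
    | edge _ c _ t ht hte hs =>
      obtain ⟨⟨e', s₁, s₂⟩, ht₀, rfl⟩ := List.mem_map.1 ht
      simp only [nameArrow] at hte h₂ hs
      subst hte
      rw [shift_name] at h₂ hs
      obtain ⟨t, rfl, h₃⟩ := ih h₂
      refine ⟨t, rfl, ?_⟩
      have h₄ := value_mem_of_samePoint hs
      obtain ⟨-, -, h₅⟩ := hF _ ht₀
      rw [value_append, evalWord_αWord_mk] at h₄
      rw [value_append, evalWord_ωWord_mk] at h₃
      rw [transport_cons_one]
      dsimp only at h₅
      have h₆ := eq_inv_mul_of_mul_eq (vertexHom_mul_edgeElement v₀ e c)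
      convert mul_mem (mul_mem h₄ h₅) h₃ using 1
      conv_lhs => rw [h₆]
      group

end Coding

end GraphOfGroups

/-! ### Completeness of the certificates -/

namespace GraphOfGroups

variable {V : Type u} [SerreGraph.{u, v} V] {A : GraphOfGroups.{u, v, w, x} V}

open GPath

namespace Coding

variable {K : Type*} {C : A.Coding K} {v₀ : V}

theorem PathWord.exists_edge_mem {a b : V} {p : A.GPath a b} {f : List (Letter V K × Bool)}
    (hp : C.PathWord p f) (h : p.length ≠ 0) : ∃ e : TotalEdge V, (Sum.inr e, true) ∈ f := by
  induction hp with
  | nil a => exact (h rfl).elim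
  | vertex k β _ ih =>
    rw [length_lmul] at h
    obtain ⟨e, he⟩ := ih h
    exact ⟨e, List.mem_cons_of_mem _ he⟩
  | edge e _ _ => exact ⟨_, List.mem_cons_self⟩

/-- Reading an edge resets the point to the target of an arrow in `E`, shifted by an edge group
element: finitely many possibilities, whatever came before. The vertex letters after the last edge
add a fixed shift. -/
theorem finite_run_end [Finite A.EdgeElement] (E : List (TotalEdge V × Point V K × Point V K))
    {f : List (Letter V K × Bool)} (hf : ∃ e : TotalEdge V, (Sum.inr e, true) ∈ f) :
    {y : Point V K | ∃ a x b, Run (C.TraceStep E) (a, some x) f (b, some y)}.Finite := by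
  induction f using List.reverseRecOn with
  | nil => simp at hf
  | append_singleton f l ih =>
    obtain ⟨l | l, β⟩ := l
    · have h₁ := (ih (by simpa using hf)).image fun x => shift x [(l.2, β)]
      refine h₁.subset ?_
      rintro y ⟨a, x, b, hr⟩
      obtain ⟨⟨d, ξ⟩, hr₀, hl⟩ := run_append_iff.1 hr
      obtain ⟨s, hl, hs⟩ := run_cons_iff.1 hl
      cases hs
      generalize hy : some y = ξ' at hl
      cases hl with
      | vertex a' k β =>
        obtain ⟨z, rfl, rfl⟩ := Option.map_eq_some_iff.1 hy.symm
        exact ⟨z, ⟨a, x, _, hr₀⟩, rfl⟩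
    · have h₁ : (Set.image2 (fun (t : TotalEdge V × Point V K × Point V K) (c : A.EdgeElement) =>
          shift t.2.2 (C.ωWord c)) {t | t ∈ E} Set.univ).Finite :=
        Set.Finite.image2 _ (List.finite_toSet E) Set.finite_univ
      refine h₁.subset ?_
      rintro y ⟨a, x, b, hr⟩
      obtain ⟨⟨d, ξ⟩, hr₀, hl⟩ := run_append_iff.1 hr
      obtain ⟨s, hl, hs⟩ := run_cons_iff.1 hl
      cases hs
      cases hl with
      | edge e c x' t ht => exact ⟨t, ht, _, trivial, rfl⟩

variable {H : Subgroup (A.FundamentalGroup v₀)} {S : List (List (K × Bool))}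
  {F : List (TotalEdge V × (A.FundamentalGroup v₀ × List (K × Bool)) ×
    (A.FundamentalGroup v₀ × List (K × Bool)))}

/-- The list consists of the points reachable by one or more traces of `c`. It is finite by
`finite_run_end`, and each of its points names the coset of the starting value times a positive
power of `c`. -/
theorem evades_of_forall [Finite A.EdgeElement] (hF : ∀ t ∈ F, C.IsArrow H t) {a : V}
    {c : A.GPath a a} {f : List (Letter V K × Bool)} (hc : C.PathWord c f) (hl : c.length ≠ 0)
    {s t : A.FundamentalGroup v₀ × List (K × Bool)}
    (h : ∀ n : ℕ, C.value a s * transport v₀ c ^ (n + 1) * (C.value a t)⁻¹ ∉ H) :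
    C.Evades (F.map (C.nameArrow H S)) a f (C.name H S a s) (C.name H S a t) := by
  let R : Point V K → Point V K → Prop := fun x y =>
    Run (C.TraceStep (F.map (C.nameArrow H S))) (a, some x) f (a, some y)
  have hfin : {y | Relation.TransGen R (C.name H S a s) y}.Finite := by
    refine (finite_run_end (C := C) (F.map (C.nameArrow H S)) (hc.exists_edge_mem hl)).subset ?_
    intro y hy
    obtain ⟨x, -, hxy⟩ := Relation.TransGen.tail'_iff.1 hy
    exact ⟨a, x, a, hxy⟩
  have hval : ∀ y, Relation.TransGen R (C.name H S a s) y → ∃ (n : ℕ) (s' : _),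
      y = C.name H S a s' ∧ C.value a s * transport v₀ c ^ (n + 1) * (C.value a s')⁻¹ ∈ H := by
    intro y hy
    induction hy with
    | single h =>
      obtain ⟨s', rfl, hs'⟩ := hc.value_of_run hF h
      exact ⟨0, s', rfl, by simpa using hs'⟩
    | tail _ h ih =>
      obtain ⟨n, s', rfl, hs'⟩ := ih
      obtain ⟨s'', rfl, hs''⟩ := hc.value_of_run hF h
      refine ⟨n + 1, s'', rfl, ?_⟩
      convert mul_mem hs' hs'' using 1
      rw [pow_succ (transport v₀ c) (n + 1)]
      group
  refine ⟨hfin.toFinset.toList, ?_, ?_⟩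
  · intro ζ hζ
    obtain ⟨ξ, hξ⟩ := hc.exists_run (E := F.map (C.nameArrow H S)) (some ζ)
    cases ξ with
    | none => exact Or.inl hξ
    | some ζ' =>
      refine Or.inr ⟨ζ', ?_, hξ⟩
      rw [Finset.mem_toList, Set.Finite.mem_toFinset]
      rcases List.mem_cons.1 hζ with rfl | hζ
      · exact Relation.TransGen.single hξ
      · rw [Finset.mem_toList, Set.Finite.mem_toFinset] at hζ
        exact Relation.TransGen.tail hζ hξ
  · intro ζ hζ hsame
    rw [Finset.mem_toList, Set.Finite.mem_toFinset] at hζ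
    obtain ⟨n, s', rfl, hs'⟩ := hval ζ hζ
    refine h n ?_
    convert mul_mem hs' (value_mem_of_samePoint hsame) using 1
    group

/-- These are all quotients of sources of arrows, twisted by edge group elements; there are finitely
many because the edge groups are finite. -/
theorem exists_stabilizing_words [Finite A.EdgeElement]
    (F : List (TotalEdge V × (A.FundamentalGroup v₀ × List (K × Bool)) ×
      (A.FundamentalGroup v₀ × List (K × Bool)))) (X : List (List (K × Bool))) :
    ∃ S : List (List (K × Bool)), (∀ k ∈ X, k ∈ S) ∧ ∀ t ∈ F, ∀ t' ∈ F, ∀ c,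
      t.2.1.2 ++ C.αWord c ++ FreeGroup.invRev t'.2.1.2 ∈ S := by
  have h₁ : (Set.image2 (fun (t : _ × A.EdgeElement) t' =>
      t.1.2.1.2 ++ C.αWord t.2 ++ FreeGroup.invRev t'.2.1.2)
      ({t | t ∈ F} ×ˢ Set.univ) {t | t ∈ F}).Finite :=
    Set.Finite.image2 _ ((List.finite_toSet F).prod Set.finite_univ) (List.finite_toSet F)
  refine ⟨X ++ h₁.toFinset.toList, fun k hk => List.mem_append_left _ hk, ?_⟩
  intro t ht t' ht' c
  refine List.mem_append_right _ ?_
  rw [Finset.mem_toList, Set.Finite.mem_toFinset]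
  exact ⟨(t, c), ⟨ht, trivial⟩, t', ht', rfl⟩

/-- The arrows of H\G used by y, z and the generators of H, with their reverses, suffice. The loop
`c` contributes none: should its trace leave this finite part, evading the target only becomes
easier. -/
theorem refuted_of_not_powerCoset [Finite A.EdgeElement] {I : List (Letter V K × Bool) ×
    List (Letter V K × Bool) × List (List (Letter V K × Bool))}
    (hI : ¬ PowerCoset (C.letter v₀) I) : C.Refuted v₀ I := by
  obtain ⟨xw, gw, L⟩ := I
  obtain ⟨xp, xf, hxf, hx⟩ := C.exists_loop_word v₀ (evalWord (C.letter v₀) xw)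
  obtain ⟨gp, gf, hgf, hg⟩ := C.exists_loop_word v₀ (evalWord (C.letter v₀) gw)
  obtain ⟨a, y, c, hyc, hc⟩ := exists_conj_cyclicallyReduced gp
  obtain ⟨cf, hcf, hc'⟩ : ∃ cf, C.PathWord c cf ∧ ((∃ w, cf = vertexWord a w) ∨
      c.length ≠ 0 ∧ Reduced c ∧ Reduced (append c c)) := by
    by_cases hl : c.length = 0
    · cases c with
      | nil k =>
        obtain ⟨w, rfl⟩ := exists_evalWord (C.closure_gen a) k
        exact ⟨_, C.pathWord_vertexWord a w, Or.inl ⟨w, rfl⟩⟩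
      | cons => simp [length] at hl
    · obtain ⟨cf, hcf⟩ := C.exists_pathWord c
      exact ⟨cf, hcf, Or.inr ⟨hl, hc.resolve_left hl⟩⟩
  obtain ⟨yf, hyf⟩ := C.exists_pathWord y
  obtain ⟨zf, hzf⟩ := C.exists_pathWord (append (GPath.inv xp) y)
  set H := wordSubgroup (C.letter v₀) L with hH
  -- the transports
  have hTz : evalWord (C.letter v₀) xw * transport v₀ (append (GPath.inv xp) y) =
      transport v₀ y := by
    rw [transport_append, transport_inv, transport_loop, hx, mul_inv_cancel_left]
  have hTg : evalWord (C.letter v₀) gw * transport v₀ y = transport v₀ y * transport v₀ c := by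
    rw [← hg, ← transport_loop, ← transport_append, transport_congr v₀ hyc, transport_append]
  have hno : ∀ m : ℤ, m ≠ 0 → transport v₀ (append (GPath.inv xp) y) * transport v₀ c ^ m *
      (transport v₀ y)⁻¹ ∉ H := by
    intro m hm hmem
    refine hI ⟨m, hm, ?_⟩
    have h₁ : evalWord (C.letter v₀) gw = transport v₀ y * transport v₀ c * (transport v₀ y)⁻¹ := by
      rw [← hTg, mul_inv_cancel_right]
    dsimp only
    rw [h₁, conj_zpow]
    convert hmem using 1
    rw [← mul_assoc, ← mul_assoc, ← hTz]
    group
  -- the arrows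
  obtain ⟨s₀, hs₀, hs₀'⟩ := C.exists_value (H := H) v₀ 1
  rw [one_mul, inv_mem_iff] at hs₀'
  have hloop : ∀ l : List (Letter V K × Bool), ∃ (p : A.GPath v₀ v₀)
      (f : List (Letter V K × Bool)), C.PathWord p f ∧ loopClass p = evalWord (C.letter v₀) l :=
    fun l => C.exists_loop_word v₀ _
  choose lp lf hlf hl using hloop
  choose Fl tl hFl htl htl' hrunl using fun l => (hlf l).exists_arrows hs₀
  obtain ⟨Fy, ty, hFy, hty, hty', hruny⟩ := hyf.exists_arrows hs₀
  obtain ⟨Fz, tz, hFz, htz, htz', hrunz⟩ := hzf.exists_arrows hs₀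
  let F₀ := L.flatMap Fl ++ (Fy ++ Fz)
  let F := F₀ ++ F₀.map fun t => (t.1.rev, t.2.2, t.2.1)
  have hF₀ : ∀ t ∈ F₀, C.IsArrow H t := by
    intro t ht
    rcases List.mem_append.1 ht with ht | ht
    · obtain ⟨l, -, ht⟩ := List.mem_flatMap.1 ht
      exact hFl l t ht
    · exact (List.mem_append.1 ht).elim (hFy t) (hFz t)
  have hF : ∀ t ∈ F, C.IsArrow H t := by
    intro t ht
    rcases List.mem_append.1 ht with ht | ht
    · exact hF₀ t ht
    · obtain ⟨t, ht₀, rfl⟩ := List.mem_map.1 ht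
      exact (hF₀ t ht₀).rev
  have hrev : ∀ t ∈ F, (t.1.rev, t.2.2, t.2.1) ∈ F := by
    intro t ht
    rcases List.mem_append.1 ht with ht | ht
    · exact List.mem_append_right _ (List.mem_map.2 ⟨t, ht, rfl⟩)
    · obtain ⟨t, ht₀, rfl⟩ := List.mem_map.1 ht
      refine List.mem_append_left _ ?_
      rwa [TotalEdge.rev_rev]
  -- The additional words compare the end of the trace of each generator of H with the base point,
  -- so that these traces visibly close up.
  obtain ⟨S, hXS, hS⟩ := exists_stabilizing_words (C := C) F
    (L.map fun l => (tl l).2 ++ FreeGroup.invRev s₀.2)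
  have hmem : ∀ t ∈ F₀, C.nameArrow H S t ∈ F.map (C.nameArrow H S) := fun t ht =>
    List.mem_map_of_mem (List.mem_append_left _ ht)
  -- the values of the end points
  have hvz : C.value a tz * (transport v₀ (append (GPath.inv xp) y))⁻¹ ∈ H := by
    have := inv_mem (mul_mem (inv_mem hs₀') htz')
    simpa [mul_assoc] using this
  have hvy : C.value a ty * (transport v₀ y)⁻¹ ∈ H := by
    have := inv_mem (mul_mem (inv_mem hs₀') hty')
    simpa [mul_assoc] using this
  have hno' : ∀ m : ℤ, m ≠ 0 →
      C.value a tz * transport v₀ c ^ m * (C.value a ty)⁻¹ ∉ H := by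
    intro m hm h
    refine hno m hm ?_
    convert mul_mem (mul_mem (inv_mem hvz) h) hvy using 1
    group
  refine ⟨F.map (C.nameArrow H S), C.name H S v₀ s₀, valid_map_nameArrow hF hrev hS, ?_,
    a, zf, yf, cf, C.name H S a tz, C.name H S a ty, ?_, ?_, ?_, ?_, ?_⟩
  · intro l hlL
    refine ⟨lf l, C.name H S v₀ (tl l), ?_, hrunl l S _ fun t ht => hmem t ?_, ?_⟩
    · rw [(hlf l).evalWord_eq, transport_loop, hl]
    · exact List.mem_append_left _ (List.mem_flatMap.2 ⟨l, hlL, ht⟩)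
    · have hlH : evalWord (C.letter v₀) l ∈ H := Subgroup.subset_closure ⟨l, hlL, rfl⟩
      refine samePoint_name (htl l) hs₀ ?_ ⟨_, hXS _ (List.mem_map_of_mem hlL), ?_⟩
      · have h₁ := htl' l
        rw [transport_loop, hl] at h₁
        convert mul_mem (inv_mem h₁) (mul_mem (mul_mem hs₀' hlH) (inv_mem hs₀')) using 1
        group
      · rw [evalWord_append, evalWord_invRev]
  · rw [evalWord_append, hzf.evalWord_eq, hyf.evalWord_eq]
    exact hTz
  · rw [evalWord_append, evalWord_append, hyf.evalWord_eq, hcf.evalWord_eq]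
    exact hTg
  · exact hrunz S _ fun t ht => hmem t
      (List.mem_append_right _ (List.mem_append_right _ ht))
  · exact hruny S _ fun t ht => hmem t
      (List.mem_append_right _ (List.mem_append_left _ ht))
  · rcases hc' with ⟨w, rfl⟩ | ⟨hl, hr, hr'⟩
    · refine Or.inl ⟨w, rfl, ?_⟩
      rintro ⟨h₁, m, hm, h₂⟩
      refine hno' m hm ?_
      have h₃ := value_mul_mem_of_mem (k := evalWord (C.gen a) w ^ m) h₁ h₂
      have h₄ : A.vertexHom v₀ a (evalWord (C.gen a) w) = transport v₀ c := by
        rw [← hcf.evalWord_eq, (C.pathWord_vertexWord a w).evalWord_eq]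
        rfl
      rwa [map_zpow, h₄] at h₃
    · refine Or.inr ⟨hcf.exists_run_reducedStep_none_iff.2 hr,
        (hcf.append hcf).exists_run_reducedStep_none_iff.2 hr',
        evades_of_forall hF hcf hl fun n h => ?_, evades_of_forall hF hcf hl fun n h => ?_⟩
      · exact hno' (n + 1 : ℕ) (by omega) (by rwa [zpow_natCast])
      · refine hno' (-(n + 1 : ℕ)) (by omega) ?_
        convert inv_mem h using 1
        rw [zpow_neg, zpow_natCast]
        group

theorem refuted_iff [Finite A.EdgeElement] {I : List (Letter V K × Bool) ×
    List (Letter V K × Bool) × List (List (Letter V K × Bool))} :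
    C.Refuted v₀ I ↔ ¬ PowerCoset (C.letter v₀) I :=
  ⟨fun h => h.not_powerCoset, refuted_of_not_powerCoset⟩

end Coding

end GraphOfGroups

/-! ### Recursive enumerability for words -/

section WordComputability

variable {ι κ G : Type*} [Group G]

/-- All powers of the trivial element coincide, so the power coset problem contains the subgroup
membership problem and, with no subgroup generators, the word problem. -/
theorem mem_wordSubgroup_iff_powerCoset {s : ι → G} {k : List (ι × Bool)}
    {L : List (List (ι × Bool))} :
    evalWord s k ∈ wordSubgroup s L ↔ PowerCoset s (k, [], L) := by
  rw [PowerCoset]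
  simp only [evalWord_nil, one_zpow, mul_one, inv_mem_iff]
  exact ⟨fun h => ⟨1, one_ne_zero, h⟩, fun ⟨_, _, h⟩ => h⟩

theorem evalWord_eq_iff_powerCoset {s : ι → G} {k l : List (ι × Bool)} :
    evalWord s k = evalWord s l ↔ PowerCoset s (k ++ FreeGroup.invRev l, [], []) := by
  rw [← mem_wordSubgroup_iff_powerCoset, wordSubgroup]
  simp [Subgroup.mem_bot, mul_inv_eq_one]

theorem wordSubgroup_map {s : ι → G} {t : κ → G} {τ : List (κ × Bool) → List (ι × Bool)}
    (hτ : ∀ l, evalWord s (τ l) = evalWord t l) (L : List (List (κ × Bool))) :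
    wordSubgroup s (L.map τ) = wordSubgroup t L := by
  simp [wordSubgroup, hτ]

variable [Primcodable ι] [Primcodable κ]

theorem Primrec.invRev_comp {α : Type*} [Primcodable α] {f : α → List (ι × Bool)}
    (hf : Primrec f) : Primrec fun a => FreeGroup.invRev (f a) := by
  refine Primrec.list_reverse.comp (Primrec.list_map hf ?_)
  exact ((Primrec.fst.comp Primrec.snd).pair
    (Primrec.not.comp (Primrec.snd.comp Primrec.snd))).to₂

attribute [fun_prop] Primrec.invRev_comp

/-- Each letter of the finite new alphabet is replaced by a fixed word in the old one. The family
`t` need not generate. -/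
theorem computablePred_powerCoset_of [Finite κ] {s : ι → G} (t : κ → G)
    (hs : Subgroup.closure (Set.range s) = ⊤) (h : ComputablePred (PowerCoset s)) :
    ComputablePred (PowerCoset t) := by
  choose τ hτ using fun x => exists_evalWord hs (evalWord t [x])
  have hτ' := evalWord_flatMap s τ t hτ
  have hprim : Primrec fun l : List (κ × Bool) => l.flatMap τ :=
    Primrec.list_flatMap Primrec.id ((Primrec.dom_finite τ).comp Primrec.snd).to₂
  have hf : Primrec fun I : List (κ × Bool) × List (κ × Bool) × List (List (κ × Bool)) =>
      (I.1.flatMap τ, I.2.1.flatMap τ, I.2.2.map fun l => l.flatMap τ) := by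
    refine (hprim.comp Primrec.fst).pair ((hprim.comp (by fun_prop)).pair
      (Primrec.list_map (by fun_prop) (hprim.comp Primrec.snd).to₂))
  refine ComputablePred.computable_of_manyOneReducible ⟨_, hf.to_comp, fun I => ?_⟩ h
  simp only [PowerCoset, hτ', wordSubgroup_map hτ']

theorem rePred_evalWord_eq {α : Type*} [Primcodable α] {s : ι → G}
    (heq : REPred fun x : List (ι × Bool) × List (ι × Bool) => evalWord s x.1 = evalWord s x.2)
    {f g : α → List (ι × Bool)} (hf : Primrec f) (hg : Primrec g) :
    REPred fun x => evalWord s (f x) = evalWord s (g x) :=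
  heq.comp (f := fun x => (f x, g x)) (hf.pair hg)

end WordComputability

/-! ### Certificates in terms of vertex group instances -/

namespace GraphOfGroups

variable {V : Type u} [SerreGraph.{u, v} V] {A : GraphOfGroups.{u, v, w, x} V}

/-- The origin of an edge. -/
def TotalEdge.src (e : TotalEdge V) : V := e.1

/-- The terminus of an edge. -/
def TotalEdge.tgt (e : TotalEdge V) : V := e.2.1

/-- The edge to which an element of an edge group belongs. -/
def EdgeElement.edge (c : A.EdgeElement) : TotalEdge V := c.1

namespace Coding

variable {K : Type*} {C : A.Coding K} {v₀ : V}

theorem samePoint_iff_powerCoset {a : V} {x y : Point V K} :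
    C.SamePoint a x y ↔
      x.1 = y.1 ∧ PowerCoset (C.gen a) (x.2 ++ FreeGroup.invRev y.2, [], x.1.2) := by
  rw [← mem_wordSubgroup_iff_powerCoset, evalWord_append, evalWord_invRev]
  rfl

/-- With u, v for the words of x, y, one has u w ^ m v⁻¹ = (v u⁻¹)⁻¹ (v w v⁻¹) ^ m. -/
theorem powerHits_iff_powerCoset {a : V} {w : List (K × Bool)} {x y : Point V K} :
    C.PowerHits a w x y ↔ x.1 = y.1 ∧ PowerCoset (C.gen a)
      (y.2 ++ FreeGroup.invRev x.2, y.2 ++ w ++ FreeGroup.invRev y.2, x.1.2) := by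
  refine and_congr_right fun _ => exists_congr fun m => and_congr_right fun _ => ?_
  simp only [evalWord_append, evalWord_invRev, conj_zpow]
  rw [iff_iff_eq]
  congr 1
  group

/-- The dependent indices of the constructors are traded for equations between encodable data, and
implications for disjunctions. Negations then hit only equations and `SamePoint`, whose complements
are enumerable. -/
theorem traceStep_iff {E : List (TotalEdge V × Point V K × Point V K)}
    {s t : V × Option (Point V K)} {l : Letter V K × Bool} : C.TraceStep E s l t ↔
      (∃ x : (V × K) × Bool, l = (Sum.inl x.1, x.2) ∧ s.1 = x.1.1 ∧
        t = (x.1.1, s.2.map fun y => shift y [(x.1.2, x.2)])) ∨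
      ∃ e : TotalEdge V, l = (Sum.inr e, true) ∧ s.1 = e.src ∧ t.1 = e.tgt ∧
        ((s.2 = none ∧ t.2 = none) ∨ ∃ x, s.2 = some x ∧
          ((∃ c : A.EdgeElement, EdgeElement.edge c = e ∧ ∃ t₀, t₀ ∈ E ∧ t₀.1 = e ∧
            C.SamePoint e.src x (shift t₀.2.1 (C.αWord c)) ∧
            t.2 = some (shift t₀.2.2 (C.ωWord c))) ∨
          (t.2 = none ∧ ∀ t₀ ∈ E, ∀ c : A.EdgeElement, t₀.1 ≠ EdgeElement.edge c ∨
            EdgeElement.edge c ≠ e ∨ ¬ C.SamePoint e.src x (shift t₀.2.1 (C.αWord c))))) := by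
  constructor
  · rintro (⟨a, k, β, ζ⟩ | ⟨e, c, x, t, ht, hte, hs⟩ | ⟨e, x, h⟩ | ⟨e⟩)
    · exact Or.inl ⟨((a, k), β), rfl, rfl, rfl⟩
    · exact Or.inr ⟨⟨_, _, e⟩, rfl, rfl, rfl, Or.inr ⟨x, rfl, Or.inl
        ⟨⟨⟨_, _, e⟩, c⟩, rfl, t, ht, hte, hs, rfl⟩⟩⟩
    · refine Or.inr ⟨⟨_, _, e⟩, rfl, rfl, rfl, Or.inr ⟨x, rfl, Or.inr ⟨rfl, fun t ht c => ?_⟩⟩⟩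
      by_cases h₁ : t.1 = c.1
      · by_cases h₂ : c.1 = ⟨_, _, e⟩
        · exact Or.inr (Or.inr (h t ht c h₁ h₂))
        · exact Or.inr (Or.inl h₂)
      · exact Or.inl h₁
    · exact Or.inr ⟨⟨_, _, e⟩, rfl, rfl, rfl, Or.inl ⟨rfl, rfl⟩⟩
  · obtain ⟨s, ζ⟩ := s
    obtain ⟨t, ξ⟩ := t
    rintro (⟨⟨⟨a, k⟩, β⟩, rfl, h₁, h₂⟩ | ⟨⟨a, b, e⟩, rfl, h₁, h₂, h⟩)
    · dsimp only at h₁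
      subst h₁
      rw [h₂]
      exact TraceStep.vertex _ _ _ _
    · dsimp only [TotalEdge.src, TotalEdge.tgt] at h₁ h₂ h
      subst h₁ h₂
      rcases h with ⟨rfl, rfl⟩ | ⟨x, rfl, ⟨⟨e', c⟩, hc, t₀, ht₀, hte, hs, rfl⟩ | ⟨rfl, h⟩⟩
      · exact TraceStep.dead e
      · dsimp only [EdgeElement.edge] at hc
        subst hc
        exact TraceStep.edge e c x t₀ ht₀ hte hs
      · refine TraceStep.stuck e x fun t₀ ht₀ c hc hc' => ?_
        exact ((h t₀ ht₀ c).resolve_left (not_not.2 hc)).resolve_left (not_not.2 hc')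

theorem reducedStep_iff {s t : V × Option (TotalEdge V) × List (K × Bool)}
    {l : Letter V K × Bool} : C.ReducedStep s l t ↔
      (∃ x : (V × K) × Bool, l = (Sum.inl x.1, x.2) ∧ s.1 = x.1.1 ∧
        t = (x.1.1, s.2.1, s.2.2 ++ [(x.1.2, x.2)])) ∨
      ∃ e : TotalEdge V, l = (Sum.inr e, true) ∧ s.1 = e.src ∧ t = (e.tgt, some e, []) ∧
        ∀ c : A.EdgeElement, s.2.1 ≠ some (EdgeElement.edge c) ∨
          (EdgeElement.edge c).rev ≠ e ∨
          ¬ PowerCoset (C.gen (EdgeElement.edge c).tgt)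
            (s.2.2 ++ FreeGroup.invRev (C.ωWord c), [], []) := by
  simp only [← evalWord_eq_iff_powerCoset]
  constructor
  · rintro (⟨a, k, β, o, w⟩ | ⟨e, o, w, h⟩)
    · exact Or.inl ⟨((a, k), β), rfl, rfl, rfl⟩
    · refine Or.inr ⟨⟨_, _, e⟩, rfl, rfl, rfl, fun c => ?_⟩
      by_cases h₁ : o = some c.1
      · by_cases h₂ : c.1.rev = ⟨_, _, e⟩
        · exact Or.inr (Or.inr (h c h₁ h₂))
        · exact Or.inr (Or.inl h₂)
      · exact Or.inl h₁
  · obtain ⟨s, o, w⟩ := s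
    rintro (⟨⟨⟨a, k⟩, β⟩, rfl, h₁, h₂⟩ | ⟨⟨a, b, e⟩, rfl, h₁, rfl, h⟩)
    · dsimp only at h₁
      subst h₁
      rw [h₂]
      exact ReducedStep.vertex _ _ _ _ _
    · dsimp only [TotalEdge.src] at h₁
      subst h₁
      refine ReducedStep.edge e o w fun c hc hc' => ?_
      exact ((h c).resolve_left (not_not.2 hc)).resolve_left (not_not.2 hc')

/-! ### Certificates are recursively enumerable -/

section REPred

variable [Primcodable V] [Primcodable K] [Primcodable (TotalEdge V)] [Primcodable A.EdgeElement]
  {α : Type*} [Primcodable α]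

theorem primrec_shift_comp {f : α → Point V K} {g : α → List (K × Bool)} (hf : Primrec f)
    (hg : Primrec g) : Primrec fun x => shift (f x) (g x) := by
  unfold shift
  fun_prop

theorem primrec_vertexWord_comp {f : α → V} {g : α → List (K × Bool)} (hf : Primrec f)
    (hg : Primrec g) : Primrec fun x => vertexWord (f x) (g x) :=
  Primrec.list_map hg (Primrec.to₂
    (f := fun y : α × K × Bool => ((Sum.inl (f y.1, y.2.1), y.2.2) : Letter V K × Bool))
    (by fun_prop))

theorem primrec_src_comp [Finite (TotalEdge V)] {f : α → TotalEdge V} (hf : Primrec f) :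
    Primrec fun x => (f x).src :=
  (Primrec.dom_finite TotalEdge.src).comp hf

theorem primrec_tgt_comp [Finite (TotalEdge V)] {f : α → TotalEdge V} (hf : Primrec f) :
    Primrec fun x => (f x).tgt :=
  (Primrec.dom_finite TotalEdge.tgt).comp hf

omit [Primcodable V] in
theorem primrec_rev_comp [Finite (TotalEdge V)] {f : α → TotalEdge V} (hf : Primrec f) :
    Primrec fun x => (f x).rev :=
  (Primrec.dom_finite TotalEdge.rev).comp hf

omit [Primcodable V] in
theorem primrec_edge_comp [Finite A.EdgeElement] {f : α → A.EdgeElement} (hf : Primrec f) :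
    Primrec fun x => EdgeElement.edge (f x) :=
  (Primrec.dom_finite EdgeElement.edge).comp hf

omit [Primcodable V] [Primcodable (TotalEdge V)] in
theorem primrec_αWord_comp [Finite A.EdgeElement] (C : A.Coding K) {f : α → A.EdgeElement}
    (hf : Primrec f) : Primrec fun x => C.αWord (f x) :=
  (Primrec.dom_finite C.αWord).comp hf

omit [Primcodable V] [Primcodable (TotalEdge V)] in
theorem primrec_ωWord_comp [Finite A.EdgeElement] (C : A.Coding K) {f : α → A.EdgeElement}
    (hf : Primrec f) : Primrec fun x => C.ωWord (f x) :=
  (Primrec.dom_finite C.ωWord).comp hf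

attribute [fun_prop] primrec_shift_comp primrec_vertexWord_comp primrec_src_comp primrec_tgt_comp
  primrec_rev_comp primrec_edge_comp primrec_αWord_comp primrec_ωWord_comp

omit [Primcodable (TotalEdge V)] [Primcodable A.EdgeElement] in
theorem rePred_powerCoset [Finite V]
    (hdec : ∀ a, ComputablePred (PowerCoset (C.gen a)))
    {f : α → V}
    {g : α → List (K × Bool) × List (K × Bool) × List (List (K × Bool))} (hf : Primrec f)
    (hg : Primrec g) : REPred fun x => PowerCoset (C.gen (f x)) (g x) :=
  (REPred.uncurry_finite fun a => (ComputablePred.computable_iff_re_compl_re'.1 (hdec a)).1).comp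
    (hg.pair hf)

omit [Primcodable (TotalEdge V)] [Primcodable A.EdgeElement] in
theorem rePred_not_powerCoset [Finite V]
    (hdec : ∀ a, ComputablePred (PowerCoset (C.gen a)))
    {f : α → V}
    {g : α → List (K × Bool) × List (K × Bool) × List (List (K × Bool))} (hf : Primrec f)
    (hg : Primrec g) : REPred fun x => ¬ PowerCoset (C.gen (f x)) (g x) :=
  (REPred.uncurry_finite fun a => (ComputablePred.computable_iff_re_compl_re'.1 (hdec a)).2).comp
    (hg.pair hf)

omit [Primcodable A.EdgeElement] in
theorem rePred_samePoint [Finite V]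
    (hdec : ∀ a, ComputablePred (PowerCoset (C.gen a)))
    {f : α → V} {g h : α → Point V K} (hf : Primrec f)
    (hg : Primrec g) (hh : Primrec h) : REPred fun x => C.SamePoint (f x) (g x) (h x) := by
  simp only [samePoint_iff_powerCoset]
  exact (REPred.eq (by fun_prop) (by fun_prop)).and
    (rePred_powerCoset hdec (by fun_prop) (by fun_prop))

omit [Primcodable A.EdgeElement] in
theorem rePred_not_samePoint [Finite V]
    (hdec : ∀ a, ComputablePred (PowerCoset (C.gen a)))
    {f : α → V} {g h : α → Point V K} (hf : Primrec f)
    (hg : Primrec g) (hh : Primrec h) : REPred fun x => ¬ C.SamePoint (f x) (g x) (h x) := by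
  simp only [samePoint_iff_powerCoset, not_and_or]
  exact (REPred.ne (by fun_prop) (by fun_prop)).or
    (rePred_not_powerCoset hdec (by fun_prop) (by fun_prop))

omit [Primcodable A.EdgeElement] in
theorem rePred_not_powerHits [Finite V]
    (hdec : ∀ a, ComputablePred (PowerCoset (C.gen a)))
    {f : α → V} {k : α → List (K × Bool)} {g h : α → Point V K}
    (hf : Primrec f) (hk : Primrec k) (hg : Primrec g) (hh : Primrec h) :
    REPred fun x => ¬ C.PowerHits (f x) (k x) (g x) (h x) := by
  simp only [powerHits_iff_powerCoset, not_and_or]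
  exact (REPred.ne (by fun_prop) (by fun_prop)).or
    (rePred_not_powerCoset hdec (by fun_prop) (by fun_prop))

variable [Finite V] [Finite (TotalEdge V)] [Finite A.EdgeElement]

theorem rePred_traceStep
    (hdec : ∀ a, ComputablePred (PowerCoset (C.gen a)))
    {E : α → List (TotalEdge V × Point V K × Point V K)}
    {s t : α → V × Option (Point V K)} {l : α → Letter V K × Bool} (hE : Primrec E)
    (hs : Primrec s) (hl : Primrec l) (ht : Primrec t) :
    REPred fun x => C.TraceStep (E x) (s x) (l x) (t x) := by
  simp only [traceStep_iff]
  refine .or (.exists (.and (.eq ?_ ?_) (.and (.eq ?_ ?_) (.eq ?_ (.pair ?_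
      (.option_map ?_ (primrec_shift_comp (f := Prod.snd)
        (g := fun y : (α × (V × K) × Bool) × Point V K => [(y.1.2.1.2, y.1.2.2)])
        ?_ ?_).to₂)))))) (.exists (.and (.eq ?_ ?_) (.and (.eq ?_ ?_)
      (.and (.eq ?_ ?_) (.or (.and (.eq ?_ ?_) (.eq ?_ ?_)) (.exists (.and (.eq ?_ ?_)
      (.or (.exists (.and (.eq ?_ ?_) (.exists (.and (.mem ?_ ?_) (.and (.eq ?_ ?_)
        (.and (rePred_samePoint hdec ?_ ?_ ?_) (.eq ?_ ?_)))))))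
      (.and (.eq ?_ ?_) (.forall_mem (.forall_finite (.or (.ne ?_ ?_) (.or (.ne ?_ ?_)
        (rePred_not_samePoint hdec ?_ ?_ ?_)))) ?_)))))))))) <;> fun_prop

theorem rePred_run_traceStep
    (hdec : ∀ a, ComputablePred (PowerCoset (C.gen a)))
    {E : α → List (TotalEdge V × Point V K × Point V K)}
    {s t : α → V × Option (Point V K)} {l : α → List (Letter V K × Bool)} (hE : Primrec E)
    (hs : Primrec s) (hl : Primrec l) (ht : Primrec t) :
    REPred fun x => Run (C.TraceStep (E x)) (s x) (l x) (t x) :=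
  REPred.run (R := fun x => C.TraceStep (E x))
    (rePred_traceStep hdec (by fun_prop) (by fun_prop) (by fun_prop) (by fun_prop)) hs hl ht

theorem rePred_run_reducedStep
    (hdec : ∀ a, ComputablePred (PowerCoset (C.gen a)))
    {s t : α → V × Option (TotalEdge V) × List (K × Bool)}
    {l : α → List (Letter V K × Bool)} (hs : Primrec s) (hl : Primrec l) (ht : Primrec t) :
    REPred fun x => Run C.ReducedStep (s x) (l x) (t x) := by
  refine REPred.run (R := fun _ => C.ReducedStep) ?_ hs hl ht
  simp only [reducedStep_iff]
  refine .or (.exists (.and (.eq ?_ ?_) (.and (.eq ?_ ?_) (.eq ?_ ?_))))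
    (.exists (.and (.eq ?_ ?_) (.and (.eq ?_ ?_) (.and (.eq ?_ ?_) (.forall_finite
      (.or (.ne ?_ ?_) (.or (.ne ?_ ?_) (rePred_not_powerCoset hdec ?_ ?_)))))))) <;> fun_prop

theorem rePred_valid
    (hdec : ∀ a, ComputablePred (PowerCoset (C.gen a)))
    {E : α → List (TotalEdge V × Point V K × Point V K)} (hE : Primrec E) :
    REPred fun x => C.Valid (E x) := by
  have h₁ : REPred fun x => (∀ t ∈ E x, (t.1.rev, t.2.2, t.2.1) ∈ E x) ∧
      ∀ t ∈ E x, ∀ t' ∈ E x, ∀ c : A.EdgeElement, t.1 ≠ EdgeElement.edge c ∨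
        t'.1 ≠ EdgeElement.edge c ∨
        ¬ C.SamePoint (EdgeElement.edge c).src (shift t.2.1 (C.αWord c)) t'.2.1 ∨
          C.SamePoint (EdgeElement.edge c).tgt (shift t.2.2 (C.ωWord c)) t'.2.2 := by
    refine .and (.forall_mem (.mem ?_ ?_) hE) (.forall_mem (.forall_mem (.forall_finite
      (.or (.ne ?_ ?_) (.or (.ne ?_ ?_) (.or (rePred_not_samePoint hdec ?_ ?_ ?_)
        (rePred_samePoint hdec ?_ ?_ ?_))))) ?_) hE) <;> fun_prop
  refine h₁.of_eq fun x => and_congr_right fun _ => forall₂_congr fun t _ =>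
    forall₂_congr fun t' _ => forall_congr' fun c => ?_
  change _ ↔ (t.1 = EdgeElement.edge c → t'.1 = EdgeElement.edge c →
    C.SamePoint (EdgeElement.edge c).src _ _ → C.SamePoint (EdgeElement.edge c).tgt _ _)
  tauto

theorem rePred_evades
    (hdec : ∀ a, ComputablePred (PowerCoset (C.gen a)))
    {E : α → List (TotalEdge V × Point V K × Point V K)} {a : α → V}
    {c : α → List (Letter V K × Bool)} {p r : α → Point V K} (hE : Primrec E) (ha : Primrec a)
    (hc : Primrec c) (hp : Primrec p) (hr : Primrec r) :
    REPred fun x => C.Evades (E x) (a x) (c x) (p x) (r x) := by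
  unfold Evades
  refine .exists (.and (.forall_mem (.or (rePred_run_traceStep hdec ?_ ?_ ?_ ?_)
    (.exists (.and (.mem ?_ ?_) (rePred_run_traceStep hdec ?_ ?_ ?_ ?_)))) ?_)
    (.forall_mem (rePred_not_samePoint hdec ?_ ?_ ?_) ?_)) <;> fun_prop

theorem rePred_stabilizes
    (hdec : ∀ a, ComputablePred (PowerCoset (C.gen a)))
    (heq : REPred fun x : List (Letter V K × Bool) × List (Letter V K × Bool) =>
      evalWord (C.letter v₀) x.1 = evalWord (C.letter v₀) x.2)
    {E : α → List (TotalEdge V × Point V K × Point V K)} {q : α → Point V K}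
    {L : α → List (List (Letter V K × Bool))} (hE : Primrec E) (hq : Primrec q)
    (hL : Primrec L) : REPred fun x => C.Stabilizes v₀ (E x) (q x) (L x) := by
  unfold Stabilizes
  refine .forall_mem (.exists (.exists
    (.and (rePred_evalWord_eq heq ?_ ?_) (.and (rePred_run_traceStep hdec ?_ ?_ ?_ ?_)
      (rePred_samePoint hdec ?_ ?_ ?_))))) ?_ <;> fun_prop

theorem rePred_avoids
    (hdec : ∀ a, ComputablePred (PowerCoset (C.gen a)))
    {E : α → List (TotalEdge V × Point V K × Point V K)} {a : α → V}
    {c : α → List (Letter V K × Bool)} {p r : α → Point V K} (hE : Primrec E) (ha : Primrec a)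
    (hc : Primrec c) (hp : Primrec p) (hr : Primrec r) : REPred fun x =>
      (∃ w, c x = vertexWord (a x) w ∧ ¬ C.PowerHits (a x) w (p x) (r x)) ∨
        ((∃ t, Run C.ReducedStep (a x, none, []) (c x) (a x, t)) ∧
          (∃ t, Run C.ReducedStep (a x, none, []) (c x ++ c x) (a x, t)) ∧
          C.Evades (E x) (a x) (c x) (p x) (r x) ∧ C.Evades (E x) (a x) (c x) (r x) (p x)) := by
  refine .or (.exists (.and (.eq ?_ ?_) (rePred_not_powerHits hdec ?_ ?_ ?_ ?_)))
    (.and (.exists (rePred_run_reducedStep hdec ?_ ?_ ?_))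
      (.and (.exists (rePred_run_reducedStep hdec ?_ ?_ ?_)) (.and
        (rePred_evades hdec ?_ ?_ ?_ ?_ ?_) (rePred_evades hdec ?_ ?_ ?_ ?_ ?_)))) <;> fun_prop

set_option synthInstance.maxSize 1000 in
theorem rePred_refuted
    (hdec : ∀ a, ComputablePred (PowerCoset (C.gen a)))
    (heq : REPred fun x : List (Letter V K × Bool) × List (Letter V K × Bool) =>
      evalWord (C.letter v₀) x.1 = evalWord (C.letter v₀) x.2) : REPred (C.Refuted v₀) := by
  unfold Refuted
  refine .exists (.exists (.and (rePred_valid hdec ?_) (.and (rePred_stabilizes hdec heq ?_ ?_ ?_)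
    (.exists (.exists (.exists (.exists (.exists (.exists
    (.and (rePred_evalWord_eq heq ?_ ?_) (.and (rePred_evalWord_eq heq ?_ ?_)
      (.and (rePred_run_traceStep hdec ?_ ?_ ?_ ?_) (.and (rePred_run_traceStep hdec ?_ ?_ ?_ ?_)
        (rePred_avoids hdec ?_ ?_ ?_ ?_ ?_)))))))))))))) <;> fun_prop

end REPred

end Coding

end GraphOfGroups

/-! ### Enumerating products of words -/

section ProductsOfWords

variable {ι G : Type*} [Group G]

theorem exists_flatten_of_mem_closure {s : ι → G} {S : Set G} {P : List (ι × Bool) → Prop}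
    (hP : ∀ y, y ∈ S ∨ y⁻¹ ∈ S → ∃ t, P t ∧ evalWord s t = y) {h : G}
    (hh : h ∈ Subgroup.closure S) : ∃ T : List (List (ι × Bool)), (∀ t ∈ T, P t) ∧
      evalWord s T.flatten = h := by
  rw [← Subgroup.mem_toSubmonoid, Subgroup.closure_toSubmonoid] at hh
  obtain ⟨l, hl, rfl⟩ := Submonoid.exists_list_of_mem_closure hh
  clear hh
  induction l with
  | nil => exact ⟨[], by simp, by simp⟩
  | cons y l ih =>
    obtain ⟨T, hT, hTl⟩ := ih fun z hz => hl z (List.mem_cons_of_mem _ hz)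
    obtain ⟨t, ht, rfl⟩ := hP y (hl y List.mem_cons_self)
    exact ⟨t :: T, by simpa using ⟨ht, hT⟩, by simp [hTl]⟩

theorem evalWord_flatten_mem {s : ι → G} {H : Subgroup G} {T : List (List (ι × Bool))}
    (h : ∀ t ∈ T, evalWord s t ∈ H) : evalWord s T.flatten ∈ H := by
  induction T with
  | nil => simp [one_mem]
  | cons t T ih =>
    rw [List.flatten_cons, evalWord_append]
    exact mul_mem (h t List.mem_cons_self) (ih fun t' ht' => h t' (List.mem_cons_of_mem _ ht'))

theorem evalWord_flatten_of_forall_eq {s : ι → G} {k : List (ι × Bool)}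
    {T : List (List (ι × Bool))} (h : ∀ t ∈ T, t = k) :
    evalWord s T.flatten = evalWord s k ^ T.length := by
  induction T with
  | nil => simp
  | cons t T ih =>
    rw [List.flatten_cons, evalWord_append, ih fun t' ht' => h t' (List.mem_cons_of_mem _ ht'),
      h t List.mem_cons_self, List.length_cons, pow_succ']

/-- `T` is a product of generators of the subgroup and their inverses, and `R` is the power, with
its sign in `k` and its exponent non-zero because `R` is non-empty. The one condition that is not
primitive recursive is equality of values in the group. -/
theorem powerCoset_iff_exists_flatten {s : ι → G}
    {I : List (ι × Bool) × List (ι × Bool) × List (List (ι × Bool))} : PowerCoset s I ↔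
      ∃ (T R : List (List (ι × Bool))) (k : List (ι × Bool)),
        (∀ t ∈ T, t ∈ I.2.2 ∨ FreeGroup.invRev t ∈ I.2.2) ∧ R ≠ [] ∧ (∀ r ∈ R, r = k) ∧
        (k = I.2.1 ∨ k = FreeGroup.invRev I.2.1) ∧
        evalWord s (I.1 ++ T.flatten) = evalWord s R.flatten := by
  constructor
  · rintro ⟨m, hm, h⟩
    obtain ⟨T, hT, hTh⟩ := exists_flatten_of_mem_closure (s := s)
      (P := fun t => t ∈ I.2.2 ∨ FreeGroup.invRev t ∈ I.2.2) (by
        rintro y (⟨l, hl, rfl⟩ | ⟨l, hl, hy⟩)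
        · exact ⟨l, Or.inl hl, rfl⟩
        · refine ⟨FreeGroup.invRev l, Or.inr (by rwa [FreeGroup.invRev_invRev]), ?_⟩
          rw [evalWord_invRev, hy, inv_inv]) h
    have h₁ : evalWord s (I.1 ++ T.flatten) = evalWord s I.2.1 ^ m := by
      rw [evalWord_append, hTh, mul_inv_cancel_left]
    obtain ⟨n, rfl | rfl⟩ := Int.eq_nat_or_neg m
    · refine ⟨T, List.replicate n I.2.1, I.2.1, hT, by simpa using hm,
        fun r hr => List.eq_of_mem_replicate hr, Or.inl rfl, ?_⟩
      rw [evalWord_flatten_of_forall_eq fun r hr => List.eq_of_mem_replicate hr, h₁]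
      simp
    · refine ⟨T, List.replicate n (FreeGroup.invRev I.2.1), FreeGroup.invRev I.2.1, hT,
        by simpa using hm, fun r hr => List.eq_of_mem_replicate hr, Or.inr rfl, ?_⟩
      rw [evalWord_flatten_of_forall_eq fun r hr => List.eq_of_mem_replicate hr, h₁]
      simp
  · rintro ⟨T, R, k, hT, hR, hRk, hk, h⟩
    have h₁ : evalWord s T.flatten ∈ wordSubgroup s I.2.2 := by
      refine evalWord_flatten_mem fun t ht => ?_
      rcases hT t ht with h | h
      · exact Subgroup.subset_closure ⟨t, h, rfl⟩
      · rw [← inv_mem_iff, ← evalWord_invRev]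
        exact Subgroup.subset_closure ⟨_, h, rfl⟩
    have hR' : (R.length : ℤ) ≠ 0 := by simpa using hR
    rw [evalWord_append, evalWord_flatten_of_forall_eq hRk, ← eq_inv_mul_iff_mul_eq] at h
    rcases hk with rfl | rfl
    · refine ⟨R.length, hR', ?_⟩
      rwa [zpow_natCast, ← h]
    · refine ⟨-R.length, neg_ne_zero.2 hR', ?_⟩
      rw [evalWord_invRev] at h
      rwa [zpow_neg, zpow_natCast, ← inv_pow, ← h]

variable [Primcodable ι]

theorem Primrec.flatten_comp {α β : Type*} [Primcodable α] [Primcodable β]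
    {f : α → List (List β)} (hf : Primrec f) : Primrec fun x => (f x).flatten :=
  Primrec.list_flatten.comp hf

attribute [fun_prop] Primrec.flatten_comp

theorem rePred_powerCoset_of_evalWord_eq {s : ι → G}
    (h : REPred fun x : List (ι × Bool) × List (ι × Bool) => evalWord s x.1 = evalWord s x.2) :
    REPred (PowerCoset s) := by
  have h₁ : REPred fun I : List (ι × Bool) × List (ι × Bool) × List (List (ι × Bool)) =>
      ∃ (T R : List (List (ι × Bool))) (k : List (ι × Bool)),
        (∀ t ∈ T, t ∈ I.2.2 ∨ FreeGroup.invRev t ∈ I.2.2) ∧ R ≠ [] ∧ (∀ r ∈ R, r = k) ∧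
        (k = I.2.1 ∨ k = FreeGroup.invRev I.2.1) ∧
        evalWord s (I.1 ++ T.flatten) = evalWord s R.flatten := by
    refine .exists (.exists (.exists (.and (.forall_mem (.or (.mem ?_ ?_) (.mem ?_ ?_)) ?_)
      (.and (.ne ?_ ?_) (.and (.forall_mem (.eq ?_ ?_) ?_) (.and (.or (.eq ?_ ?_) (.eq ?_ ?_))
        (rePred_evalWord_eq h ?_ ?_))))))) <;> fun_prop
  exact h₁.of_eq fun I => powerCoset_iff_exists_flatten.symm

theorem primrec_freeGroup_reduce [DecidableEq ι] :
    Primrec (FreeGroup.reduce : List (ι × Bool) → List (ι × Bool)) := by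
  let step : ι × Bool → List (ι × Bool) → List (ι × Bool) := fun y l =>
    List.casesOn l [y] fun hd tl => if y.1 = hd.1 ∧ y.2 = !hd.2 then tl else y :: hd :: tl
  have hstep : Primrec fun z : (ι × Bool) × List (ι × Bool) => step z.1 z.2 := by
    refine Primrec.list_casesOn (α := (ι × Bool) × List (ι × Bool)) Primrec.snd
      (g := fun z => [z.1]) (by fun_prop) (h := fun z y => if z.1.1 = y.1.1 ∧ z.1.2 = !y.1.2 then y.2 else z.1 :: y.1 :: y.2) ?_
    refine Primrec.ite ((Primrec.eq.comp (by fun_prop) (by fun_prop)).and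
      (Primrec.eq.comp (by fun_prop) (Primrec.not.comp (by fun_prop)))) (by fun_prop) (by fun_prop)
  have h : Primrec fun l : List (ι × Bool) => l.foldr step [] :=
    Primrec.list_foldr (h := fun _ y => step y.1 y.2) Primrec.id (by fun_prop)
      (hstep.comp Primrec.snd).to₂
  refine h.of_eq fun l => ?_
  induction l with
  | nil => rfl
  | cons y l ih => rw [List.foldr_cons, ih, FreeGroup.reduce.cons]

-- The normal closure consists of products of conjugates of relators and their inverses. Such a
-- product can be guessed, and equality in the free group is checked on reduced words.
omit [Primcodable ι] in
theorem mk_mem_normalClosure_iff [DecidableEq ι] {R : Set (List (ι × Bool))}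
    {f : List (ι × Bool)} : FreeGroup.mk f ∈ Subgroup.normalClosure (FreeGroup.mk '' R) ↔
      ∃ T : List (List (ι × Bool)), (∀ t ∈ T, ∃ c r : List (ι × Bool),
        (r ∈ R ∨ FreeGroup.invRev r ∈ R) ∧ t = c ++ r ++ FreeGroup.invRev c) ∧
        FreeGroup.reduce f = FreeGroup.reduce T.flatten := by
  have hmk : ∀ l : List (ι × Bool), evalWord FreeGroup.of l = FreeGroup.mk l := fun l =>
    FreeGroup.lift_of_apply _
  constructor
  · intro h
    obtain ⟨T, hT, hTf⟩ := exists_flatten_of_mem_closure (s := FreeGroup.of)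
      (P := fun t => ∃ c r : List (ι × Bool), (r ∈ R ∨ FreeGroup.invRev r ∈ R) ∧
        t = c ++ r ++ FreeGroup.invRev c) (by
        have key : ∀ y ∈ Group.conjugatesOfSet (FreeGroup.mk '' R), ∃ c, ∃ r ∈ R,
            FreeGroup.mk c * FreeGroup.mk r * (FreeGroup.mk c)⁻¹ = y := by
          intro y hy
          obtain ⟨_, ⟨r, hr, rfl⟩, hy⟩ := Group.mem_conjugatesOfSet_iff.1 hy
          obtain ⟨⟨c⟩, rfl⟩ := isConj_iff.1 hy
          exact ⟨c, r, hr, rfl⟩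
        rintro y (hy | hy)
        · obtain ⟨c, r, hr, rfl⟩ := key _ hy
          refine ⟨_, ⟨c, r, Or.inl hr, rfl⟩, ?_⟩
          simp [hmk]
        · obtain ⟨c, r, hr, h⟩ := key _ hy
          refine ⟨_, ⟨c, FreeGroup.invRev r, Or.inr (by rwa [FreeGroup.invRev_invRev]), rfl⟩, ?_⟩
          rw [← inv_inv y, ← h]
          simp only [← FreeGroup.mul_mk, ← FreeGroup.inv_mk, hmk]
          group) h
    rw [hmk] at hTf
    exact ⟨T, hT, (FreeGroup.reduce.sound hTf).symm⟩
  · rintro ⟨T, hT, hTf⟩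
    rw [FreeGroup.reduce.exact hTf, ← hmk]
    refine evalWord_flatten_mem fun t ht => ?_
    obtain ⟨c, r, hr, rfl⟩ := hT t ht
    simp only [hmk, ← FreeGroup.mul_mk, ← FreeGroup.inv_mk]
    refine Subgroup.normalClosure_normal.conj_mem _ ?_ _
    rcases hr with hr | hr
    · exact Subgroup.subset_normalClosure ⟨r, hr, rfl⟩
    · rw [← inv_mem_iff, FreeGroup.inv_mk]
      exact Subgroup.subset_normalClosure ⟨_, hr, rfl⟩

theorem rePred_mk_mem_normalClosure {R : Set (List (ι × Bool))} (hR : REPred fun r => r ∈ R) :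
    REPred fun f => FreeGroup.mk f ∈ Subgroup.normalClosure (FreeGroup.mk '' R) := by
  classical
  simp only [mk_mem_normalClosure_iff]
  refine .exists (.and (.forall_mem (.exists (.exists (.and (.or (hR.comp ?_) (hR.comp ?_))
    (.eq ?_ ?_)))) ?_) (.eq (primrec_freeGroup_reduce.comp ?_)
      (primrec_freeGroup_reduce.comp ?_))) <;> fun_prop

end ProductsOfWords

namespace GraphOfGroups

variable {V : Type u} [SerreGraph.{u, v} V] {A : GraphOfGroups.{u, v, w, x} V}

open GPath

namespace Coding

variable {K : Type*} (C : A.Coding K)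

/-! ### A presentation -/

@[simp] theorem vertexWord_append (a : V) (k l : List (K × Bool)) :
    vertexWord a (k ++ l) = vertexWord a k ++ vertexWord a l := List.map_append

@[simp] theorem vertexWord_invRev (a : V) (k : List (K × Bool)) :
    vertexWord a (FreeGroup.invRev k) = FreeGroup.invRev (vertexWord a k) := by
  simp [vertexWord, FreeGroup.invRev, Function.comp_def]

theorem evalWord_letter_vertexWord (v₀ a : V) (k : List (K × Bool)) :
    evalWord (C.letter v₀) (vertexWord a k) = A.vertexHom v₀ a (evalWord (C.gen a) k) := by
  rw [(C.pathWord_vertexWord a k).evalWord_eq, vertexHom_apply]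

/-- Relators for the letters: the relators of the vertex groups, and the relators that belong to
the elementary reductions. -/
def relators : Set (List (Letter V K × Bool)) :=
  {f | (∃ a k, evalWord (C.gen a) k = 1 ∧ f = vertexWord a k) ∨ ∃ c : A.EdgeElement,
    f = [(Sum.inr c.1, true)] ++ vertexWord c.1.2.1 (C.ωWord c) ++ [(Sum.inr c.1.rev, true)] ++
      FreeGroup.invRev (vertexWord c.1.1 (C.αWord c))}

theorem evalWord_letter_of_mem_relators (v₀ : V) {f : List (Letter V K × Bool)}
    (hf : f ∈ C.relators) : evalWord (C.letter v₀) f = 1 := by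
  rcases hf with ⟨a, k, hk, rfl⟩ | ⟨⟨⟨a, b, e⟩, c⟩, rfl⟩
  · rw [evalWord_letter_vertexWord, hk, map_one]
  · simp only [evalWord_append, evalWord_invRev, evalWord_letter_vertexWord,
      evalWord_singleton_true, evalWord_αWord_mk, evalWord_ωWord_mk, mul_inv_eq_one]
    exact edgeElement_mul_vertexHom_mul v₀ e c

/-- The group with the generators `Letter V K` and the relators `C.relators`. -/
abbrev Presented := FreeGroup (Letter V K) ⧸ Subgroup.normalClosure (FreeGroup.mk '' C.relators)

/-- The generators of the presented group. -/
def presentedLetter (l : Letter V K) : C.Presented := QuotientGroup.mk (FreeGroup.of l)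

theorem evalWord_presentedLetter (f : List (Letter V K × Bool)) :
    evalWord C.presentedLetter f = (FreeGroup.mk f : C.Presented) := by
  have := map_evalWord (QuotientGroup.mk' (Subgroup.normalClosure (FreeGroup.mk '' C.relators)))
    FreeGroup.of f
  rw [evalWord, FreeGroup.lift_of_apply] at this
  exact this.symm

theorem evalWord_presentedLetter_eq_one_iff {f : List (Letter V K × Bool)} :
    evalWord C.presentedLetter f = 1 ↔
      FreeGroup.mk f ∈ Subgroup.normalClosure (FreeGroup.mk '' C.relators) := by
  rw [evalWord_presentedLetter, QuotientGroup.eq_one_iff]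

theorem evalWord_presentedLetter_of_mem_relators {f : List (Letter V K × Bool)}
    (hf : f ∈ C.relators) : evalWord C.presentedLetter f = 1 :=
  C.evalWord_presentedLetter_eq_one_iff.2 (Subgroup.subset_normalClosure ⟨f, hf, rfl⟩)

/-- The homomorphism from a vertex group to the presented group. -/
noncomputable def presentedVertex (a : V) (g : A.vertexGroup a) : C.Presented :=
  evalWord C.presentedLetter (vertexWord a (exists_evalWord (C.closure_gen a) g).choose)

/-- Two words with the same value in a vertex group differ by one of the relators, so the chosen
word is immaterial. -/
theorem presentedVertex_evalWord (a : V) (k : List (K × Bool)) :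
    C.presentedVertex a (evalWord (C.gen a) k) = evalWord C.presentedLetter (vertexWord a k) := by
  rw [presentedVertex, ← mul_inv_eq_one, ← evalWord_invRev, ← evalWord_append,
    ← vertexWord_invRev, ← vertexWord_append]
  refine C.evalWord_presentedLetter_of_mem_relators (Or.inl ⟨a, _, ?_, rfl⟩)
  rw [evalWord_append, evalWord_invRev, mul_inv_eq_one]
  exact (exists_evalWord (C.closure_gen a) _).choose_spec

theorem presentedVertex_one (a : V) : C.presentedVertex a 1 = 1 := by
  have := C.presentedVertex_evalWord a []
  simpa [vertexWord] using this

theorem presentedVertex_mul (a : V) (g h : A.vertexGroup a) :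
    C.presentedVertex a (g * h) = C.presentedVertex a g * C.presentedVertex a h := by
  obtain ⟨k, rfl⟩ := exists_evalWord (C.closure_gen a) g
  obtain ⟨l, rfl⟩ := exists_evalWord (C.closure_gen a) h
  rw [← evalWord_append, presentedVertex_evalWord, vertexWord_append, evalWord_append,
    presentedVertex_evalWord, presentedVertex_evalWord]

/-- The value of a path in the presented group. -/
noncomputable def presentedPath : {a b : V} → A.GPath a b → C.Presented
  | a, _, GPath.nil g => C.presentedVertex a g
  | a, _, @GPath.cons _ _ _ _ b _ g e p =>
    C.presentedVertex a g * C.presentedLetter (Sum.inr ⟨a, b, e⟩) * presentedPath p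

theorem presentedPath_lmul {a b : V} (g : A.vertexGroup a) (p : A.GPath a b) :
    C.presentedPath (lmul g p) = C.presentedVertex a g * C.presentedPath p := by
  cases p <;> simp [lmul, presentedPath, presentedVertex_mul, mul_assoc]

theorem presentedLetter_mul_presentedVertex_mul {a b : V} (e : a ⟶ b) (c : A.edgeGroup e) :
    C.presentedLetter (Sum.inr ⟨a, b, e⟩) * C.presentedVertex b (A.ω e c) *
      C.presentedLetter (Sum.inr ⟨b, a, Quiver.reverse e⟩) = C.presentedVertex a (A.α e c) := by
  have := C.evalWord_presentedLetter_of_mem_relators (Or.inr ⟨⟨⟨a, b, e⟩, c⟩, rfl⟩)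
  simp only [evalWord_append, evalWord_invRev, evalWord_singleton_true, mul_inv_eq_one] at this
  rw [← C.evalWord_αWord_mk, ← C.evalWord_ωWord_mk, presentedVertex_evalWord,
    presentedVertex_evalWord]
  exact this

theorem presentedPath_eq_of_red {a b : V} {p q : A.GPath a b} (h : Red p q) :
    C.presentedPath p = C.presentedPath q := by
  induction h with
  | head g e c p =>
    rw [presentedPath_lmul, presentedVertex_mul, ← presentedLetter_mul_presentedVertex_mul]
    simp [presentedPath, mul_assoc]
  | tail g e _ ih => simp [presentedPath, ih]

theorem presentedPath_eq_of_equiv {a b : V} {p q : A.GPath a b} (h : GPath.Equiv p q) :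
    C.presentedPath p = C.presentedPath q := by
  induction h with
  | rel p q h => exact C.presentedPath_eq_of_red h
  | refl p => rfl
  | symm p q _ ih => exact ih.symm
  | trans p q r _ _ ih₁ ih₂ => exact ih₁.trans ih₂

variable {C} in
theorem PathWord.presentedPath_eq {a b : V} {p : A.GPath a b} {f : List (Letter V K × Bool)}
    (h : C.PathWord p f) : C.presentedPath p = evalWord C.presentedLetter f := by
  induction h with
  | nil a => exact C.presentedVertex_one a
  | @vertex a _ k β _ f _ ih =>
    rw [presentedPath_lmul, ih, presentedVertex_evalWord, evalWord_cons _ _ f]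
    rfl
  | edge e _ ih =>
    rw [presentedPath, presentedVertex_one, one_mul, ih, evalWord_cons C.presentedLetter,
      evalWord_singleton_true]

-- No paths are collapsed in the presented group, so its map to the fundamental group can have a
-- kernel. For words spelling loops this is harmless: the value of a path in the presented group is
-- invariant under elementary reductions.
variable {C} in
theorem PathWord.evalWord_eq_one_iff {v₀ : V} {p : A.GPath v₀ v₀} {f : List (Letter V K × Bool)}
    (h : C.PathWord p f) : evalWord (C.letter v₀) f = 1 ↔
      FreeGroup.mk f ∈ Subgroup.normalClosure (FreeGroup.mk '' C.relators) := by
  constructor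
  · intro hf
    rw [h.evalWord_eq, transport_loop] at hf
    have h₁ := C.presentedPath_eq_of_equiv (loopClass_eq_iff.1 (hf : _ = loopClass (GPath.nil 1)))
    rw [h.presentedPath_eq, presentedPath, presentedVertex_one] at h₁
    exact C.evalWord_presentedLetter_eq_one_iff.1 h₁
  · intro hf
    have h₁ : Subgroup.normalClosure (FreeGroup.mk '' C.relators) ≤
        (FreeGroup.lift (C.letter v₀)).ker := by
      refine Subgroup.normalClosure_le_normal ?_
      rintro _ ⟨r, hr, rfl⟩
      exact C.evalWord_letter_of_mem_relators v₀ hr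
    exact h₁ hf

/-- Replacing every letter by a loop at `v₀` with the same value makes any word spell a loop, to
which the presentation applies. -/
theorem exists_pathWord_flatMap (v₀ : V) : ∃ τ : Letter V K × Bool → List (Letter V K × Bool),
    (∀ f, evalWord (C.letter v₀) (f.flatMap τ) = evalWord (C.letter v₀) f) ∧
      ∀ f : List (Letter V K × Bool), ∃ p : A.GPath v₀ v₀, C.PathWord p (f.flatMap τ) := by
  choose p τ hτ hp using fun l => C.exists_loop_word v₀ (evalWord (C.letter v₀) [l])
  refine ⟨τ, evalWord_flatMap _ _ _ fun l => ?_, fun f => ?_⟩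
  · rw [(hτ l).evalWord_eq, transport_loop, hp]
  · induction f with
    | nil => exact ⟨_, PathWord.nil v₀⟩
    | cons l f ih =>
      obtain ⟨q, hq⟩ := ih
      exact ⟨_, (hτ l).append hq⟩

/-! ### The word problem is recursively enumerable -/

variable [Primcodable V] [Primcodable K] [Primcodable (TotalEdge V)] [Primcodable A.EdgeElement]
  [Finite V] [Finite K] [Finite (TotalEdge V)] [Finite A.EdgeElement]
  {C}

omit [Finite K] in
theorem rePred_relators (hdec : ∀ a, ComputablePred (PowerCoset (C.gen a))) :
    REPred fun f => f ∈ C.relators := by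
  have h₁ : REPred fun f : List (Letter V K × Bool) => (∃ a k,
      PowerCoset (C.gen a) (k, [], []) ∧ f = vertexWord a k) ∨ ∃ c : A.EdgeElement,
      f = [(Sum.inr c.edge, true)] ++ vertexWord c.edge.tgt (C.ωWord c) ++
        [(Sum.inr c.edge.rev, true)] ++
        FreeGroup.invRev (vertexWord c.edge.src (C.αWord c)) := by
    refine .or (.exists (.exists (.and (rePred_powerCoset hdec ?_ ?_) (.eq ?_ ?_))))
      (.exists (.eq ?_ ?_)) <;> fun_prop
  refine h₁.of_eq fun f => or_congr_left (exists_congr fun a => exists_congr fun k =>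
    and_congr_left fun _ => ?_)
  rw [← mem_wordSubgroup_iff_powerCoset]
  simp [wordSubgroup, Subgroup.mem_bot]

theorem rePred_evalWord_letter_eq (hdec : ∀ a, ComputablePred (PowerCoset (C.gen a))) (v₀ : V) :
    REPred fun x : List (Letter V K × Bool) × List (Letter V K × Bool) =>
      evalWord (C.letter v₀) x.1 = evalWord (C.letter v₀) x.2 := by
  obtain ⟨τ, hτ, hp⟩ := C.exists_pathWord_flatMap v₀
  have h₁ : Primrec fun f : List (Letter V K × Bool) => f.flatMap τ :=
    Primrec.list_flatMap Primrec.id ((Primrec.dom_finite τ).comp Primrec.snd).to₂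
  have h₂ := (rePred_mk_mem_normalClosure (rePred_relators hdec)).comp
    (f := fun x : List (Letter V K × Bool) × List (Letter V K × Bool) =>
      (x.1 ++ FreeGroup.invRev x.2).flatMap τ) (h₁.comp (by fun_prop))
  refine h₂.of_eq fun x => ?_
  obtain ⟨p, hp⟩ := hp (x.1 ++ FreeGroup.invRev x.2)
  rw [← hp.evalWord_eq_one_iff, hτ, evalWord_append, evalWord_invRev, mul_inv_eq_one]

end Coding

end GraphOfGroups

/-! ### Change of generators and conclusion -/

theorem exists_primcodable_of_finite (α : Type*) [Finite α] : Nonempty (Primcodable α) := by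
  obtain ⟨n, ⟨e⟩⟩ := Finite.exists_equiv_fin α
  exact ⟨Primcodable.ofEquiv (Fin n) e⟩

theorem exists_generators_fin {ι : Type*} [Finite ι] {G : ι → Type*} [∀ a, Group (G a)]
    (h : ∀ a, DecidablePowerCosetMembership (G a)) : ∃ (N : ℕ) (t : ∀ a, Fin N → G a),
      ∀ a, Subgroup.closure (Set.range (t a)) = ⊤ ∧ ComputablePred (PowerCoset (t a)) := by
  choose n s hs hd using h
  obtain ⟨N, hN⟩ := (Set.finite_range n).bddAbove
  -- Padding with trivial elements gives all vertex groups generators with the same index type, as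
  -- `Coding` requires.
  refine ⟨N, fun a i => if hi : i < n a then s a ⟨i, hi⟩ else 1, fun a => ⟨?_, ?_⟩⟩
  · rw [eq_top_iff, ← hs a]
    refine Subgroup.closure_mono ?_
    rintro _ ⟨j, rfl⟩
    exact ⟨Fin.castLE (hN ⟨a, rfl⟩) j, by simp⟩
  · exact computablePred_powerCoset_of _ (hs a)
      ((hd a).of_eq fun I => powerCosetInstance_iff (s a) I)

theorem decidablePowerCosetMembership_of_powerCoset {ι G : Type*} [Group G] [Finite ι]
    [Primcodable ι] {s : ι → G} (hs : Subgroup.closure (Set.range s) = ⊤)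
    (h : ComputablePred (PowerCoset s)) : DecidablePowerCosetMembership G := by
  obtain ⟨n, ⟨e⟩⟩ := Finite.exists_equiv_fin ι
  refine ⟨n, s ∘ e.symm, by rwa [e.symm.surjective.range_comp], ?_⟩
  exact (computablePred_powerCoset_of (s ∘ e.symm) hs h).of_eq fun I =>
    (powerCosetInstance_iff _ I).symm

theorem mainTheorem12 {V : Type u} [SerreGraph.{u, v} V] [Finite V] [∀ a b : V, Finite (a ⟶ b)]
    (A : GraphOfGroups.{u, v, w, x} V) (v₀ : V)
    (hedge : ∀ {a b : V} (e : a ⟶ b), Finite (A.edgeGroup e))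
    (hvertex : ∀ a : V, DecidablePowerCosetMembership (A.vertexGroup a)) :
    DecidablePowerCosetMembership (A.FundamentalGroup v₀) := by
  obtain ⟨N, t, ht⟩ := exists_generators_fin hvertex
  obtain ⟨C, hC⟩ := GraphOfGroups.exists_coding t fun a => (ht a).1
  have hdec : ∀ a, ComputablePred (PowerCoset (C.gen a)) := fun a => hC ▸ (ht a).2
  have : ∀ e : GraphOfGroups.TotalEdge V, Finite (A.edgeGroup e.2.2) := fun e => hedge e.2.2
  obtain ⟨_⟩ := exists_primcodable_of_finite V
  obtain ⟨_⟩ := exists_primcodable_of_finite (GraphOfGroups.TotalEdge V)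
  obtain ⟨_⟩ := exists_primcodable_of_finite A.EdgeElement
  have heq := GraphOfGroups.Coding.rePred_evalWord_letter_eq hdec v₀
  -- Post's theorem: positive instances are enumerated through the word problem, negative ones
  -- through certificates.
  refine decidablePowerCosetMembership_of_powerCoset (C.closure_range_letter v₀)
    (ComputablePred.computable_iff_re_compl_re'.2 ⟨rePred_powerCoset_of_evalWord_eq heq, ?_⟩)
  exact (GraphOfGroups.Coding.rePred_refuted hdec heq).of_eq fun I => C.refuted_iff
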